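/- **Setting.** Let $\mathbf{RPC}$ be the category of rational polyhedral cones: an object $\sigma$ is a finitely generated free abelian group $N$ with a strictly convex finite intersection of rational half spaces of $N\otimes\mathbb{R}$ that spans $N\otimes\mathbb{R}$; a morphism is a homomorphism of the lattices that maps one cone into the other. $S_\sigma$ denotes the dual monoid of integral functionals on $N$ that are nonnegative on $\sigma$. A tropical curve $\Gamma$ of genus $g$ with $n$ marked legs over $\sigma$ is a connected finite vertex-weighted graph of genus $b_1+\sum_v h(v)=g$ with legs $l_1,\dots,l_n$, together with a nonzero length $d(e)\in S_\sigma$ for every finite edge $e$; it is stable if $2h(v)-2+\mathrm{val}(v)>0$ for every vertex $v$. Let $\mathcal{M}_{g,n}^{\mathrm{trop}}$ be the category, fibered in groupoids over $\mathbf{RPC}$, of pairs $(\sigma,\Gamma)$ with $\Gamma$ stable; a morphism $(\sigma',\Gamma')\to(\sigma,\Gamma)$ is a morphism $f:\sigma'\to\sigma$ with a morphism of weighted marked graphs (edge contractions followed by an isomorphism) from the graph of $\Gamma$ to the graph of $\Gamma'$ that contracts exactly the edges $e$ with $f^*d(e)=0$ and maps every other edge $e$ to an edge of length $f^*d(e)$.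 For a tropical curve $\Gamma$ over $\sigma$, the cone space $c:\mathrm{Cone}(\Gamma)\to\sigma$ is glued from $\mathrm{Cone}(v)=\sigma$ for every vertex $v$, $\mathrm{Cone}(l)=\sigma\times\mathbb{R}_{\ge0}$ for every leg $l$ and $\mathrm{Cone}(e)=\sigma\times_{\mathbb{R}_{\ge0}}\mathbb{R}_{\ge0}^2$ for every finite edge $e$ (via $d(e):\sigma\to\mathbb{R}_{\ge0}$ and $(a,b)\mapsto a+b$), where the face $\sigma\times0$ of $\mathrm{Cone}(l)$, respectively each of the two faces $a=0$, $b=0$ of $\mathrm{Cone}(e)$, is identified with $\mathrm{Cone}$ of the root of the corresponding flag; $q$ is the quotient map. For a section $s$ of $c$ put $H(s)=h(v)$ if $s(\sigma)=q(\mathrm{Cone}(v))$ for a vertex $v$, and $H(s)=0$ if there is no such $v$. The universal curve $\mathcal{X}_{g,n}^{\mathrm{trop}}\to\mathcal{M}_{g,n}^{\mathrm{trop}}$ is the fibered category of triples $(\sigma,\Gamma,s)$ with $(\sigma,\Gamma)$ in $\mathcal{M}_{g,n}^{\mathrm{trop}}$ and $s$ a section of $\mathrm{Cone}(\Gamma)\to\sigma$.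 Let $2g-2+n>0$. The forgetful morphism $\pi:\mathcal{M}_{g,n+1}^{\mathrm{trop}}\to\mathcal{M}_{g,n}^{\mathrm{trop}}$ deletes the leg $l_{n+1}$; if the result is not stable, then the vertex $v$ that carried $l_{n+1}$ has weight $0$ and two remaining flags, and $v$ is deleted with these flags: two edges at $v$ are replaced by one edge whose length is the sum of their lengths, an edge and a leg $l_i$ at $v$ are replaced by one leg $l_i$. Let $h_{n+1}$ be the function that assigns to an object of $\mathcal{M}_{g,n+1}^{\mathrm{trop}}$ the weight of the vertex to which $l_{n+1}$ is attached. **Theorem.** Let $g,n\ge0$ with $2g-2+n>0$. (a) The categories $\mathcal{X}_{g,n}^{\mathrm{trop}}$ and $\mathcal{M}_{g,n+1}^{\mathrm{trop}}$ are isomorphic over $\mathcal{M}_{g,n}^{\mathrm{trop}}$: there are an equivalence $\Phi:\mathcal{X}_{g,n}^{\mathrm{trop}}\to\mathcal{M}_{g,n+1}^{\mathrm{trop}}$ of categories over $\mathbf{RPC}$ and an isomorphism of $\pi\circ\Phi$ with the projection $\mathcal{X}_{g,n}^{\mathrm{trop}}\to\mathcal{M}_{g,n}^{\mathrm{trop}}$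 (over the identities of $\mathbf{RPC}$), such that $h_{n+1}(\Phi(\sigma,\Gamma,s))=H(s)$. (b) Every stable tropical curve $\Gamma$ of genus $g$ with $n$ marked legs over a cone $\sigma$ corresponds to a morphism $u_{[\Gamma]}:\sigma\to\mathcal{M}_{g,n}^{\mathrm{trop}}$, i.e. a morphism with an isomorphism $u_{[\Gamma]}(\mathrm{id}_\sigma)\cong\Gamma$ over $\sigma$. For every choice of these morphisms there are morphisms $U_{[\Gamma]}$ and $2$-cartesian diagrams $$\begin{array}{ccc}\mathrm{Cone}(\Gamma)&\xrightarrow{\;U_{[\Gamma]}\;}&\mathcal{M}_{g,n+1}^{\mathrm{trop}}\\ {\scriptstyle c}\downarrow&&\downarrow{\scriptstyle\pi}\\ \sigma&\xrightarrow{\;u_{[\Gamma]}\;}&\mathcal{M}_{g,n}^{\mathrm{trop}}\end{array}$$ such that $H(s)=h_{n+1}(U_{[\Gamma]}(s))$ for every section $s$ of $\mathrm{Cone}(\Gamma)\to\sigma$, and such that the diagrams depend contravariantly on $\sigma$: for every morphism $\varphi:(\sigma',\Gamma')\to(\sigma,\Gamma)$, the two morphisms $\mathrm{Cone}(\Gamma)\times_\sigma\sigma'\to\mathcal{M}_{g,n+1}^{\mathrm{trop}}$,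 one the projection to $\mathrm{Cone}(\Gamma)$ followed by $U_{[\Gamma]}$, the other the pullback map $\mathrm{Cone}(\Gamma)\times_\sigma\sigma'\to\mathrm{Cone}(\Gamma')$ followed by $U_{[\Gamma']}$, are isomorphic by an isomorphism that after $\pi$ is compatible with $\varphi$ and with the natural morphisms from $\pi(U_{[\Gamma]}(x))$ to $\Gamma$ and from $\pi(U_{[\Gamma']}(x'))$ to $\Gamma'$. -/

import Mathlib

open CategoryTheory Opposite
open scoped TensorProduct

noncomputable section

namespace TropicalModuli

/-! ### Rational polyhedral cones -/

/-- The real-linear extension `N ⊗ ℝ → ℝ` of an integral functional `u : N → ℤ`. -/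
def realPairing {N : Type} [AddCommGroup N] (u : N →ₗ[ℤ] ℤ) : (ℝ ⊗[ℤ] N) →ₗ[ℝ] ℝ :=
  (TensorProduct.AlgebraTensorModule.rid ℤ ℝ ℝ).toLinearMap ∘ₗ u.baseChange ℝ

lemma realPairing_tmul {N : Type} [AddCommGroup N] (u : N →ₗ[ℤ] ℤ) (c : ℝ) (x : N) :
    realPairing u (c ⊗ₜ x) = (u x : ℝ) * c := by
  simp [realPairing]

lemma realPairing_add {N : Type} [AddCommGroup N] (u v : N →ₗ[ℤ] ℤ) :
    realPairing (u + v) = realPairing u + realPairing v := by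
  simp [realPairing, LinearMap.baseChange_add, LinearMap.comp_add]

lemma realPairing_zero {N : Type} [AddCommGroup N] :
    realPairing (0 : N →ₗ[ℤ] ℤ) = 0 := by
  simp [realPairing]

lemma realPairing_comp {N N' : Type} [AddCommGroup N] [AddCommGroup N'] (u : N' →ₗ[ℤ] ℤ)
    (f : N →ₗ[ℤ] N') (x : ℝ ⊗[ℤ] N) :
    realPairing (u ∘ₗ f) x = realPairing u (f.baseChange ℝ x) := by
  simp [realPairing, LinearMap.baseChange_comp]

lemma realPairing_injective {N : Type} [AddCommGroup N] {u : N →ₗ[ℤ] ℤ}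
    (h : realPairing u = 0) : u = 0 := by
  ext x
  have := LinearMap.congr_fun h (1 ⊗ₜ x)
  rw [realPairing_tmul] at this
  simpa using this

/-- A rational polyhedral cone: a finitely generated free abelian group `N` together with a
strictly convex finite intersection of rational half spaces in `N ⊗ ℝ` that spans `N ⊗ ℝ`
(equivalently, whose dual monoid is sharp). -/
structure RPC where
  /-- the lattice -/
  N : Type
  [grp : AddCommGroup N]
  [free : Module.Free ℤ N]
  [finite : Module.Finite ℤ N]
  /-- the cone in `N ⊗ ℝ` -/
  cone : Set (ℝ ⊗[ℤ] N)
  polyhedral : ∃ s : Finset (N →ₗ[ℤ] ℤ), cone = {x | ∀ u ∈ s, 0 ≤ realPairing u x}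
  salient : ∀ x ∈ cone, -x ∈ cone → x = 0
  spans : Submodule.span ℝ cone = ⊤

attribute [instance] RPC.grp RPC.free RPC.finite

/-- Morphisms of cones: homomorphisms of lattices mapping one cone into the other. -/
@[ext]
structure RPC.Hom (σ τ : RPC) where
  /-- the homomorphism of lattices -/
  map : σ.N →ₗ[ℤ] τ.N
  mapsTo : ∀ x ∈ σ.cone, map.baseChange ℝ x ∈ τ.cone

instance : Category RPC where
  Hom := RPC.Hom
  id σ := ⟨LinearMap.id, fun x hx => by simpa using hx⟩
  comp f g := ⟨g.map ∘ₗ f.map, fun x hx => by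
    simpa [LinearMap.baseChange_comp] using g.mapsTo _ (f.mapsTo x hx)⟩

@[simp] lemma RPC.id_map (σ : RPC) : RPC.Hom.map (𝟙 σ) = LinearMap.id := rfl

@[simp] lemma RPC.comp_map {σ τ ρ : RPC} (f : σ ⟶ τ) (g : τ ⟶ ρ) :
    RPC.Hom.map (f ≫ g) = g.map ∘ₗ f.map := rfl

/-- The dual monoid `S_σ`: the integral functionals that are nonnegative on `σ`. -/
def RPC.S (σ : RPC) : AddSubmonoid (σ.N →ₗ[ℤ] ℤ) where
  carrier := {u | ∀ x ∈ σ.cone, 0 ≤ realPairing u x}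
  zero_mem' := fun x _ => by simp [realPairing_zero]
  add_mem' := fun {u v} hu hv x hx => by
    simpa [realPairing_add] using add_nonneg (hu x hx) (hv x hx)

/-- The dual monoid of a cone is sharp. -/
lemma RPC.sharp {σ : RPC} {u v : σ.S} (h : u + v = 0) : u = 0 := by
  have huv : realPairing u.1 + realPairing v.1 = 0 := by
    rw [← realPairing_add]
    have : u.1 + v.1 = 0 := congrArg Subtype.val h
    rw [this, realPairing_zero]
  have h0 : realPairing u.1 = 0 := by
    have hle : Submodule.span ℝ σ.cone ≤ LinearMap.ker (realPairing u.1) := by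
      rw [Submodule.span_le]
      intro x hx
      have h1 := u.2 x hx
      have h2 := v.2 x hx
      have h3 : realPairing u.1 x + realPairing v.1 x = 0 := LinearMap.congr_fun huv x
      have : realPairing u.1 x = 0 := by linarith
      simpa using this
    rw [σ.spans] at hle
    exact LinearMap.ker_eq_top.mp (top_le_iff.mp hle)
  exact Subtype.ext (realPairing_injective h0)

lemma RPC.add_eq_zero {σ : RPC} {u v : σ.S} : u + v = 0 ↔ u = 0 ∧ v = 0 := by
  constructor
  · intro h
    exact ⟨RPC.sharp h, RPC.sharp ((add_comm v u).trans h)⟩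
  · rintro ⟨rfl, rfl⟩
    simp

/-- The homomorphism `f^* : S_τ → S_σ` of dual monoids induced by a morphism of cones. -/
def RPC.pull {σ τ : RPC} (f : σ ⟶ τ) : τ.S →+ σ.S where
  toFun u := ⟨u.1 ∘ₗ f.map, fun x hx => by
    rw [realPairing_comp]
    exact u.2 _ (f.mapsTo x hx)⟩
  map_zero' := Subtype.ext (LinearMap.zero_comp _)
  map_add' u v := Subtype.ext (LinearMap.add_comp _ _ _)

lemma RPC.pull_id {σ : RPC} (u : σ.S) : RPC.pull (𝟙 σ) u = u := rfl

lemma RPC.pull_comp {σ τ ρ : RPC} (f : σ ⟶ τ) (g : τ ⟶ ρ) (u : ρ.S) :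
    RPC.pull (f ≫ g) u = RPC.pull f (RPC.pull g u) := rfl

/-! ### Weighted marked graphs -/

/-- A finite `n`-marked vertex-weighted graph. The set `X` consists of the vertices and the flags,
`r` is the root map and `ι` the involution. The vertices are the elements in the image of `r`,
that is, the fixed points of `r`; all other elements are flags. The weight function is extended by
zero from the vertices to `X`, and the marking is a bijection onto the set of legs. -/
structure MGraph (n : ℕ) where
  /-- vertices and flags -/
  X : Type
  [finite : Finite X]
  /-- the root map -/
  r : X → X
  /-- the involution -/
  ι : X → X
  r_r : ∀ x, r (r x) = r x
  ι_ι : ∀ x, ι (ι x) = x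
  ι_vertex : ∀ x, r x = x → ι x = x
  /-- the vertex weights -/
  h : X → ℕ
  h_flag : ∀ x, r x ≠ x → h x = 0
  /-- the marking -/
  mark : Fin n → X
  mark_inj : Function.Injective mark
  mark_leg : ∀ x, (r x ≠ x ∧ ι x = x) ↔ ∃ i, mark i = x

attribute [instance] MGraph.finite

namespace MGraph

variable {n : ℕ}

/-- `x` is a vertex. -/
def IsVertex (G : MGraph n) (x : G.X) : Prop := G.r x = x

/-- `x` is a leg, i.e. a flag fixed by the involution. -/
def IsLeg (G : MGraph n) (x : G.X) : Prop := ¬ G.IsVertex x ∧ G.ι x = x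

/-- The valence of a vertex: the number of flags emanating from it. -/
def valence (G : MGraph n) (v : G.X) : ℕ := {f | ¬ G.IsVertex f ∧ G.r f = v}.ncard

/-- The finite edges `{f, ι f}` with `f ≠ ι f` that are contained in a subgraph `S`. -/
def edges (G : MGraph n) (S : Set G.X) : Set (Set G.X) :=
  {e | ∃ f ∈ S, G.ι f ≠ f ∧ e = {f, G.ι f}}

/-- A subgraph `S` (a set of vertices and flags) is connected: it is nonempty and any two of its
vertices are joined by a chain of flags of `S`. -/
def Connected (G : MGraph n) (S : Set G.X) : Prop :=
  S.Nonempty ∧ ∀ v ∈ S, ∀ w ∈ S, G.IsVertex v → G.IsVertex w →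
    Relation.ReflTransGen (fun a b => ∃ f ∈ S, G.r f = a ∧ G.r (G.ι f) = b) v w

/-- The genus `b₁ + ∑ h(v)` of a connected subgraph `S`, where `b₁ = #E - #V + 1`. -/
def genus (G : MGraph n) (S : Set G.X) : ℤ :=
  ((G.edges S).ncard : ℤ) - ({v ∈ S | G.IsVertex v}.ncard : ℤ) + 1 + ((∑ᶠ v ∈ S, G.h v : ℕ) : ℤ)

/-- Stability: `2 h(v) - 2 + val(v) > 0` for every vertex. -/
def Stable (G : MGraph n) : Prop :=
  ∀ v, G.IsVertex v → 0 < 2 * (G.h v : ℤ) - 2 + (G.valence v : ℤ)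

/-- A morphism of weighted marked graphs (a weighted edge contraction followed by an
isomorphism). -/
@[ext]
structure Hom (G H : MGraph n) where
  /-- the map on vertices and flags -/
  toFun : G.X → H.X
  map_r : ∀ x, toFun (G.r x) = H.r (toFun x)
  map_ι : ∀ x, toFun (G.ι x) = H.ι (toFun x)
  map_mark : ∀ i, toFun (G.mark i) = H.mark i
  flag : ∀ f, ¬ H.IsVertex f → ∃! x, toFun x = f
  fiber_connected : ∀ v, H.IsVertex v → G.Connected (toFun ⁻¹' {v})
  fiber_genus : ∀ v, H.IsVertex v → G.genus (toFun ⁻¹' {v}) = (H.h v : ℤ)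

lemma isVertex_r (G : MGraph n) (x : G.X) : G.IsVertex (G.r x) := G.r_r x

lemma isLeg_mark (G : MGraph n) (i : Fin n) : G.IsLeg (G.mark i) :=
  (G.mark_leg _).2 ⟨i, rfl⟩

lemma IsVertex.ι_eq {G : MGraph n} {x : G.X} (hx : G.IsVertex x) : G.ι x = x := G.ι_vertex x hx

lemma isVertex_ι {G : MGraph n} {x : G.X} : G.IsVertex (G.ι x) ↔ G.IsVertex x := by
  constructor
  · intro h
    have := h.ι_eq
    rw [G.ι_ι] at this
    rwa [← this] at h
  · intro h
    rwa [h.ι_eq]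

/-- Local Euler characteristic contribution. -/
def chi (G : MGraph n) (x : G.X) : ℤ :=
  open Classical in if G.IsVertex x then 2 * (G.h x : ℤ) - 2 else 1

lemma chi_vertex {G : MGraph n} {x : G.X} (hx : G.IsVertex x) :
    G.chi x = 2 * (G.h x : ℤ) - 2 := if_pos hx

lemma chi_flag {G : MGraph n} {x : G.X} (hx : ¬ G.IsVertex x) : G.chi x = 1 := if_neg hx

lemma finsum_mem_one_int {α : Type} [Finite α] (S : Set α) :
    ∑ᶠ x ∈ S, (1 : ℤ) = (S.ncard : ℤ) := by
  rw [finsum_mem_eq_finite_toFinset_sum _ (Set.toFinite S), Finset.sum_const,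
    Set.ncard_eq_toFinset_card S (Set.toFinite S)]
  simp

lemma ncard_halfEdges (G : MGraph n) (S : Set G.X) (hS : ∀ x ∈ S, G.ι x ∈ S) :
    ({x ∈ S | G.ι x ≠ x}.ncard : ℤ) = 2 * ((G.edges S).ncard : ℤ) := by
  classical
  have := Fintype.ofFinite G.X
  set s : Finset G.X := Finset.univ.filter (fun x => x ∈ S ∧ G.ι x ≠ x) with hs
  have h1 : {x ∈ S | G.ι x ≠ x} = (s : Set G.X) := by ext; simp [hs]
  have h2 : G.edges S = ((s.image (fun f => ({f, G.ι f} : Set G.X)) : Finset (Set G.X)) :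
      Set (Set G.X)) := by
    ext e
    simp only [edges, Set.mem_ofPred_eq, Finset.coe_image, Set.mem_image, Finset.mem_coe, hs,
      Finset.mem_filter, Finset.mem_univ, true_and]
    constructor
    · rintro ⟨f, h, h', rfl⟩; exact ⟨f, ⟨h, h'⟩, rfl⟩
    · rintro ⟨f, ⟨h, h'⟩, rfl⟩; exact ⟨f, h, h', rfl⟩
  rw [h1, h2, Set.ncard_coe_finset, Set.ncard_coe_finset]
  rw [Finset.card_eq_sum_card_image (fun f => ({f, G.ι f} : Set G.X)) s]
  rw [Finset.sum_const_nat (m := 2)]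
  · push_cast; ring
  · intro e he
    obtain ⟨f, hf, rfl⟩ := Finset.mem_image.1 he
    have hf' : f ∈ S ∧ G.ι f ≠ f := by simpa [hs] using hf
    have : s.filter (fun a => ({a, G.ι a} : Set G.X) = {f, G.ι f}) = {f, G.ι f} := by
      ext a
      simp only [Finset.mem_filter, Finset.mem_insert, Finset.mem_singleton]
      constructor
      · rintro ⟨_, h⟩
        have : a ∈ ({f, G.ι f} : Set G.X) := by rw [← h]; simp
        simpa using this
      · rintro (rfl | rfl)
        · exact ⟨hf, rfl⟩
        · refine ⟨?_, ?_⟩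
          · simp only [hs, Finset.mem_filter, Finset.mem_univ, true_and, G.ι_ι]
            exact ⟨hS _ hf'.1, fun h => hf'.2 h.symm⟩
          · rw [G.ι_ι, Set.pair_comm]
    rw [this, Finset.card_pair (fun h => hf'.2 h.symm)]

/-- Euler characteristic formula for a subgraph. -/
lemma finsum_chi (G : MGraph n) (S : Set G.X) (hS : ∀ x ∈ S, G.ι x ∈ S) :
    ∑ᶠ x ∈ S, G.chi x = 2 * G.genus S - 2 + ({x ∈ S | G.IsLeg x}.ncard : ℤ) := by
  have hd : S = {x ∈ S | G.IsVertex x} ∪ ({x ∈ S | G.IsLeg x} ∪ {x ∈ S | G.ι x ≠ x}) := by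
    ext x
    simp only [Set.mem_union, Set.mem_ofPred_eq, IsLeg]
    tauto
  have hd1 : Disjoint {x ∈ S | G.IsVertex x} ({x ∈ S | G.IsLeg x} ∪ {x ∈ S | G.ι x ≠ x}) := by
    rw [Set.disjoint_left]
    rintro x ⟨_, hx⟩ (⟨_, hx'⟩ | ⟨_, hx'⟩)
    · exact hx'.1 hx
    · exact hx' hx.ι_eq
  have hd2 : Disjoint {x ∈ S | G.IsLeg x} {x ∈ S | G.ι x ≠ x} := by
    rw [Set.disjoint_left]
    rintro x ⟨_, hx⟩ ⟨_, hx'⟩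
    exact hx' hx.2
  have hw : ((∑ᶠ v ∈ S, G.h v : ℕ) : ℤ) = ∑ᶠ v ∈ {x ∈ S | G.IsVertex x}, (G.h v : ℤ) := by
    rw [finsum_mem_eq_finite_toFinset_sum _ (Set.toFinite S),
      finsum_mem_eq_finite_toFinset_sum _ (Set.toFinite {x ∈ S | G.IsVertex x})]
    push_cast
    symm
    apply Finset.sum_subset
    · intro x; simp only [Set.Finite.mem_toFinset]; exact fun h => h.1
    · intro x hx hx'
      simp only [Set.Finite.mem_toFinset, Set.mem_ofPred_eq, not_and] at hx hx'
      simp [G.h_flag x (hx' hx)]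
  have e1 : ∑ᶠ x ∈ {x ∈ S | G.IsVertex x}, G.chi x
      = 2 * ((∑ᶠ v ∈ S, G.h v : ℕ) : ℤ) - 2 * ({v ∈ S | G.IsVertex v}.ncard : ℤ) := by
    rw [hw, ← finsum_mem_one_int, mul_finsum_mem,
      mul_finsum_mem, ← finsum_mem_sub_distrib _ _ (Set.toFinite _)]
    exact finsum_mem_congr rfl (fun x hx => by rw [chi_vertex hx.2]; ring)
  have e2 : ∑ᶠ x ∈ {x ∈ S | G.IsLeg x}, G.chi x = ({x ∈ S | G.IsLeg x}.ncard : ℤ) := by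
    rw [← finsum_mem_one_int]
    exact finsum_mem_congr rfl (fun x hx => chi_flag hx.2.1)
  have e3 : ∑ᶠ x ∈ {x ∈ S | G.ι x ≠ x}, G.chi x = 2 * ((G.edges S).ncard : ℤ) := by
    rw [← G.ncard_halfEdges S hS, ← finsum_mem_one_int]
    exact finsum_mem_congr rfl (fun x hx => chi_flag (fun h => hx.2 h.ι_eq))
  conv_lhs => rw [hd]
  rw [finsum_mem_union hd1 (Set.toFinite _) (Set.toFinite _),
    finsum_mem_union hd2 (Set.toFinite _) (Set.toFinite _), e1, e2, e3, genus]
  ring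

lemma finsum_preimage {α β : Type} [Finite α] [Finite β] (g : α → β) (φ : α → ℤ) (ψ : β → ℤ)
    (T : Set β) (h : ∀ y ∈ T, ∑ᶠ x ∈ g ⁻¹' {y}, φ x = ψ y) :
    ∑ᶠ x ∈ g ⁻¹' T, φ x = ∑ᶠ y ∈ T, ψ y := by
  have : g ⁻¹' T = ⋃ y ∈ T, g ⁻¹' {y} := by ext; simp
  rw [this, finsum_mem_biUnion _ (Set.toFinite T) (fun _ _ => Set.toFinite _)]
  · exact finsum_mem_congr rfl (fun y hy => h y hy)
  · intro y _ y' _ hyy'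
    rw [Function.onFun, Set.disjoint_left]
    intro x hx hx'
    exact hyy' (hx.symm.trans hx')

lemma ncard_legs (G : MGraph n) : {x ∈ Set.univ | G.IsLeg x}.ncard = n := by
  have : {x ∈ Set.univ | G.IsLeg x} = G.mark '' Set.univ := by
    ext x
    simp only [Set.mem_univ, true_and, Set.mem_ofPred_eq, Set.image_univ, Set.mem_range]
    exact G.mark_leg x
  rw [this, Set.ncard_image_of_injective _ G.mark_inj, Set.ncard_univ, Nat.card_fin]

lemma finsum_chi_univ (G : MGraph n) :
    ∑ᶠ x ∈ Set.univ, G.chi x = 2 * G.genus Set.univ - 2 + n := by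
  rw [G.finsum_chi _ (fun _ _ => Set.mem_univ _), ncard_legs]

lemma finsum_chi_star (G : MGraph n) {v : G.X} (hv : G.IsVertex v) :
    ∑ᶠ x ∈ {x | G.r x = v}, G.chi x = 2 * (G.h v : ℤ) - 2 + G.valence v := by
  have hd : {x | G.r x = v} = {v} ∪ {f | ¬ G.IsVertex f ∧ G.r f = v} := by
    ext x
    simp only [Set.mem_ofPred_eq, Set.mem_union, Set.mem_singleton_iff, IsVertex]
    constructor
    · intro h
      by_cases h' : G.r x = x
      · exact Or.inl (h'.symm.trans h)
      · exact Or.inr ⟨h', h⟩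
    · rintro (rfl | h)
      · exact hv
      · exact h.2
  have hdj : Disjoint {v} {f | ¬ G.IsVertex f ∧ G.r f = v} := by
    rw [Set.disjoint_singleton_left]
    exact fun h => h.1 hv
  rw [hd, finsum_mem_union hdj (Set.toFinite _) (Set.toFinite _), finsum_mem_singleton,
    chi_vertex hv, valence, ← finsum_mem_one_int]
  congr 1
  exact finsum_mem_congr rfl (fun x hx => chi_flag hx.1)

namespace Hom

variable {G H K : MGraph n}

lemma isVertex (g : Hom G H) {x : G.X} (hx : G.IsVertex x) : H.IsVertex (g.toFun x) := by
  rw [IsVertex, ← g.map_r, hx]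

lemma isLeg (g : Hom G H) {x : G.X} (hx : G.IsLeg x) : H.IsLeg (g.toFun x) := by
  obtain ⟨i, rfl⟩ := (G.mark_leg x).1 hx
  rw [g.map_mark]
  exact H.isLeg_mark i

lemma injOn (g : Hom G H) {x y : G.X} (h : g.toFun x = g.toFun y)
    (hx : ¬ H.IsVertex (g.toFun x)) : x = y :=
  (g.flag _ hx).unique rfl h.symm

lemma finsum_fiber_chi (g : Hom G H) (y : H.X) :
    ∑ᶠ x ∈ g.toFun ⁻¹' {y}, G.chi x = H.chi y := by
  by_cases hy : H.IsVertex y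
  · rw [G.finsum_chi, g.fiber_genus y hy, chi_vertex hy]
    · have : {x ∈ g.toFun ⁻¹' {y} | G.IsLeg x} = ∅ := by
        ext x
        simp only [Set.mem_ofPred_eq, Set.mem_empty_iff_false, iff_false, not_and]
        intro hx hl
        rw [Set.mem_preimage, Set.mem_singleton_iff] at hx
        exact (g.isLeg hl).1 (hx ▸ hy)
      rw [this]; simp
    · intro x hx
      rw [Set.mem_preimage, Set.mem_singleton_iff] at *
      rw [g.map_ι, hx, hy.ι_eq]
  · obtain ⟨x, hx, hx'⟩ := g.flag y hy
    have : g.toFun ⁻¹' {y} = {x} := by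
      ext z
      simp only [Set.mem_preimage, Set.mem_singleton_iff]
      exact ⟨fun h => hx' z h, fun h => h ▸ hx⟩
    rw [this, finsum_mem_singleton, chi_flag hy, chi_flag]
    intro h
    apply hy
    rw [← hx]
    exact g.isVertex h

/-- The genus condition on a fibre in terms of Euler characteristics. -/
lemma genus_of_finsum {g : G.X → H.X} {v : H.X} (hv : H.IsVertex v)
    (hι : ∀ x, g (G.ι x) = H.ι (g x)) (hl : ∀ x, G.IsLeg x → H.IsLeg (g x))
    (h : ∑ᶠ x ∈ g ⁻¹' {v}, G.chi x = H.chi v) : G.genus (g ⁻¹' {v}) = (H.h v : ℤ) := by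
  rw [G.finsum_chi, chi_vertex hv] at h
  · have : {x ∈ g ⁻¹' {v} | G.IsLeg x} = ∅ := by
      ext x
      simp only [Set.mem_ofPred_eq, Set.mem_empty_iff_false, iff_false, not_and]
      intro hx hl'
      rw [Set.mem_preimage, Set.mem_singleton_iff] at hx
      exact (hl x hl').1 (hx ▸ hv)
    rw [this] at h
    simp only [Set.ncard_empty, Nat.cast_zero, add_zero] at h
    linarith
  · intro x hx
    rw [Set.mem_preimage, Set.mem_singleton_iff] at *
    rw [hι, hx, hv.ι_eq]

/-- The preimage of a connected subgraph is connected. -/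
lemma connected_preimage (g : Hom G H) {T : Set H.X}
    (hr : ∀ y ∈ T, H.r y ∈ T) (hι : ∀ y ∈ T, H.ι y ∈ T) (hT : H.Connected T) :
    G.Connected (g.toFun ⁻¹' T) := by
  have fib : ∀ u v : G.X, G.IsVertex u → G.IsVertex v → g.toFun u = g.toFun v →
      g.toFun u ∈ T → Relation.ReflTransGen
        (fun a b => ∃ f ∈ g.toFun ⁻¹' T, G.r f = a ∧ G.r (G.ι f) = b) u v := by
    intro u v hu hv huv huT
    have := (g.fiber_connected _ (g.isVertex hu)).2 u rfl v huv.symm hu hv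
    refine Relation.ReflTransGen.mono ?_ _ _ this
    rintro a b ⟨f, hf, h⟩
    refine ⟨f, ?_, h⟩
    rw [Set.mem_preimage, Set.mem_singleton_iff] at hf
    rw [Set.mem_preimage, hf]; exact huT
  constructor
  · obtain ⟨y, hy⟩ := hT.1
    obtain ⟨x, hx⟩ := (g.fiber_connected (H.r y) (H.isVertex_r y)).1
    refine ⟨x, ?_⟩
    rw [Set.mem_preimage, Set.mem_singleton_iff] at hx
    rw [Set.mem_preimage, hx]
    exact hr _ hy
  · intro u hu v hv huV hvV
    have key : ∀ y, Relation.ReflTransGen (fun a b => ∃ f ∈ T, H.r f = a ∧ H.r (H.ι f) = b)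
        (g.toFun u) y → y ∈ T ∧ ∀ v, G.IsVertex v → g.toFun v = y → Relation.ReflTransGen
        (fun a b => ∃ f ∈ g.toFun ⁻¹' T, G.r f = a ∧ G.r (G.ι f) = b) u v := by
      intro y hy
      induction hy with
      | refl => exact ⟨hu, fun v hv h => fib u v huV hv h.symm hu⟩
      | tail _ hstep ih =>
        obtain ⟨f, hf, h1, h2⟩ := hstep
        refine ⟨h2 ▸ hr _ (hι _ hf), ?_⟩
        intro v hv hvy
        by_cases hfv : H.IsVertex f
        · apply ih.2 v hv
          rw [hvy, ← h2, hfv.ι_eq, h1]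
        · obtain ⟨x, hx, _⟩ := g.flag f hfv
          have h3 := ih.2 (G.r x) (G.isVertex_r x) (by rw [g.map_r, hx, h1])
          have hxT : x ∈ g.toFun ⁻¹' T := by rw [Set.mem_preimage, hx]; exact hf
          refine (h3.tail ⟨x, hxT, rfl, rfl⟩).trans ?_
          apply fib _ _ (G.isVertex_r _) hv
          · rw [g.map_r, g.map_ι, hx, h2, hvy]
          · rw [g.map_r, g.map_ι, hx]
            exact hr _ (hι _ hf)
    exact (key _ (hT.2 _ hu _ hv (g.isVertex huV) (g.isVertex hvV))).2 v hvV rfl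

/-- The identity. -/
def id (G : MGraph n) : Hom G G where
  toFun := fun x => x
  map_r _ := rfl
  map_ι _ := rfl
  map_mark _ := rfl
  flag f _ := ⟨f, rfl, fun _ h => h⟩
  fiber_connected v _ := ⟨⟨v, rfl⟩, by
    rintro a ha b hb _ _
    have : a = b := Eq.trans (show a = v from ha) (show b = v from hb).symm
    subst this
    exact Relation.ReflTransGen.refl⟩
  fiber_genus v hv := by
    apply genus_of_finsum (H := G) (g := fun x => x) hv (fun _ => rfl) (fun _ h => h)
    have : (fun x : G.X => x) ⁻¹' {v} = {v} := rfl
    rw [this, finsum_mem_singleton]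

/-- Composition. -/
def comp (g : Hom G H) (k : Hom H K) : Hom G K where
  toFun := fun x => k.toFun (g.toFun x)
  map_r x := by rw [g.map_r, k.map_r]
  map_ι x := by rw [g.map_ι, k.map_ι]
  map_mark i := by rw [g.map_mark, k.map_mark]
  flag f hf := by
    obtain ⟨y, hy, hy'⟩ := k.flag f hf
    have hyv : ¬ H.IsVertex y := fun h => hf (hy ▸ k.isVertex h)
    obtain ⟨x, hx, hx'⟩ := g.flag y hyv
    exact ⟨x, by simp only [hx, hy], fun z hz => hx' z (hy' _ hz)⟩
  fiber_connected v hv := by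
    apply g.connected_preimage (T := k.toFun ⁻¹' {v}) _ _ (k.fiber_connected v hv)
    · intro y hy
      rw [Set.mem_preimage, Set.mem_singleton_iff] at *
      rw [k.map_r, hy, hv]
    · intro y hy
      rw [Set.mem_preimage, Set.mem_singleton_iff] at *
      rw [k.map_ι, hy, hv.ι_eq]
  fiber_genus v hv := by
    apply genus_of_finsum (g := fun x => k.toFun (g.toFun x)) hv
      (fun x => by rw [g.map_ι, k.map_ι]) (fun _ h => k.isLeg (g.isLeg h))
    have := finsum_preimage g.toFun G.chi H.chi (k.toFun ⁻¹' {v})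
      (fun y _ => g.finsum_fiber_chi y)
    rw [k.finsum_fiber_chi] at this
    exact this

end Hom

end MGraph

/-! ### Tropical curves and their moduli -/

/-- A tropical curve of genus `g` with `n` marked legs and edge lengths in `P`. The length
function is extended from the finite edges to all of `X`: `d x` is the length of the edge
containing `x` if `x` is a flag of a finite edge, and zero if `x` is a vertex or a leg. -/
structure TropicalCurve (g n : ℕ) (P : Type) [AddCommMonoid P] extends MGraph n where
  connected : toMGraph.Connected Set.univ
  genus_eq : toMGraph.genus Set.univ = (g : ℤ)
  /-- the edge lengths -/
  d : X → P
  d_ι : ∀ x, d (ι x) = d x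
  d_eq_zero : ∀ x, d x = 0 ↔ ι x = x

/-- The objects `(σ, Γ)` of the moduli stack of tropical curves: a cone `σ` and a stable tropical
curve of genus `g` with `n` marked legs and edge lengths in `S_σ`. -/
structure MTrop (g n : ℕ) where
  /-- the base -/
  cone : RPC
  /-- the tropical curve -/
  curve : TropicalCurve g n cone.S
  stable : curve.toMGraph.Stable

namespace MTrop

variable {g n : ℕ}

/-- A morphism `(σ, Γ) → (σ', Γ')`: a morphism `σ → σ'` of cones and a morphism of graphs from the
graph of `Γ'` to the graph of `Γ` that contracts exactly the edges whose length becomes zero and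
is compatible with the lengths of the other edges. -/
@[ext]
structure Hom (A B : MTrop g n) where
  /-- the morphism of cones -/
  base : A.cone ⟶ B.cone
  /-- the morphism of graphs -/
  graph : MGraph.Hom B.curve.toMGraph A.curve.toMGraph
  contracts_iff : ∀ x, B.curve.ι x ≠ x →
    (A.curve.IsVertex (graph.toFun x) ↔ RPC.pull base (B.curve.d x) = 0)
  length_eq : ∀ x, B.curve.ι x ≠ x → A.curve.ι (graph.toFun x) ≠ graph.toFun x →
    RPC.pull base (B.curve.d x) = A.curve.d (graph.toFun x)

lemma Hom.d_eq {A B : MTrop g n} (φ : Hom A B) (x : B.curve.X) :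
    A.curve.d (φ.graph.toFun x) = RPC.pull φ.base (B.curve.d x) := by
  by_cases hx : B.curve.ι x = x
  · rw [(B.curve.d_eq_zero x).2 hx, map_zero, A.curve.d_eq_zero, ← φ.graph.map_ι, hx]
  · by_cases hv : A.curve.ι (φ.graph.toFun x) = φ.graph.toFun x
    · rw [(A.curve.d_eq_zero _).2 hv]
      symm
      rw [← φ.contracts_iff x hx]
      by_contra hn
      obtain ⟨i, hi⟩ := (A.curve.mark_leg _).1 ⟨hn, hv⟩
      rw [← φ.graph.map_mark] at hi
      have := φ.graph.injOn hi.symm hn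
      exact hx (this ▸ (B.curve.isLeg_mark i).2)
    · exact (φ.length_eq x hx hv).symm

/-- A morphism from the condition `d (g x) = f^* d(x)` for all `x`. -/
def Hom.mk' {A B : MTrop g n} (base : A.cone ⟶ B.cone)
    (graph : MGraph.Hom B.curve.toMGraph A.curve.toMGraph)
    (h : ∀ x, A.curve.d (graph.toFun x) = RPC.pull base (B.curve.d x)) : Hom A B where
  base := base
  graph := graph
  contracts_iff x hx := by
    rw [← h, A.curve.d_eq_zero]
    constructor
    · exact fun hv => hv.ι_eq
    · intro hv
      by_contra hn
      obtain ⟨i, hi⟩ := (A.curve.mark_leg _).1 ⟨hn, hv⟩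
      rw [← graph.map_mark] at hi
      have := graph.injOn hi.symm hn
      exact hx (this ▸ (B.curve.isLeg_mark i).2)
  length_eq x _ _ := (h x).symm

instance : Category (MTrop g n) where
  Hom := Hom
  id A := Hom.mk' (𝟙 A.cone) (MGraph.Hom.id _) (fun _ => rfl)
  comp φ ψ := Hom.mk' (φ.base ≫ ψ.base) (ψ.graph.comp φ.graph) (fun x => by
    rw [RPC.pull_comp, ← ψ.d_eq, ← φ.d_eq]; rfl)

lemma hom_ext {A B : MTrop g n} {φ ψ : A ⟶ B} (h : Hom.base φ = Hom.base ψ)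
    (h' : ∀ x, φ.graph.toFun x = ψ.graph.toFun x) : φ = ψ :=
  Hom.ext h (MGraph.Hom.ext (funext h'))

@[simp] lemma id_base (A : MTrop g n) : Hom.base (𝟙 A) = 𝟙 A.cone := rfl

@[simp] lemma comp_base {A B C : MTrop g n} (φ : A ⟶ B) (ψ : B ⟶ C) :
    Hom.base (φ ≫ ψ) = φ.base ≫ ψ.base := rfl

@[simp] lemma id_graph (A : MTrop g n) (x : A.curve.X) : (Hom.graph (𝟙 A)).toFun x = x := rfl

@[simp] lemma comp_graph {A B C : MTrop g n} (φ : A ⟶ B) (ψ : B ⟶ C) (x : C.curve.X) :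
    (Hom.graph (φ ≫ ψ)).toFun x = φ.graph.toFun (ψ.graph.toFun x) := rfl

/-- The projection `(σ, Γ) ↦ σ`. -/
def proj (g n : ℕ) : MTrop g n ⥤ RPC where
  obj A := A.cone
  map φ := φ.base

/-- The moduli stack of tropical curves, as a category over the category of cones. -/
abbrev based (g n : ℕ) : BasedCategory.{0, 1} RPC := BasedCategory.ofFunctor (proj g n)

end MTrop

/-! ### Forgetting the last leg of a graph -/

namespace MGraph

variable {n : ℕ}

/-- The last leg. -/
def lastLeg (G : MGraph (n + 1)) : G.X := G.mark (Fin.last n)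

/-- The vertex at which the last leg is attached. -/
def lastVertex (G : MGraph (n + 1)) : G.X := G.r G.lastLeg

/-- The graph obtained by deleting the last leg is unstable: the stability condition fails at the
vertex from which the last leg was emanating, whose valence drops by one. -/
def Bad (G : MGraph (n + 1)) : Prop :=
  ¬ (0 < 2 * (G.h G.lastVertex : ℤ) - 2 + ((G.valence G.lastVertex : ℤ) - 1))

/-- The vertices and flags that remain: the last leg is deleted, and if the result is unstable,
then the vertex from which it was emanating is deleted together with its flags. -/
def keep (G : MGraph (n + 1)) : Set G.X :=
  {x | x ≠ G.lastLeg ∧ ¬ (G.Bad ∧ G.r x = G.lastVertex)}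

/-- If `y` is a flag at the vertex that is deleted, the other flag at this vertex, different from
the last leg. -/
def other (G : MGraph (n + 1)) (y : G.X) : G.X :=
  open Classical in
  if h : ∃ z, ¬ G.IsVertex z ∧ G.r z = G.lastVertex ∧ z ≠ G.lastLeg ∧ z ≠ y then h.choose else y

/-- If `x` belongs to an edge whose other end is the vertex that is deleted, the flag pointing out
of this vertex on the other side; otherwise `x` itself. -/
def partner (G : MGraph (n + 1)) (x : G.X) : G.X :=
  open Classical in if G.Bad ∧ G.r (G.ι x) = G.lastVertex then G.other (G.ι x) else x

/-- The new involution: the two edges at the deleted vertex are joined to one edge, respectively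
the edge and the leg at the deleted vertex are joined to one leg. -/
def forgetInv (G : MGraph (n + 1)) (x : G.X) : G.X :=
  open Classical in if G.IsLeg (G.partner x) then x else G.ι (G.partner x)

/-- The new marking: if the `i`-th leg was attached to the deleted vertex, the remaining flag of
the edge at this vertex becomes the `i`-th leg. -/
def forgetMark (G : MGraph (n + 1)) (i : Fin n) : G.X :=
  open Classical in
  if G.Bad ∧ G.r (G.mark i.castSucc) = G.lastVertex then G.ι (G.other (G.mark i.castSucc))
  else G.mark i.castSucc

/-- The standing assumptions for forgetting a leg. -/
structure Adm (G : MGraph (n + 1)) : Prop where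
  stable : G.Stable
  connected : G.Connected Set.univ
  big : 1 < ∑ᶠ x ∈ Set.univ, G.chi x

lemma isVertex_lastVertex (G : MGraph (n + 1)) : G.IsVertex G.lastVertex := G.isVertex_r _

lemma isLeg_lastLeg (G : MGraph (n + 1)) : G.IsLeg G.lastLeg := G.isLeg_mark _

lemma bad_iff (G : MGraph (n + 1)) :
    G.Bad ↔ ∑ᶠ x ∈ {x | G.r x = G.lastVertex}, G.chi x ≤ 1 := by
  rw [G.finsum_chi_star G.isVertex_lastVertex, Bad]
  constructor <;> intro h <;> linarith

/-- The situation at the deleted vertex. -/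
structure Pair (G : MGraph (n + 1)) (y z : G.X) : Prop where
  y_flag : ¬ G.IsVertex y
  z_flag : ¬ G.IsVertex z
  r_y : G.r y = G.lastVertex
  r_z : G.r z = G.lastVertex
  y_ne : y ≠ G.lastLeg
  z_ne : z ≠ G.lastLeg
  ne : z ≠ y
  all : ∀ w, G.r w = G.lastVertex → w = G.lastVertex ∨ w = G.lastLeg ∨ w = y ∨ w = z
  y_out : G.ι y = y ∨ G.r (G.ι y) ≠ G.lastVertex
  z_out : G.ι z = z ∨ G.r (G.ι z) ≠ G.lastVertex
  out : ¬ (G.ι y = y ∧ G.ι z = z)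

lemma Pair.symm {G : MGraph (n + 1)} {y z : G.X} (h : G.Pair y z) : G.Pair z y where
  y_flag := h.z_flag
  z_flag := h.y_flag
  r_y := h.r_z
  r_z := h.r_y
  y_ne := h.z_ne
  z_ne := h.y_ne
  ne := h.ne.symm
  all w hw := by rcases h.all w hw with h | h | h | h <;> simp [h]
  y_out := h.z_out
  z_out := h.y_out
  out := fun ⟨h1, h2⟩ => h.out ⟨h2, h1⟩

lemma Adm.exists_out {G : MGraph (n + 1)} (hG : G.Adm) (hb : G.Bad) :
    ∃ y, G.r y = G.lastVertex ∧ G.r (G.ι y) ≠ G.lastVertex := by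
  by_contra hcon
  push Not at hcon
  have hall : ∀ w, G.IsVertex w → w = G.lastVertex := by
    intro w hw
    have := hG.connected.2 G.lastVertex (Set.mem_univ _) w (Set.mem_univ _)
      G.isVertex_lastVertex hw
    induction this with
    | refl => rfl
    | tail _ hs ih =>
      obtain ⟨f, -, h1, h2⟩ := hs
      rw [← h2]
      apply hcon
      rw [h1]
      exact ih (h1 ▸ G.isVertex_r f)
  have : {x | G.r x = G.lastVertex} = Set.univ := by
    ext x
    simp only [Set.mem_ofPred_eq, Set.mem_univ, iff_true]
    exact hall _ (G.isVertex_r x)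
  have h1 := G.bad_iff.1 hb
  rw [this] at h1
  have := hG.big
  linarith

lemma Adm.h_lastVertex {G : MGraph (n + 1)} (hG : G.Adm) (hb : G.Bad) :
    G.h G.lastVertex = 0 ∧ ∃ a b, G.Pair a b := by
  obtain ⟨a, ha, ha'⟩ := hG.exists_out hb
  have hp := G.isLeg_lastLeg
  have haf : ¬ G.IsVertex a := fun h => ha' (by rw [h.ι_eq, ha])
  have hap : a ≠ G.lastLeg := by
    rintro rfl
    exact ha' (by rw [hp.2, ha])
  set F : Set G.X := {f | ¬ G.IsVertex f ∧ G.r f = G.lastVertex} with hF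
  have hval : G.valence G.lastVertex = F.ncard := rfl
  have hsub : {G.lastLeg, a} ⊆ F := by
    rintro x (rfl | rfl)
    · exact ⟨hp.1, rfl⟩
    · exact ⟨haf, ha⟩
  have h2 : 2 ≤ F.ncard := by
    rw [← Set.ncard_pair hap.symm]
    exact Set.ncard_le_ncard hsub (Set.toFinite _)
  have hst := hG.stable _ G.isVertex_lastVertex
  have hb' := hb
  rw [Bad, hval] at hb'
  rw [hval] at hst
  have hh : G.h G.lastVertex = 0 := by omega
  refine ⟨hh, ?_⟩
  have h3 : F.ncard = 3 := by omega
  have hd : (F \ {G.lastLeg, a}).ncard = 1 := by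
    rw [Set.ncard_sdiff hsub (Set.toFinite _), Set.ncard_pair hap.symm, h3]
  obtain ⟨b, hb1⟩ := Set.ncard_eq_one.1 hd
  have hbm : b ∈ F \ {G.lastLeg, a} := by rw [hb1]; rfl
  have hbp : b ≠ G.lastLeg := fun h => hbm.2 (by simp [h])
  have hba : b ≠ a := fun h => hbm.2 (by simp [h])
  have hall : ∀ w, G.r w = G.lastVertex → w = G.lastVertex ∨ w = G.lastLeg ∨ w = a ∨ w = b := by
    intro w hw
    by_cases hwv : G.IsVertex w
    · exact Or.inl (hwv.symm.trans hw)
    · by_cases hwF : w ∈ F \ {G.lastLeg, a}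
      · rw [hb1] at hwF
        exact Or.inr (Or.inr (Or.inr hwF))
      · by_contra hne
        push Not at hne
        apply hwF
        exact ⟨⟨hwv, hw⟩, by rintro (h | h); exacts [hne.2.1 h, hne.2.2.1 h]⟩
  refine ⟨a, b, ⟨haf, hbm.1.1, ha, hbm.1.2, hap, hbp, hba, hall, Or.inr ha', ?_, ?_⟩⟩
  · by_contra hcon
    push Not at hcon
    rcases hall _ hcon.2 with h | h | h | h
    · have : G.IsVertex (G.ι b) := h ▸ G.isVertex_lastVertex
      exact hbm.1.1 (isVertex_ι.1 this)
    · apply hbp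
      rw [← G.ι_ι b, h, hp.2]
    · apply ha'
      rw [← h, G.ι_ι, hbm.1.2]
    · exact hcon.1 h
  · rintro ⟨h, -⟩
    exact ha' (by rw [h, ha])

lemma Adm.pair {G : MGraph (n + 1)} (hG : G.Adm) (hb : G.Bad) {y : G.X}
    (hy : ¬ G.IsVertex y) (hr : G.r y = G.lastVertex) (hp : y ≠ G.lastLeg) :
    G.Pair y (G.other y) ∧ G.other (G.other y) = y := by
  obtain ⟨-, a, b, hab⟩ := hG.h_lastVertex hb
  have key : ∀ a b, G.Pair a b → G.other a = b := by
    intro a b hab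
    have hex : ∃ z, ¬ G.IsVertex z ∧ G.r z = G.lastVertex ∧ z ≠ G.lastLeg ∧ z ≠ a :=
      ⟨b, hab.z_flag, hab.r_z, hab.z_ne, hab.ne⟩
    have h := hex.choose_spec
    rw [other, dif_pos hex]
    rcases hab.all _ h.2.1 with h' | h' | h' | h'
    · exact absurd (by rw [h']; exact G.isVertex_lastVertex) h.1
    · exact absurd h' h.2.2.1
    · exact absurd h' h.2.2.2
    · exact h'
  have h1 := key _ _ hab
  have h2 := key _ _ hab.symm
  rcases hab.all y hr with h | h | h | h
  · exact absurd (h ▸ G.isVertex_lastVertex) hy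
  · exact absurd h hp
  · rw [h, h1]; exact ⟨hab, h2⟩
  · rw [h, h2]; exact ⟨hab.symm, h1⟩

lemma partner_of_not {G : MGraph (n + 1)} {x : G.X}
    (h : ¬ (G.Bad ∧ G.r (G.ι x) = G.lastVertex)) : G.partner x = x := if_neg h

lemma forgetInv_of_not {G : MGraph (n + 1)} {x : G.X}
    (h : ¬ (G.Bad ∧ G.r (G.ι x) = G.lastVertex)) : G.forgetInv x = G.ι x := by
  rw [forgetInv, partner_of_not h]
  split_ifs with hl
  · exact hl.2.symm
  · rfl

/-- The flags that are affected by the stabilization. -/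
structure Spec (G : MGraph (n + 1)) (x : G.X) : Prop where
  bad : G.Bad
  r_ι : G.r (G.ι x) = G.lastVertex
  pair : G.Pair (G.ι x) (G.partner x)
  other : G.other (G.partner x) = G.ι x
  r_ne : G.r x ≠ G.lastVertex
  not_vertex : ¬ G.IsVertex x

lemma Adm.spec {G : MGraph (n + 1)} (hG : G.Adm) {x : G.X} (hx : x ∈ G.keep)
    (h : G.Bad ∧ G.r (G.ι x) = G.lastVertex) : G.Spec x := by
  have hne : G.r x ≠ G.lastVertex := fun h' => hx.2 ⟨h.1, h'⟩
  have hf : ¬ G.IsVertex x := by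
    intro hv
    apply hne
    rw [← h.2, hv.ι_eq]
  have hp : G.ι x ≠ G.lastLeg := by
    intro h'
    apply hx.1
    rw [← G.ι_ι x, h', G.isLeg_lastLeg.2]
  obtain ⟨h1, h2⟩ := hG.pair h.1 (fun h' => hf (isVertex_ι.1 h')) h.2 hp
  have hpar : G.partner x = G.other (G.ι x) := if_pos h
  exact ⟨h.1, h.2, hpar ▸ h1, hpar ▸ h2, hne, hf⟩

lemma Spec.mem_keep {G : MGraph (n + 1)} {x : G.X} (h : G.Spec x) : x ∈ G.keep := by
  refine ⟨?_, fun h' => h.r_ne h'.2⟩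
  rintro rfl
  exact h.r_ne rfl

lemma Spec.forgetInv_leg {G : MGraph (n + 1)} {x : G.X} (_ : G.Spec x)
    (hl : G.ι (G.partner x) = G.partner x) : G.forgetInv x = x := by
  by_cases h' : G.IsVertex (G.partner x)
  · rename_i h; exact absurd h' h.pair.z_flag
  · exact if_pos ⟨h', hl⟩

lemma Spec.forgetInv_edge {G : MGraph (n + 1)} {x : G.X}
    (hl : G.ι (G.partner x) ≠ G.partner x) : G.forgetInv x = G.ι (G.partner x) :=
  if_neg (fun h' => hl h'.2)

/-- The flag on the other side of the deleted vertex. -/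
lemma Adm.spec_symm {G : MGraph (n + 1)} (hG : G.Adm) {x : G.X} (h : G.Spec x)
    (hl : G.ι (G.partner x) ≠ G.partner x) :
    G.Spec (G.ι (G.partner x)) ∧ G.partner (G.ι (G.partner x)) = G.ι x := by
  have hr := h.pair.z_out.resolve_left hl
  have hk : G.ι (G.partner x) ∈ G.keep := by
    refine ⟨?_, fun h' => hr h'.2⟩
    intro h'
    apply h.pair.z_ne
    rw [← G.ι_ι (G.partner x), h', G.isLeg_lastLeg.2]
  have hs := hG.spec hk ⟨h.bad, by rw [G.ι_ι]; exact h.pair.r_z⟩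
  refine ⟨hs, ?_⟩
  rw [← h.other]
  have : G.partner (G.ι (G.partner x)) = G.other (G.ι (G.ι (G.partner x))) :=
    if_pos ⟨hs.bad, hs.r_ι⟩
  rw [this, G.ι_ι]

lemma Adm.forgetInv_mem {G : MGraph (n + 1)} (hG : G.Adm) {x : G.X} (hx : x ∈ G.keep) :
    G.forgetInv x ∈ G.keep := by
  by_cases h : G.Bad ∧ G.r (G.ι x) = G.lastVertex
  · have hs := hG.spec hx h
    by_cases hl : G.ι (G.partner x) = G.partner x
    · rw [hs.forgetInv_leg hl]; exact hx
    · rw [Spec.forgetInv_edge hl]; exact (hG.spec_symm hs hl).1.mem_keep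
  · rw [forgetInv_of_not h]
    refine ⟨?_, h⟩
    intro h'
    apply hx.1
    rw [← G.ι_ι x, h', G.isLeg_lastLeg.2]

lemma Adm.forgetInv_inv {G : MGraph (n + 1)} (hG : G.Adm) {x : G.X} (hx : x ∈ G.keep) :
    G.forgetInv (G.forgetInv x) = x := by
  by_cases h : G.Bad ∧ G.r (G.ι x) = G.lastVertex
  · have hs := hG.spec hx h
    by_cases hl : G.ι (G.partner x) = G.partner x
    · rw [hs.forgetInv_leg hl, hs.forgetInv_leg hl]
    · obtain ⟨hs', hp⟩ := hG.spec_symm hs hl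
      rw [Spec.forgetInv_edge hl, Spec.forgetInv_edge, hp, G.ι_ι]
      rw [hp, G.ι_ι]
      intro h'
      exact hs.r_ne (by rw [h', hs.r_ι])
  · rw [forgetInv_of_not h, forgetInv_of_not, G.ι_ι]
    rw [G.ι_ι]; exact hx.2

lemma r_mem_keep {G : MGraph (n + 1)} {x : G.X} (hx : x ∈ G.keep) : G.r x ∈ G.keep := by
  refine ⟨?_, ?_⟩
  · intro h
    exact G.isLeg_lastLeg.1 (h ▸ G.isVertex_r x)
  · rw [G.r_r]; exact hx.2

lemma mark_castSucc_ne (G : MGraph (n + 1)) (i : Fin n) : G.mark i.castSucc ≠ G.lastLeg := by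
  intro h
  have := G.mark_inj h
  exact (Fin.castSucc_lt_last i).ne this

lemma exists_mark {G : MGraph (n + 1)} {x : G.X} (hx : G.IsLeg x) (hne : x ≠ G.lastLeg) :
    ∃ i : Fin n, G.mark i.castSucc = x := by
  obtain ⟨j, rfl⟩ := (G.mark_leg x).1 hx
  have hj : j ≠ Fin.last n := fun h => hne (by rw [h]; rfl)
  exact ⟨j.castPred hj, by rw [Fin.castSucc_castPred]⟩

/-- Legs attached at the deleted vertex. -/
lemma Adm.spec_mark {G : MGraph (n + 1)} (hG : G.Adm) (i : Fin n)
    (h : G.Bad ∧ G.r (G.mark i.castSucc) = G.lastVertex) :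
    G.Spec (G.forgetMark i) ∧ G.partner (G.forgetMark i) = G.mark i.castSucc := by
  have hl := G.isLeg_mark i.castSucc
  obtain ⟨h1, h2⟩ := hG.pair h.1 hl.1 h.2 (G.mark_castSucc_ne i)
  have hz : G.ι (G.other (G.mark i.castSucc)) ≠ G.other (G.mark i.castSucc) :=
    fun h' => h1.out ⟨hl.2, h'⟩
  have hr := h1.z_out.resolve_left hz
  have hm : G.forgetMark i = G.ι (G.other (G.mark i.castSucc)) := if_pos h
  have hk : G.forgetMark i ∈ G.keep := by
    rw [hm]
    refine ⟨?_, fun h' => hr h'.2⟩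
    intro h'
    apply h1.z_ne
    rw [← G.ι_ι (G.other _), h', G.isLeg_lastLeg.2]
  have hs := hG.spec hk ⟨h.1, by rw [hm, G.ι_ι]; exact h1.r_z⟩
  refine ⟨hs, ?_⟩
  have : G.partner (G.forgetMark i) = G.other (G.ι (G.forgetMark i)) := if_pos ⟨hs.bad, hs.r_ι⟩
  rw [this, hm, G.ι_ι, h2]

lemma forgetMark_of_not {G : MGraph (n + 1)} {i : Fin n}
    (h : ¬ (G.Bad ∧ G.r (G.mark i.castSucc) = G.lastVertex)) :
    G.forgetMark i = G.mark i.castSucc := if_neg h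

lemma mark_nonspec {G : MGraph (n + 1)} {i : Fin n}
    (h : ¬ (G.Bad ∧ G.r (G.mark i.castSucc) = G.lastVertex)) :
    ¬ (G.Bad ∧ G.r (G.ι (G.mark i.castSucc)) = G.lastVertex) := by
  rwa [(G.isLeg_mark i.castSucc).2]

lemma Adm.forgetMark_mem {G : MGraph (n + 1)} (hG : G.Adm) (i : Fin n) :
    G.forgetMark i ∈ G.keep := by
  by_cases h : G.Bad ∧ G.r (G.mark i.castSucc) = G.lastVertex
  · exact (hG.spec_mark i h).1.mem_keep
  · rw [forgetMark_of_not h]; exact ⟨G.mark_castSucc_ne i, h⟩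

/-- Forgetting the last leg and stabilizing. -/
def forget (G : MGraph (n + 1)) (hG : G.Adm) : MGraph n where
  X := G.keep
  r x := ⟨G.r x, r_mem_keep x.2⟩
  ι x := ⟨G.forgetInv x, hG.forgetInv_mem x.2⟩
  r_r x := Subtype.ext (G.r_r x)
  ι_ι x := Subtype.ext (hG.forgetInv_inv x.2)
  ι_vertex x hx := by
    apply Subtype.ext
    have hv : G.IsVertex x.1 := congrArg Subtype.val hx
    have hι : G.ι x.1 = x.1 := hv.ι_eq
    show G.forgetInv x.1 = x.1
    rw [forgetInv_of_not, hι]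
    rw [hι]; exact x.2.2
  h x := G.h x
  h_flag x hx := G.h_flag x (fun h => hx (Subtype.ext h))
  mark i := ⟨G.forgetMark i, hG.forgetMark_mem i⟩
  mark_inj i j hij := by
    have hij' : G.forgetMark i = G.forgetMark j := congrArg Subtype.val hij
    have key : G.mark i.castSucc = G.mark j.castSucc := by
      by_cases hi : G.Bad ∧ G.r (G.mark i.castSucc) = G.lastVertex
      · have hi' := hG.spec_mark i hi
        by_cases hj : G.Bad ∧ G.r (G.mark j.castSucc) = G.lastVertex
        · rw [← hi'.2, ← (hG.spec_mark j hj).2, hij']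
        · exact absurd ⟨hi.1, by rw [← forgetMark_of_not hj, ← hij']; exact hi'.1.r_ι⟩
            (mark_nonspec hj)
      · by_cases hj : G.Bad ∧ G.r (G.mark j.castSucc) = G.lastVertex
        · have hj' := hG.spec_mark j hj
          exact absurd ⟨hj.1, by rw [← forgetMark_of_not hi, hij']; exact hj'.1.r_ι⟩
            (mark_nonspec hi)
        · rw [← forgetMark_of_not hi, ← forgetMark_of_not hj, hij']
    exact Fin.castSucc_injective n (G.mark_inj key)
  mark_leg x := by
    have e1 : (⟨G.r x, r_mem_keep x.2⟩ : G.keep) ≠ x ↔ ¬ G.IsVertex x.1 := by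
      rw [Ne, Subtype.ext_iff]; rfl
    have e2 : (⟨G.forgetInv x, hG.forgetInv_mem x.2⟩ : G.keep) = x ↔ G.forgetInv x.1 = x.1 := by
      rw [Subtype.ext_iff]
    rw [e1, e2]
    constructor
    · rintro ⟨hf, hι⟩
      by_cases h : G.Bad ∧ G.r (G.ι x) = G.lastVertex
      · have hs := hG.spec x.2 h
        have hl : G.ι (G.partner x.1) = G.partner x.1 := by
          by_contra hl
          rw [Spec.forgetInv_edge hl] at hι
          apply hs.pair.ne
          rw [← hι, G.ι_ι, hι]
        obtain ⟨i, hi⟩ := exists_mark ⟨hs.pair.z_flag, hl⟩ hs.pair.z_ne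
        refine ⟨i, Subtype.ext ?_⟩
        show G.forgetMark i = x.1
        have : G.forgetMark i = G.ι (G.other (G.mark i.castSucc)) :=
          if_pos ⟨h.1, by rw [hi]; exact hs.pair.r_z⟩
        rw [this, hi, hs.other, G.ι_ι]
      · rw [forgetInv_of_not h] at hι
        obtain ⟨i, hi⟩ := exists_mark ⟨hf, hι⟩ x.2.1
        refine ⟨i, Subtype.ext ?_⟩
        show G.forgetMark i = x.1
        rw [forgetMark_of_not, hi]
        rw [hi, ← hι]; exact h
    · rintro ⟨i, rfl⟩
      show ¬ G.IsVertex (G.forgetMark i) ∧ G.forgetInv (G.forgetMark i) = G.forgetMark i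
      by_cases h : G.Bad ∧ G.r (G.mark i.castSucc) = G.lastVertex
      · have hs := hG.spec_mark i h
        refine ⟨hs.1.not_vertex, hs.1.forgetInv_leg ?_⟩
        rw [hs.2]; exact (G.isLeg_mark _).2
      · rw [forgetMark_of_not h, forgetInv_of_not (mark_nonspec h)]
        exact G.isLeg_mark _

lemma forget_isVertex {G : MGraph (n + 1)} {hG : G.Adm} {x : (G.forget hG).X} :
    (G.forget hG).IsVertex x ↔ G.IsVertex x.1 :=
  Subtype.ext_iff

lemma forget_chi {G : MGraph (n + 1)} (hG : G.Adm) (x : (G.forget hG).X) :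
    (G.forget hG).chi x = G.chi x.1 := by
  by_cases h : G.IsVertex x.1
  · rw [chi_vertex h, chi_vertex (forget_isVertex.2 h)]; rfl
  · rw [chi_flag h, chi_flag (fun h' => h (forget_isVertex.1 h'))]

lemma vertex_mem_keep {G : MGraph (n + 1)} {x : G.X} (hx : G.IsVertex x)
    (h : ¬ (G.Bad ∧ x = G.lastVertex)) : x ∈ G.keep := by
  refine ⟨?_, ?_⟩
  · rintro rfl; exact G.isLeg_lastLeg.1 hx
  · rwa [show G.r x = x from hx]

lemma Adm.forget_connected {G : MGraph (n + 1)} (hG : G.Adm) {S : Set G.X}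
    (hSr : ∀ x ∈ S, G.r x ∈ S) (hSι : ∀ x ∈ S, G.ι x ∈ S) (hS : G.Connected S)
    (S' : Set (G.forget hG).X)
    (h1 : ∀ x : (G.forget hG).X, G.IsVertex x.1 → (x ∈ S' ↔ x.1 ∈ S))
    (h2 : ∀ x : (G.forget hG).X, ¬ (G.Bad ∧ G.r (G.ι x.1) = G.lastVertex) → x.1 ∈ S → x ∈ S')
    (h3 : ∀ x : (G.forget hG).X, G.Spec x.1 → G.ι (G.partner x.1) ≠ G.partner x.1 →
      x.1 ∈ S → G.ι (G.partner x.1) ∈ S → x ∈ S')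
    (h4 : G.Bad → G.lastVertex ∈ S → ∃ c ∈ S, G.r c = G.lastVertex ∧ G.ι c ≠ c) :
    (G.forget hG).Connected S' := by
  by_cases hbv : G.Bad ∧ G.lastVertex ∈ S
  · obtain ⟨hb, hv⟩ := hbv
    obtain ⟨c, hc, hcv, hcι⟩ := h4 hb hv
    have hcf : ¬ G.IsVertex c := fun h => hcι h.ι_eq
    have hcp : c ≠ G.lastLeg := fun h => hcι (by rw [h, G.isLeg_lastLeg.2])
    obtain ⟨hpair, hoth⟩ := hG.pair hb hcf hcv hcp
    have hrc := hpair.y_out.resolve_left hcι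
    have hzk : G.ι c ∈ G.keep := by
      refine ⟨?_, fun h => hrc h.2⟩
      intro h
      exact hcp (by rw [← G.ι_ι c, h, G.isLeg_lastLeg.2])
    have hz := hG.spec hzk ⟨hb, by rw [G.ι_ι, hcv]⟩
    have hzp : G.partner (G.ι c) = G.other c := by
      have : G.partner (G.ι c) = G.other (G.ι (G.ι c)) := if_pos ⟨hb, hz.r_ι⟩
      rw [this, G.ι_ι]
    have hwk : G.r (G.ι c) ∈ G.keep := r_mem_keep hzk
    have hwS : G.r (G.ι c) ∈ S := hSr _ (hSι _ hc)
    -- steps through the deleted vertex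
    have step : ∀ f ∈ S, G.r f = G.lastVertex → G.r (G.ι f) ≠ G.lastVertex → f ≠ c →
        ∃ hk : G.ι f ∈ G.keep, G.forgetInv (G.ι c) = G.ι f ∧ G.forgetInv (G.ι f) = G.ι c ∧
          (⟨G.ι c, hzk⟩ : G.keep) ∈ S' ∧ (⟨G.ι f, hk⟩ : G.keep) ∈ S' := by
      intro f hf hfv hfι hfc
      have hfo : f = G.other c := by
        rcases hpair.all f hfv with h | h | h | h
        · exfalso; apply hfι; rw [h, (G.isVertex_lastVertex).ι_eq]; exact G.isVertex_lastVertex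
        · exfalso; apply hfι; rw [h, G.isLeg_lastLeg.2]; rfl
        · exact absurd h hfc
        · exact h
      have hl : G.ι (G.partner (G.ι c)) ≠ G.partner (G.ι c) := by
        rw [hzp, ← hfo]
        intro h
        exact hfι (by rw [h, hfv])
      obtain ⟨hs, hsp⟩ := hG.spec_symm hz hl
      have e1 := Spec.forgetInv_edge hl
      have hk : G.ι f ∈ G.keep := by
        have := hs.mem_keep
        rwa [hzp, ← hfo] at this
      have e2 : G.forgetInv (G.ι f) = G.ι c := by
        have := hG.forgetInv_inv hzk
        rwa [e1, hzp, ← hfo] at this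
      refine ⟨hk, by rw [e1, hzp, ← hfo], e2, ?_, ?_⟩
      · refine h3 _ hz hl (hSι _ hc) ?_
        show G.ι (G.partner (G.ι c)) ∈ S
        rw [hzp, ← hfo]; exact hSι _ hf
      · rw [hzp, ← hfo] at hs hsp
        rw [G.ι_ι] at hsp
        refine h3 _ hs ?_ (hSι _ hf) ?_
        · show G.ι (G.partner (G.ι f)) ≠ G.partner (G.ι f)
          rw [hsp]; exact hcι
        · show G.ι (G.partner (G.ι f)) ∈ S
          rw [hsp]; exact hSι _ hc
    constructor
    · exact ⟨⟨G.r (G.ι c), hwk⟩, (h1 _ (G.isVertex_r _)).2 hwS⟩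
    · intro u hu w hw huv hwv
      rw [forget_isVertex] at huv hwv
      have hpath := hS.2 u.1 ((h1 u huv).1 hu) w.1 ((h1 w hwv).1 hw) huv hwv
      have key : ∀ y, Relation.ReflTransGen
          (fun a b => ∃ f ∈ S, G.r f = a ∧ G.r (G.ι f) = b) u.1 y →
          (y = G.lastVertex → Relation.ReflTransGen (fun a b => ∃ f ∈ S',
            (G.forget hG).r f = a ∧ (G.forget hG).r ((G.forget hG).ι f) = b)
              u ⟨G.r (G.ι c), hwk⟩) ∧
          (∀ hy : y ∈ G.keep, Relation.ReflTransGen (fun a b => ∃ f ∈ S',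
            (G.forget hG).r f = a ∧ (G.forget hG).r ((G.forget hG).ι f) = b) u ⟨y, hy⟩) := by
        intro y hy
        induction hy with
        | refl =>
          refine ⟨fun h => ?_, fun _ => Relation.ReflTransGen.refl⟩
          exact absurd ⟨hb, huv.trans h⟩ u.2.2
        | @tail y y' _ hs ih =>
          obtain ⟨f, hf, hy, hy'⟩ := hs
          have hvk : ∀ {t : G.X}, G.r t ∈ G.keep → G.r t ≠ G.lastVertex :=
            fun {t} h h' => h.2 ⟨hb, by rw [G.r_r, h']⟩
          subst hy hy'
          by_cases hv1 : G.r f = G.lastVertex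
          · by_cases hv2 : G.r (G.ι f) = G.lastVertex
            · exact ⟨fun _ => ih.1 hv1, fun h => absurd hv2 (hvk h)⟩
            · refine ⟨fun h => absurd h hv2, fun hk => ?_⟩
              by_cases hfc : f = c
              · subst hfc; exact ih.1 hv1
              · obtain ⟨hk', e1, e2, m1, m2⟩ := step f hf hv1 hv2 hfc
                refine (ih.1 hv1).tail ⟨_, m1, rfl, ?_⟩
                exact Subtype.ext (congrArg G.r e1)
          · have hyk : G.r f ∈ G.keep :=
              vertex_mem_keep (G.isVertex_r f) (fun h => hv1 h.2)
            by_cases hv2 : G.r (G.ι f) = G.lastVertex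
            · refine ⟨fun _ => ?_, fun h => absurd hv2 (hvk h)⟩
              by_cases hfc : G.ι f = c
              · have : (⟨G.r (G.ι c), hwk⟩ : G.keep) = ⟨G.r f, hyk⟩ :=
                  Subtype.ext (by show G.r (G.ι c) = G.r f; rw [← hfc, G.ι_ι])
                rw [this]
                exact ih.2 hyk
              · obtain ⟨hk', e1, e2, m1, m2⟩ := step (G.ι f) (hSι _ hf) hv2
                  (by rw [G.ι_ι]; exact hv1) hfc
                refine (ih.2 hyk).tail ⟨_, m2, ?_, ?_⟩
                · exact Subtype.ext (by show G.r (G.ι (G.ι f)) = G.r f; rw [G.ι_ι])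
                · exact Subtype.ext (congrArg G.r e2)
            · refine ⟨fun h => absurd h hv2, fun hk => ?_⟩
              have hfk : f ∈ G.keep := by
                refine ⟨?_, fun h => hv1 h.2⟩
                rintro rfl; exact hv1 rfl
              have hns : ¬ (G.Bad ∧ G.r (G.ι f) = G.lastVertex) := fun h => hv2 h.2
              refine (ih.2 hyk).tail ⟨⟨f, hfk⟩, h2 _ hns hf, rfl, ?_⟩
              exact Subtype.ext (congrArg G.r (forgetInv_of_not hns))
      exact (key _ hpath).2 w.2
  · have hvS : ∀ y ∈ S, G.IsVertex y → y ∈ G.keep := fun y hy hyv =>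
      vertex_mem_keep hyv (fun h => hbv ⟨h.1, h.2 ▸ hy⟩)
    constructor
    · obtain ⟨x, hx⟩ := hS.1
      have := hvS _ (hSr _ hx) (G.isVertex_r x)
      exact ⟨⟨_, this⟩, (h1 _ (G.isVertex_r x)).2 (hSr _ hx)⟩
    · intro u hu w hw huv hwv
      rw [forget_isVertex] at huv hwv
      have hpath := hS.2 u.1 ((h1 u huv).1 hu) w.1 ((h1 w hwv).1 hw) huv hwv
      have key : ∀ y, Relation.ReflTransGen
          (fun a b => ∃ f ∈ S, G.r f = a ∧ G.r (G.ι f) = b) u.1 y →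
          (∀ hy : y ∈ G.keep, Relation.ReflTransGen (fun a b => ∃ f ∈ S',
            (G.forget hG).r f = a ∧ (G.forget hG).r ((G.forget hG).ι f) = b) u ⟨y, hy⟩) := by
        intro y hy
        induction hy with
        | refl => exact fun _ => Relation.ReflTransGen.refl
        | @tail y y' _ hs ih =>
          obtain ⟨f, hf, hy, hy'⟩ := hs
          subst hy hy'
          intro hk
          have hyk := hvS _ (hSr _ hf) (G.isVertex_r f)
          by_cases hfp : f = G.lastLeg
          · subst hfp
            have : G.ι G.lastLeg = G.lastLeg := G.isLeg_lastLeg.2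
            simp only [this] at hk ⊢
            exact ih hyk
          · have hfk : f ∈ G.keep := ⟨hfp, fun h => hbv ⟨h.1, h.2 ▸ hSr _ hf⟩⟩
            have hns : ¬ (G.Bad ∧ G.r (G.ι f) = G.lastVertex) :=
              fun h => hbv ⟨h.1, h.2 ▸ hSr _ (hSι _ hf)⟩
            refine (ih hyk).tail ⟨⟨f, hfk⟩, h2 _ hns hf, rfl, ?_⟩
            exact Subtype.ext (congrArg G.r (forgetInv_of_not hns))
      exact key _ hpath w.2

lemma Adm.exists_out_edge {G : MGraph (n + 1)} (hG : G.Adm) (hb : G.Bad) :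
    ∃ c, G.r c = G.lastVertex ∧ G.ι c ≠ c := by
  obtain ⟨y, h1, h2⟩ := hG.exists_out hb
  exact ⟨y, h1, fun h => h2 (by rw [h, h1])⟩

lemma Adm.forget_connected_univ {G : MGraph (n + 1)} (hG : G.Adm) :
    (G.forget hG).Connected Set.univ := by
  apply hG.forget_connected (S := Set.univ) (fun _ _ => Set.mem_univ _)
    (fun _ _ => Set.mem_univ _) hG.connected
  · exact fun _ _ => ⟨fun _ => Set.mem_univ _, fun _ => Set.mem_univ _⟩
  · exact fun _ _ _ => Set.mem_univ _
  · exact fun _ _ _ _ _ => Set.mem_univ _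
  · intro hb _
    obtain ⟨c, hc⟩ := hG.exists_out_edge hb
    exact ⟨c, Set.mem_univ _, hc⟩

lemma Adm.bad_sum {G : MGraph (n + 1)} (hG : G.Adm) (hb : G.Bad) :
    ∑ᶠ x ∈ {x | G.r x = G.lastVertex}, G.chi x = 1 := by
  have h1 := G.bad_iff.1 hb
  have h2 := hG.stable _ G.isVertex_lastVertex
  rw [← G.finsum_chi_star G.isVertex_lastVertex] at h2
  linarith

lemma Adm.sum_keep {G : MGraph (n + 1)} (hG : G.Adm) :
    ∑ᶠ x ∈ G.keep, G.chi x = ∑ᶠ x ∈ Set.univ, G.chi x - 1 := by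
  by_cases hb : G.Bad
  · have hd : (Set.univ : Set G.X) = G.keep ∪ {x | G.r x = G.lastVertex} := by
      ext x
      simp only [keep, Set.mem_union, Set.mem_ofPred_eq, Set.mem_univ, true_iff, hb, true_and]
      by_cases h : G.r x = G.lastVertex
      · exact Or.inr h
      · refine Or.inl ⟨?_, h⟩
        rintro rfl; exact h rfl
    have hdj : Disjoint G.keep {x | G.r x = G.lastVertex} := by
      rw [Set.disjoint_left]
      exact fun x hx hx' => hx.2 ⟨hb, hx'⟩
    rw [hd, finsum_mem_union hdj (Set.toFinite _) (Set.toFinite _), hG.bad_sum hb]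
    ring
  · have hd : (Set.univ : Set G.X) = G.keep ∪ {G.lastLeg} := by
      ext x
      simp only [keep, Set.mem_union, Set.mem_ofPred_eq, Set.mem_univ, true_iff, hb, false_and,
        not_false_eq_true, and_true, Set.mem_singleton_iff]
      tauto
    have hdj : Disjoint G.keep {G.lastLeg} := by
      rw [Set.disjoint_singleton_right]
      exact fun hx => hx.1 rfl
    rw [hd, finsum_mem_union hdj (Set.toFinite _) (Set.toFinite _), finsum_mem_singleton,
      chi_flag G.isLeg_lastLeg.1]
    ring

lemma Adm.forget_sum {G : MGraph (n + 1)} (hG : G.Adm) :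
    ∑ᶠ x ∈ Set.univ, (G.forget hG).chi x = ∑ᶠ x ∈ Set.univ, G.chi x - 1 := by
  rw [← hG.sum_keep, finsum_mem_univ, ← finsum_set_coe_eq_finsum_mem]
  exact finsum_congr (fun x => forget_chi hG x)

lemma Adm.forget_genus {G : MGraph (n + 1)} (hG : G.Adm) :
    (G.forget hG).genus Set.univ = G.genus Set.univ := by
  have h1 := hG.forget_sum
  rw [finsum_chi_univ, finsum_chi_univ] at h1
  push_cast at h1
  linarith

lemma Adm.forget_stable {G : MGraph (n + 1)} (hG : G.Adm) : (G.forget hG).Stable := by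
  intro x hx
  have hxv := forget_isVertex.1 hx
  have hval : (G.forget hG).valence x
      = {f | f ∈ G.keep ∧ ¬ G.IsVertex f ∧ G.r f = x.1}.ncard := by
    rw [valence]
    refine (Set.ncard_image_of_injective (f := (Subtype.val : G.keep → G.X)) _
      Subtype.val_injective).symm.trans ?_
    congr 1
    ext f
    simp only [Set.mem_image, Set.mem_ofPred_eq]
    constructor
    · rintro ⟨y, ⟨h1, h2⟩, rfl⟩
      exact ⟨y.2, fun h => h1 (forget_isVertex.2 h), congrArg Subtype.val h2⟩
    · rintro ⟨h1, h2, h3⟩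
      exact ⟨⟨f, h1⟩, ⟨fun h => h2 (forget_isVertex.1 h), Subtype.ext h3⟩, rfl⟩
  have hh : (G.forget hG).h x = G.h x.1 := rfl
  rw [hval, hh]
  by_cases hxl : x.1 = G.lastVertex
  · have hnb : ¬ G.Bad := fun hb => x.2.2 ⟨hb, by rw [show G.r x.1 = x.1 from hxv, hxl]⟩
    have hset : {f | f ∈ G.keep ∧ ¬ G.IsVertex f ∧ G.r f = x.1}
        = {f | ¬ G.IsVertex f ∧ G.r f = G.lastVertex} \ {G.lastLeg} := by
      ext f
      simp only [keep, Set.mem_ofPred_eq, hnb, false_and, not_false_eq_true, and_true,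
        Set.mem_sdiff, Set.mem_singleton_iff, hxl]
      tauto
    have hmem : G.lastLeg ∈ {f | ¬ G.IsVertex f ∧ G.r f = G.lastVertex} :=
      ⟨G.isLeg_lastLeg.1, rfl⟩
    have hc := Set.ncard_sdiff_singleton_add_one hmem (Set.toFinite _)
    rw [hset, hxl]
    rw [Bad, not_not, valence, ← hc] at hnb
    push_cast at hnb
    linarith
  · have hset : {f | f ∈ G.keep ∧ ¬ G.IsVertex f ∧ G.r f = x.1}
        = {f | ¬ G.IsVertex f ∧ G.r f = x.1} := by
      ext f
      simp only [Set.mem_ofPred_eq, and_iff_right_iff_imp]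
      rintro ⟨_, h⟩
      refine ⟨?_, ?_⟩
      · rintro rfl; exact hxl h.symm
      · rw [h]; exact fun h' => hxl h'.2
    rw [hset]
    exact hG.stable x.1 hxv

namespace Hom

variable {G H K : MGraph (n + 1)}

/-- The map induced on the remaining vertices and flags by a morphism of graphs. If the edge of
`x` is contracted, and `x` now belongs to an edge or leg obtained by joining two edges, or an edge
and a leg, then the other part of this edge or leg determines the image. -/
def forgetFun (g : Hom G H) (x : G.X) : H.X :=
  open Classical in if H.IsVertex (g.toFun x) then g.toFun (G.partner x) else g.toFun x

lemma map_lastLeg (g : Hom G H) : g.toFun G.lastLeg = H.lastLeg := g.map_mark _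

lemma map_lastVertex (g : Hom G H) : g.toFun G.lastVertex = H.lastVertex := by
  rw [lastVertex, g.map_r, g.map_lastLeg]; rfl

lemma eq_lastLeg (g : Hom G H) {x : G.X} (h : g.toFun x = H.lastLeg) : x = G.lastLeg := by
  apply g.injOn
  · rw [h, g.map_lastLeg]
  · rw [h]; exact H.isLeg_lastLeg.1

lemma eq_lastVertex (g : Hom G H) {x : G.X} (hx : G.r x = G.lastVertex)
    (h : H.IsVertex (g.toFun x)) : g.toFun x = H.lastVertex := by
  rw [← g.map_lastVertex, ← hx, g.map_r]; exact h.symm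

lemma bad_of_bad (g : Hom G H) (hG : G.Adm) (hb : H.Bad) :
    G.Bad ∧ ∀ x, H.r (g.toFun x) = H.lastVertex → G.r x = G.lastVertex := by
  set U : Set G.X := {u | G.IsVertex u ∧ g.toFun u = H.lastVertex} with hU
  set ψ : G.X → ℤ := fun u => ∑ᶠ x ∈ G.r ⁻¹' {u}, G.chi x with hψ
  have hvU : G.lastVertex ∈ U := ⟨G.isVertex_lastVertex, g.map_lastVertex⟩
  have hset : g.toFun ⁻¹' {y | H.r y = H.lastVertex} = G.r ⁻¹' U := by
    ext x
    simp only [Set.mem_preimage, Set.mem_ofPred_eq, hU, g.map_r]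
    exact ⟨fun h => ⟨G.isVertex_r x, h⟩, fun h => h.2⟩
  have h1 : ∑ᶠ u ∈ U, ψ u ≤ 1 := by
    rw [← finsum_preimage G.r G.chi ψ U (fun y _ => rfl), ← hset,
      finsum_preimage g.toFun G.chi H.chi _ (fun y _ => g.finsum_fiber_chi y)]
    exact H.bad_iff.1 hb
  have h2 : ∀ u ∈ U, 1 ≤ ψ u := by
    intro u hu
    have := hG.stable u hu.1
    rw [← G.finsum_chi_star hu.1] at this
    exact this
  have h3 : (U.ncard : ℤ) ≤ ∑ᶠ u ∈ U, ψ u := by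
    rw [← finsum_mem_one_int, finsum_mem_eq_finite_toFinset_sum _ (Set.toFinite U),
      finsum_mem_eq_finite_toFinset_sum _ (Set.toFinite U)]
    apply Finset.sum_le_sum
    intro u hu
    exact h2 u ((Set.Finite.mem_toFinset _).1 hu)
  have h4 : U.ncard ≤ 1 := by
    have := h3.trans h1
    exact_mod_cast this
  have h5 : ∀ u ∈ U, u = G.lastVertex := fun u hu =>
    (Set.ncard_le_one (Set.toFinite U)).1 h4 u hu _ hvU
  have h6 : U = {G.lastVertex} := by
    ext u
    exact ⟨fun h => h5 u h, fun h => by rw [Set.mem_singleton_iff.1 h]; exact hvU⟩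
  refine ⟨?_, fun x hx => h5 _ ⟨G.isVertex_r x, by rw [g.map_r, hx]⟩⟩
  rw [bad_iff]
  rw [h6, finsum_mem_singleton] at h1
  exact h1

lemma exists_contracted (g : Hom G H) (hG : G.Adm) (hb : G.Bad) (hb' : ¬ H.Bad) :
    ∃ c, ¬ G.IsVertex c ∧ G.r c = G.lastVertex ∧ c ≠ G.lastLeg ∧ G.ι c ≠ c ∧
      H.IsVertex (g.toFun c) := by
  by_contra hcon
  push Not at hcon
  have hv' := H.isVertex_lastVertex
  have hno : ∀ f, G.r f = G.lastVertex → g.toFun f = H.lastVertex → f = G.lastVertex := by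
    intro f hf hgf
    by_contra hne
    have hff : ¬ G.IsVertex f := fun h => hne (h.symm.trans hf)
    have hfp : f ≠ G.lastLeg := by
      rintro rfl
      exact H.isLeg_lastLeg.1 (g.map_lastLeg ▸ hgf ▸ hv')
    have hfι : G.ι f ≠ f := by
      intro h
      exact (g.isLeg ⟨hff, h⟩).1 (hgf ▸ hv')
    exact hcon f hff hf hfp hfι (hgf ▸ hv')
  have hver : ∀ u, G.IsVertex u → g.toFun u = H.lastVertex → u = G.lastVertex := by
    intro u hu hgu
    have := (g.fiber_connected _ hv').2 G.lastVertex g.map_lastVertex u hgu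
      G.isVertex_lastVertex hu
    induction this with
    | refl => rfl
    | @tail b c _ hs ih =>
      obtain ⟨f, hf, h1, h2⟩ := hs
      have hbv : G.IsVertex b := h1 ▸ G.isVertex_r f
      have hb1 : b = G.lastVertex := by
        apply ih hbv
        rw [← h1, g.map_r, show g.toFun f = H.lastVertex from hf, hv']
      have := hno f (h1.trans hb1) hf
      rw [← h2, this, (G.isVertex_lastVertex).ι_eq]
      exact G.isVertex_lastVertex
  have hstar : g.toFun ⁻¹' {y | H.r y = H.lastVertex} = {x | G.r x = G.lastVertex} := by
    ext x
    simp only [Set.mem_preimage, Set.mem_ofPred_eq]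
    constructor
    · exact fun h => hver _ (G.isVertex_r x) (by rw [g.map_r, h])
    · intro h; rw [← g.map_r, h, g.map_lastVertex]
  apply hb'
  rw [bad_iff, ← finsum_preimage g.toFun G.chi H.chi _ (fun y _ => g.finsum_fiber_chi y), hstar]
  exact G.bad_iff.1 hb

lemma contracted_of_pair (g : Hom G H) (hG : G.Adm) (hb : G.Bad) (hb' : ¬ H.Bad) {y z : G.X}
    (hp : G.Pair y z) (hy : ¬ H.IsVertex (g.toFun y)) : H.IsVertex (g.toFun z) := by
  obtain ⟨c, h1, h2, h3, h4, h5⟩ := g.exists_contracted hG hb hb'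
  rcases hp.all c h2 with h | h | h | h
  · exact absurd (h ▸ G.isVertex_lastVertex) h1
  · exact absurd h h3
  · exact absurd (h ▸ h5) hy
  · exact h ▸ h5

lemma isVertex_map_ι (g : Hom G H) (x : G.X) :
    H.IsVertex (g.toFun (G.ι x)) ↔ H.IsVertex (g.toFun x) := by
  rw [g.map_ι, isVertex_ι]

lemma not_spec (g : Hom G H) (hG : G.Adm) {x : G.X}
    (h : ¬ (G.Bad ∧ G.r (G.ι x) = G.lastVertex)) :
    ¬ (H.Bad ∧ H.r (H.ι (g.toFun x)) = H.lastVertex) := by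
  rintro ⟨hb, hr⟩
  obtain ⟨h1, h2⟩ := g.bad_of_bad hG hb
  exact h ⟨h1, h2 _ (by rw [g.map_ι, hr])⟩

lemma forgetFun_of_not (g : Hom G H) {x : G.X}
    (h : ¬ (G.Bad ∧ G.r (G.ι x) = G.lastVertex)) : g.forgetFun x = g.toFun x := by
  rw [forgetFun, partner_of_not h, ite_self]

lemma forgetFun_flag (g : Hom G H) {x : G.X} (h : ¬ H.IsVertex (g.toFun x)) :
    g.forgetFun x = g.toFun x := if_neg h

lemma forgetFun_vertex (g : Hom G H) {x : G.X} (h : H.IsVertex (g.toFun x)) :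
    g.forgetFun x = g.toFun (G.partner x) := if_pos h

lemma nonspec_of_vertex {x : G.X} (hx : x ∈ G.keep) (hv : G.IsVertex x) :
    ¬ (G.Bad ∧ G.r (G.ι x) = G.lastVertex) := by
  rw [hv.ι_eq]; exact hx.2

lemma spec_eq_lastVertex (g : Hom G H) {x : G.X} (hs : G.Spec x)
    (h : H.IsVertex (g.toFun x)) : g.toFun x = H.lastVertex := by
  rw [← g.eq_lastVertex hs.r_ι ((g.isVertex_map_ι x).2 h), g.map_ι, h.ι_eq]

/-- Affected flags stay affected if the contracted graph is still unstable. -/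
lemma spec_bad (g : Hom G H) (hG : G.Adm) (hH : H.Adm) (hb : H.Bad) {x : G.X}
    (hs : G.Spec x) :
    ¬ H.IsVertex (g.toFun x) ∧ H.Spec (g.toFun x) ∧
      H.partner (g.toFun x) = g.toFun (G.partner x) := by
  obtain ⟨-, h2⟩ := g.bad_of_bad hG hb
  have hxf : ¬ H.IsVertex (g.toFun x) := by
    intro h
    apply hs.r_ne
    apply h2
    rw [h, g.spec_eq_lastVertex hs h]
  have hzf : ¬ H.IsVertex (g.toFun (G.partner x)) := by
    intro h
    rcases hs.pair.z_out with hl | hl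
    · exact (g.isLeg ⟨hs.pair.z_flag, hl⟩).1 h
    · apply hl
      apply h2
      rw [g.map_ι, h.ι_eq, h, g.eq_lastVertex hs.pair.r_z h]
  have hk : g.toFun x ∈ H.keep := by
    refine ⟨?_, fun h => hs.r_ne (h2 _ h.2)⟩
    intro h
    exact hs.mem_keep.1 (g.eq_lastLeg h)
  have hs' := hH.spec hk ⟨hb, by rw [← g.map_ι, ← g.map_r, hs.r_ι, g.map_lastVertex]⟩
  refine ⟨hxf, hs', ?_⟩
  rcases hs'.pair.all (g.toFun (G.partner x))
    (by rw [← g.map_r, hs.pair.r_z, g.map_lastVertex]) with h | h | h | h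
  · exact absurd (h ▸ H.isVertex_lastVertex) hzf
  · exact absurd (g.eq_lastLeg h) hs.pair.z_ne
  · rw [← g.map_ι] at h
    exact absurd (g.injOn h hzf) hs.pair.ne
  · exact h.symm

lemma forgetFun_spec_bad (g : Hom G H) (hG : G.Adm) (hH : H.Adm) (hb : H.Bad) {x : G.X}
    (hs : G.Spec x) : g.forgetFun x = g.toFun x :=
  g.forgetFun_flag (g.spec_bad hG hH hb hs).1

lemma forgetFun_mem (g : Hom G H) (hG : G.Adm) (hH : H.Adm) {x : G.X} (hx : x ∈ G.keep) :
    g.forgetFun x ∈ H.keep := by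
  have base : g.toFun x ∈ H.keep := by
    refine ⟨fun h => hx.1 (g.eq_lastLeg h), ?_⟩
    rintro ⟨hb, hr⟩
    obtain ⟨h1, h2⟩ := g.bad_of_bad hG hb
    exact hx.2 ⟨h1, h2 _ hr⟩
  by_cases h : G.Bad ∧ G.r (G.ι x) = G.lastVertex
  · have hs := hG.spec hx h
    by_cases hv : H.IsVertex (g.toFun x)
    · rw [g.forgetFun_vertex hv]
      have hnb : ¬ H.Bad := fun hb => (g.spec_bad hG hH hb hs).1 hv
      exact ⟨fun h' => hs.pair.z_ne (g.eq_lastLeg h'), fun h' => hnb h'.1⟩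
    · rw [g.forgetFun_flag hv]; exact base
  · rw [g.forgetFun_of_not h]; exact base

lemma forgetFun_r (g : Hom G H) (hG : G.Adm) {x : G.X} (hx : x ∈ G.keep) :
    g.forgetFun (G.r x) = H.r (g.forgetFun x) := by
  rw [g.forgetFun_of_not (nonspec_of_vertex (r_mem_keep hx) (G.isVertex_r x))]
  by_cases h : G.Bad ∧ G.r (G.ι x) = G.lastVertex
  · have hs := hG.spec hx h
    by_cases hv : H.IsVertex (g.toFun x)
    · rw [g.forgetFun_vertex hv, g.map_r, ← g.map_r (G.partner x), hs.pair.r_z, g.map_lastVertex,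
        hv, g.spec_eq_lastVertex hs hv]
    · rw [g.forgetFun_flag hv, g.map_r]
  · rw [g.forgetFun_of_not h, g.map_r]

lemma forgetInv_of_not_bad (h : ¬ H.Bad) (y : H.X) : H.forgetInv y = H.ι y :=
  forgetInv_of_not (fun h' => h h'.1)

lemma forgetFun_ι (g : Hom G H) (hG : G.Adm) (hH : H.Adm) {x : G.X} (hx : x ∈ G.keep) :
    g.forgetFun (G.forgetInv x) = H.forgetInv (g.forgetFun x) := by
  by_cases h : G.Bad ∧ G.r (G.ι x) = G.lastVertex
  · have hs := hG.spec hx h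
    have hyx : H.IsVertex (g.toFun (G.ι x)) ↔ H.IsVertex (g.toFun x) := g.isVertex_map_ι x
    by_cases hl : G.ι (G.partner x) = G.partner x
    · rw [hs.forgetInv_leg hl]
      have hzl := g.isLeg ⟨hs.pair.z_flag, hl⟩
      by_cases hb : H.Bad
      · obtain ⟨h1, h2, h3⟩ := g.spec_bad hG hH hb hs
        rw [g.forgetFun_flag h1, h2.forgetInv_leg]
        rw [h3, ← g.map_ι, hl]
      · have hv : H.IsVertex (g.toFun x) := by
          by_contra hv
          exact hzl.1 (g.contracted_of_pair hG h.1 hb hs.pair (fun h' => hv (hyx.1 h')))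
        rw [g.forgetFun_vertex hv, forgetInv_of_not_bad hb, hzl.2]
    · obtain ⟨hs', hp'⟩ := hG.spec_symm hs hl
      rw [Spec.forgetInv_edge hl]
      by_cases hb : H.Bad
      · obtain ⟨h1, h2, h3⟩ := g.spec_bad hG hH hb hs
        rw [g.forgetFun_spec_bad hG hH hb hs', g.forgetFun_flag h1, Spec.forgetInv_edge, h3,
          g.map_ι]
        rw [h3, ← g.map_ι]
        intro h'
        have hzf : ¬ H.IsVertex (g.toFun (G.partner x)) := by
          rw [← h3]; exact h2.pair.z_flag
        exact hl (g.injOn h' (h' ▸ hzf))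
      · rw [forgetInv_of_not_bad hb]
        by_cases hv : H.IsVertex (g.toFun x)
        · rw [g.forgetFun_vertex hv]
          by_cases hv' : H.IsVertex (g.toFun (G.ι (G.partner x)))
          · rw [g.forgetFun_vertex hv', hp']
            rw [g.isVertex_map_ι] at hv'
            rw [hv'.ι_eq, g.map_ι, hv.ι_eq, g.spec_eq_lastVertex hs hv,
              g.eq_lastVertex hs.pair.r_z hv']
          · rw [g.forgetFun_flag hv', g.map_ι]
        · have hz := g.contracted_of_pair hG h.1 hb hs.pair (fun h' => hv (hyx.1 h'))
          rw [g.forgetFun_flag hv, g.forgetFun_vertex ((g.isVertex_map_ι _).2 hz), hp', g.map_ι]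
  · rw [g.forgetFun_of_not h, forgetInv_of_not h, forgetInv_of_not (g.not_spec hG h),
      g.forgetFun_of_not, g.map_ι]
    rw [G.ι_ι]; exact hx.2

lemma forgetFun_mark (g : Hom G H) (hG : G.Adm) (hH : H.Adm) (i : Fin n) :
    g.forgetFun (G.forgetMark i) = H.forgetMark i := by
  by_cases h : G.Bad ∧ G.r (G.mark i.castSucc) = G.lastVertex
  · obtain ⟨hs, hp⟩ := hG.spec_mark i h
    have hr : H.r (H.mark i.castSucc) = H.lastVertex := by
      rw [← g.map_mark, ← g.map_r, h.2, g.map_lastVertex]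
    by_cases hb : H.Bad
    · obtain ⟨h1, h2, h3⟩ := g.spec_bad hG hH hb hs
      rw [g.forgetFun_flag h1]
      have : H.forgetMark i = H.ι (H.other (H.mark i.castSucc)) := if_pos ⟨hb, hr⟩
      rw [this, ← g.map_mark, ← hp, ← h3, h2.other, H.ι_ι]
    · have hzl := g.isLeg (G.isLeg_mark i.castSucc)
      have hv : H.IsVertex (g.toFun (G.forgetMark i)) := by
        by_contra hv
        have := g.contracted_of_pair hG h.1 hb hs.pair
          (fun h' => hv ((g.isVertex_map_ι _).1 h'))
        rw [hp] at this
        exact hzl.1 this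
      rw [g.forgetFun_vertex hv, hp, g.map_mark, forgetMark_of_not (fun h' => hb h'.1)]
  · rw [forgetMark_of_not h, g.forgetFun_of_not (mark_nonspec h), g.map_mark,
      forgetMark_of_not]
    rintro ⟨hb, hr⟩
    obtain ⟨h1, h2⟩ := g.bad_of_bad hG hb
    exact h ⟨h1, h2 _ (by rw [g.map_mark, hr])⟩

lemma forgetFun_flag_unique (g : Hom G H) (hG : G.Adm) (hH : H.Adm) {f : H.X}
    (hf : f ∈ H.keep) (hff : ¬ H.IsVertex f) :
    ∃ x ∈ G.keep, g.forgetFun x = f ∧ ∀ x' ∈ G.keep, g.forgetFun x' = f → x' = x := by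
  obtain ⟨x, hx, hu⟩ := g.flag f hff
  by_cases hk : x ∈ G.keep
  · refine ⟨x, hk, ?_, ?_⟩
    · rw [g.forgetFun_flag (by rwa [hx]), hx]
    · intro x' hx' h'
      by_cases hv : H.IsVertex (g.toFun x')
      · rw [g.forgetFun_vertex hv] at h'
        have hz := hu _ h'
        by_cases hsp : G.Bad ∧ G.r (G.ι x') = G.lastVertex
        · have hs := hG.spec hx' hsp
          exact absurd ⟨hsp.1, by rw [← hz, hs.pair.r_z]⟩ hk.2
        · rwa [partner_of_not hsp] at hz
      · rw [g.forgetFun_flag hv] at h'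
        exact hu _ h'
  · have hxp : x ≠ G.lastLeg := by
      rintro rfl
      exact hf.1 (by rw [← hx, g.map_lastLeg])
    have hbr : G.Bad ∧ G.r x = G.lastVertex := by
      by_contra h; exact hk ⟨hxp, h⟩
    have hnb : ¬ H.Bad := by
      intro hb
      apply hf.2
      refine ⟨hb, ?_⟩
      rw [← hx, ← g.map_r, hbr.2, g.map_lastVertex]
    have hxf : ¬ G.IsVertex x := fun h => hff (hx ▸ g.isVertex h)
    obtain ⟨hp, ho⟩ := hG.pair hbr.1 hxf hbr.2 hxp
    have hzv : H.IsVertex (g.toFun (G.other x)) :=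
      g.contracted_of_pair hG hbr.1 hnb hp (by rwa [hx])
    have hzι : G.ι (G.other x) ≠ G.other x := by
      intro h
      exact (g.isLeg ⟨hp.z_flag, h⟩).1 hzv
    have hzr := hp.z_out.resolve_left hzι
    have hzk : G.ι (G.other x) ∈ G.keep := by
      refine ⟨?_, fun h => hzr h.2⟩
      intro h
      apply hp.z_ne
      rw [← G.ι_ι (G.other x), h, G.isLeg_lastLeg.2]
    have hzs : G.Bad ∧ G.r (G.ι (G.ι (G.other x))) = G.lastVertex :=
      ⟨hbr.1, by rw [G.ι_ι, hp.r_z]⟩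
    have hpar : G.partner (G.ι (G.other x)) = x := by
      have : G.partner (G.ι (G.other x)) = G.other (G.ι (G.ι (G.other x))) := if_pos hzs
      rw [this, G.ι_ι, ho]
    refine ⟨G.ι (G.other x), hzk, ?_, ?_⟩
    · rw [g.forgetFun_vertex ((g.isVertex_map_ι _).2 hzv), hpar, hx]
    · intro x' hx' h'
      by_cases hv : H.IsVertex (g.toFun x')
      · rw [g.forgetFun_vertex hv] at h'
        have hz := hu _ h'
        by_cases hsp : G.Bad ∧ G.r (G.ι x') = G.lastVertex
        · have hs := hG.spec hx' hsp
          rw [← hz, hs.other, G.ι_ι]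
        · rw [partner_of_not hsp] at hz
          exact absurd (hz ▸ hx') hk
      · rw [g.forgetFun_flag hv] at h'
        exact absurd (hu _ h' ▸ hx') hk

lemma finsum_univ_eq (g : Hom G H) :
    ∑ᶠ x ∈ Set.univ, G.chi x = ∑ᶠ y ∈ Set.univ, H.chi y :=
  finsum_preimage g.toFun G.chi H.chi Set.univ (fun y _ => g.finsum_fiber_chi y)

/-- The map induced on the graphs obtained by forgetting the last leg and stabilizing. -/
def forgetMap (g : Hom G H) (hG : G.Adm) (hH : H.Adm) : (G.forget hG).X → (H.forget hH).X :=
  fun x => ⟨g.forgetFun x.1, g.forgetFun_mem hG hH x.2⟩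

lemma forgetMap_flag (g : Hom G H) (hG : G.Adm) (hH : H.Adm) (f : (H.forget hH).X)
    (hf : ¬ (H.forget hH).IsVertex f) : ∃! x, g.forgetMap hG hH x = f := by
  rw [forget_isVertex] at hf
  obtain ⟨x, hx, h1, h2⟩ := g.forgetFun_flag_unique hG hH f.2 hf
  exact ⟨⟨x, hx⟩, Subtype.ext h1,
    fun x' hx' => Subtype.ext (h2 _ x'.2 (congrArg Subtype.val hx'))⟩

lemma forgetMap_sum_flag (g : Hom G H) (hG : G.Adm) (hH : H.Adm) (f : (H.forget hH).X)
    (hf : ¬ (H.forget hH).IsVertex f) :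
    ∑ᶠ x ∈ g.forgetMap hG hH ⁻¹' {f}, (G.forget hG).chi x = (H.forget hH).chi f := by
  obtain ⟨x, hx, hx'⟩ := g.forgetMap_flag hG hH f hf
  have : g.forgetMap hG hH ⁻¹' {f} = {x} := by
    ext z
    simp only [Set.mem_preimage, Set.mem_singleton_iff]
    exact ⟨fun h => hx' z h, fun h => h ▸ hx⟩
  rw [this, finsum_mem_singleton, chi_flag hf, chi_flag]
  intro h
  apply hf
  rw [forget_isVertex] at h ⊢
  rw [← hx]
  show H.IsVertex (g.forgetFun x.1)
  rw [g.forgetFun_of_not (nonspec_of_vertex x.2 h)]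
  exact g.isVertex h

lemma forgetMap_sum_ne (g : Hom G H) (hG : G.Adm) (hH : H.Adm) (w : (H.forget hH).X)
    (hw : (H.forget hH).IsVertex w) (hne : w.1 ≠ H.lastVertex) :
    ∑ᶠ x ∈ g.forgetMap hG hH ⁻¹' {w}, (G.forget hG).chi x = (H.forget hH).chi w := by
  rw [forget_chi, ← g.finsum_fiber_chi]
  have hwv := forget_isVertex.1 hw
  have hset : g.toFun ⁻¹' {w.1} =
      (Subtype.val : G.keep → G.X) '' (g.forgetMap hG hH ⁻¹' {w}) := by
    ext x
    simp only [Set.mem_preimage, Set.mem_singleton_iff, Set.mem_image]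
    constructor
    · intro hx
      have hxk : x ∈ G.keep := by
        refine ⟨?_, ?_⟩
        · rintro rfl
          rw [g.map_lastLeg] at hx
          exact H.isLeg_lastLeg.1 (hx ▸ hwv)
        · rintro ⟨-, h⟩
          apply hne
          rw [← hwv, ← hx, ← g.map_r, h, g.map_lastVertex]
      refine ⟨⟨x, hxk⟩, Subtype.ext ?_, rfl⟩
      show g.forgetFun x = w.1
      by_cases h : G.Bad ∧ G.r (G.ι x) = G.lastVertex
      · exact absurd (hx.symm.trans (g.spec_eq_lastVertex (hG.spec hxk h) (hx ▸ hwv))) hne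
      · rw [g.forgetFun_of_not h, hx]
    · rintro ⟨x, hx, rfl⟩
      have hx' : g.forgetFun x.1 = w.1 := congrArg Subtype.val hx
      by_cases hv : H.IsVertex (g.toFun x.1)
      · by_cases h : G.Bad ∧ G.r (G.ι x.1) = G.lastVertex
        · have hs := hG.spec x.2 h
          rw [g.forgetFun_vertex hv] at hx'
          exact absurd (hx'.symm.trans (g.eq_lastVertex hs.pair.r_z (hx' ▸ hwv))) hne
        · rwa [g.forgetFun_of_not h] at hx'
      · rwa [g.forgetFun_flag hv] at hx'
  rw [hset, finsum_mem_image Subtype.val_injective.injOn]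
  exact finsum_mem_congr rfl (fun x _ => forget_chi hG x)

lemma forgetMap_sum (g : Hom G H) (hG : G.Adm) (hH : H.Adm) (w : (H.forget hH).X) :
    ∑ᶠ x ∈ g.forgetMap hG hH ⁻¹' {w}, (G.forget hG).chi x = (H.forget hH).chi w := by
  by_cases hw : (H.forget hH).IsVertex w
  · by_cases hne : w.1 = H.lastVertex
    · have h1 := finsum_preimage (g.forgetMap hG hH) (G.forget hG).chi (H.forget hH).chi {w}ᶜ (by
        intro y hy
        by_cases hyv : (H.forget hH).IsVertex y
        · apply g.forgetMap_sum_ne hG hH y hyv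
          intro h
          exact hy (Subtype.ext (h.trans hne.symm))
        · exact g.forgetMap_sum_flag hG hH y hyv)
      have h2 : ∑ᶠ x ∈ Set.univ, (G.forget hG).chi x = ∑ᶠ x ∈ Set.univ, (H.forget hH).chi x := by
        rw [hG.forget_sum, hH.forget_sum, g.finsum_univ_eq]
      rw [← Set.union_compl_self (g.forgetMap hG hH ⁻¹' {w}),
        finsum_mem_union disjoint_compl_right (Set.toFinite _) (Set.toFinite _),
        ← Set.union_compl_self {w},
        finsum_mem_union disjoint_compl_right (Set.toFinite _) (Set.toFinite _),
        finsum_mem_singleton, ← Set.preimage_compl, h1] at h2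
      linarith
    · exact g.forgetMap_sum_ne hG hH w hw hne
  · exact g.forgetMap_sum_flag hG hH w hw

/-- The morphism induced on the graphs obtained by forgetting the last leg and stabilizing. -/
def forget (g : Hom G H) (hG : G.Adm) (hH : H.Adm) : Hom (G.forget hG) (H.forget hH) where
  toFun := g.forgetMap hG hH
  map_r x := Subtype.ext (g.forgetFun_r hG x.2)
  map_ι x := Subtype.ext (g.forgetFun_ι hG hH x.2)
  map_mark i := Subtype.ext (g.forgetFun_mark hG hH i)
  flag := g.forgetMap_flag hG hH
  fiber_genus w hw := by
    apply genus_of_finsum hw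
    · exact fun x => Subtype.ext (g.forgetFun_ι hG hH x.2)
    · intro x hx
      obtain ⟨i, rfl⟩ := ((G.forget hG).mark_leg x).1 hx
      have : g.forgetMap hG hH ((G.forget hG).mark i) = (H.forget hH).mark i :=
        Subtype.ext (g.forgetFun_mark hG hH i)
      rw [this]
      exact (H.forget hH).isLeg_mark i
    · exact g.forgetMap_sum hG hH w
  fiber_connected w hw := by
    have hwv := forget_isVertex.1 hw
    apply hG.forget_connected (S := g.toFun ⁻¹' {w.1}) _ _ (g.fiber_connected _ hwv)
    · intro x hx
      have : g.forgetMap hG hH x = w ↔ g.forgetFun x.1 = w.1 := Subtype.ext_iff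
      rw [Set.mem_preimage, Set.mem_singleton_iff, this, Set.mem_preimage,
        Set.mem_singleton_iff, g.forgetFun_of_not (nonspec_of_vertex x.2 hx)]
    · intro x hx h
      apply Subtype.ext
      show g.forgetFun x.1 = w.1
      rw [g.forgetFun_of_not hx]; exact h
    · intro x hs hl h1 h2
      apply Subtype.ext
      show g.forgetFun x.1 = w.1
      have h1' : g.toFun x.1 = w.1 := h1
      have h2' : g.toFun (G.ι (G.partner x.1)) = w.1 := h2
      rw [g.forgetFun_vertex (by rw [h1']; exact hwv), ← G.ι_ι (G.partner x.1), g.map_ι, h2',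
        hwv.ι_eq]
    · intro hb hv
      have hv' : H.lastVertex = w.1 := by
        rw [← g.map_lastVertex]; exact hv
      have hnb : ¬ H.Bad := fun hb' => w.2.2 ⟨hb', by rw [← hv']; exact H.isVertex_lastVertex⟩
      obtain ⟨c, h1, h2, h3, h4, h5⟩ := g.exists_contracted hG hb hnb
      refine ⟨c, ?_, h2, h4⟩
      rw [Set.mem_preimage, Set.mem_singleton_iff, g.eq_lastVertex h2 h5, hv']
    · intro x hx
      rw [Set.mem_preimage, Set.mem_singleton_iff] at *
      rw [g.map_r, hx, hwv]
    · intro x hx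
      rw [Set.mem_preimage, Set.mem_singleton_iff] at *
      rw [g.map_ι, hx, hwv.ι_eq]

lemma forgetFun_id {x : G.X} (hx : x ∈ G.keep) : (Hom.id G).forgetFun x = x := by
  by_cases hv : G.IsVertex x
  · exact (Hom.id G).forgetFun_of_not (nonspec_of_vertex hx hv)
  · exact (Hom.id G).forgetFun_flag hv

lemma forgetFun_comp (g : Hom G H) (k : Hom H K) (hG : G.Adm) (hH : H.Adm) {x : G.X}
    (hx : x ∈ G.keep) : (g.comp k).forgetFun x = k.forgetFun (g.forgetFun x) := by
  have hgk : ∀ y, (g.comp k).toFun y = k.toFun (g.toFun y) := fun _ => rfl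
  by_cases h : G.Bad ∧ G.r (G.ι x) = G.lastVertex
  · have hs := hG.spec hx h
    by_cases hb : H.Bad
    · obtain ⟨h1, h2, h3⟩ := g.spec_bad hG hH hb hs
      rw [g.forgetFun_flag h1]
      by_cases hv : K.IsVertex (k.toFun (g.toFun x))
      · rw [k.forgetFun_vertex hv, h3, (g.comp k).forgetFun_vertex hv, hgk]
      · rw [k.forgetFun_flag hv, (g.comp k).forgetFun_flag hv, hgk]
    · rw [k.forgetFun_of_not (fun h' => hb h'.1)]
      by_cases hv : H.IsVertex (g.toFun x)
      · rw [g.forgetFun_vertex hv, (g.comp k).forgetFun_vertex (k.isVertex hv), hgk]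
      · rw [g.forgetFun_flag hv]
        by_cases hv' : K.IsVertex (k.toFun (g.toFun x))
        · rw [(g.comp k).forgetFun_vertex hv', hgk]
          have hz := g.contracted_of_pair hG h.1 hb hs.pair
            (fun h' => hv ((g.isVertex_map_ι x).1 h'))
          rw [g.eq_lastVertex hs.pair.r_z hz, k.map_lastVertex,
            ← (g.comp k).spec_eq_lastVertex hs hv', hgk]
        · rw [(g.comp k).forgetFun_flag hv', hgk]
  · rw [g.forgetFun_of_not h, (g.comp k).forgetFun_of_not h,
      k.forgetFun_of_not (g.not_spec hG h), hgk]

end Hom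

end MGraph

/-! ### The forgetful morphism -/

namespace MGraph

variable {n : ℕ} {P : Type} [AddCommMonoid P]

/-- The edge lengths after forgetting the last leg: if two edges are joined, the length of the new
edge is the sum of their lengths; an edge that is joined to a leg becomes a leg. -/
def forgetLen (G : MGraph (n + 1)) (d : G.X → P) (x : G.X) : P :=
  open Classical in
  if G.Bad ∧ G.r (G.ι x) = G.lastVertex then
    if G.IsLeg (G.partner x) then 0 else d x + d (G.partner x)
  else d x

lemma forgetLen_of_not {G : MGraph (n + 1)} {d : G.X → P} {x : G.X}
    (h : ¬ (G.Bad ∧ G.r (G.ι x) = G.lastVertex)) : G.forgetLen d x = d x := if_neg h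

lemma Spec.forgetLen_leg {G : MGraph (n + 1)} {d : G.X → P} {x : G.X} (h : G.Spec x)
    (hl : G.ι (G.partner x) = G.partner x) : G.forgetLen d x = 0 := by
  rw [forgetLen, if_pos ⟨h.bad, h.r_ι⟩, if_pos ⟨h.pair.z_flag, hl⟩]

lemma Spec.forgetLen_edge {G : MGraph (n + 1)} {d : G.X → P} {x : G.X} (h : G.Spec x)
    (hl : G.ι (G.partner x) ≠ G.partner x) : G.forgetLen d x = d x + d (G.partner x) := by
  rw [forgetLen, if_pos ⟨h.bad, h.r_ι⟩, if_neg (fun h' => hl h'.2)]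

lemma Adm.forgetLen_ι {G : MGraph (n + 1)} (hG : G.Adm) {d : G.X → P}
    (hd : ∀ x, d (G.ι x) = d x) {x : G.X} (hx : x ∈ G.keep) :
    G.forgetLen d (G.forgetInv x) = G.forgetLen d x := by
  by_cases h : G.Bad ∧ G.r (G.ι x) = G.lastVertex
  · have hs := hG.spec hx h
    by_cases hl : G.ι (G.partner x) = G.partner x
    · rw [hs.forgetInv_leg hl]
    · obtain ⟨hs', hp⟩ := hG.spec_symm hs hl
      have hl' : G.ι (G.partner (G.ι (G.partner x))) ≠ G.partner (G.ι (G.partner x)) := by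
        rw [hp, G.ι_ι]
        intro h'
        exact hs.r_ne (by rw [h', hs.r_ι])
      rw [Spec.forgetInv_edge hl, hs'.forgetLen_edge hl', hp, hd, hd, hs.forgetLen_edge hl,
        add_comm]
  · rw [forgetInv_of_not h, forgetLen_of_not h, forgetLen_of_not, hd]
    rw [G.ι_ι]; exact hx.2

lemma Adm.forgetLen_eq_zero {G : MGraph (n + 1)} (hG : G.Adm) {d : G.X → P}
    (hP : ∀ a b : P, a + b = 0 → a = 0) (hd : ∀ x, d x = 0 ↔ G.ι x = x) {x : G.X}
    (hx : x ∈ G.keep) : G.forgetLen d x = 0 ↔ G.forgetInv x = x := by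
  by_cases h : G.Bad ∧ G.r (G.ι x) = G.lastVertex
  · have hs := hG.spec hx h
    by_cases hl : G.ι (G.partner x) = G.partner x
    · rw [hs.forgetInv_leg hl, hs.forgetLen_leg hl]; simp
    · rw [Spec.forgetInv_edge hl, hs.forgetLen_edge hl]
      constructor
      · intro h'
        have := (hd x).1 (hP _ _ h')
        exact absurd (by rw [← this, hs.r_ι]) hs.r_ne
      · intro h'
        exfalso
        apply hs.pair.ne
        rw [← G.ι_ι (G.partner x), h']
  · rw [forgetInv_of_not h, forgetLen_of_not h, hd]

lemma Hom.forgetLen {G H : MGraph (n + 1)} {Q : Type} [AddCommMonoid Q] (g : Hom G H)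
    (hG : G.Adm) (hH : H.Adm) (k : P →+ Q) {d : G.X → P} {d' : H.X → Q}
    (hd' : ∀ x, d' x = 0 ↔ H.ι x = x) (hgd : ∀ x, d' (g.toFun x) = k (d x)) {x : G.X}
    (hx : x ∈ G.keep) : H.forgetLen d' (g.forgetFun x) = k (G.forgetLen d x) := by
  have vz : ∀ y, H.IsVertex y → d' y = 0 := fun y hy => (hd' y).2 hy.ι_eq
  by_cases h : G.Bad ∧ G.r (G.ι x) = G.lastVertex
  · have hs := hG.spec hx h
    by_cases hb : H.Bad
    · obtain ⟨h1, h2, h3⟩ := g.spec_bad hG hH hb hs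
      rw [g.forgetFun_flag h1]
      by_cases hl : G.ι (G.partner x) = G.partner x
      · rw [hs.forgetLen_leg hl, h2.forgetLen_leg (by rw [h3, ← g.map_ι, hl]), map_zero]
      · rw [hs.forgetLen_edge hl, h2.forgetLen_edge, h3, hgd, hgd, map_add]
        rw [h3, ← g.map_ι]
        intro h'
        exact hl (g.injOn h' (by rw [h', ← h3]; exact h2.pair.z_flag))
    · rw [forgetLen_of_not (fun h' => hb h'.1)]
      by_cases hv : H.IsVertex (g.toFun x)
      · rw [g.forgetFun_vertex hv]
        by_cases hl : G.ι (G.partner x) = G.partner x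
        · rw [hs.forgetLen_leg hl, map_zero, hd', ← g.map_ι, hl]
        · rw [hs.forgetLen_edge hl, map_add, ← hgd, ← hgd, vz _ hv, zero_add]
      · rw [g.forgetFun_flag hv]
        have hz := g.contracted_of_pair hG h.1 hb hs.pair
          (fun h' => hv ((g.isVertex_map_ι x).1 h'))
        have hl : G.ι (G.partner x) ≠ G.partner x := fun hl =>
          (g.isLeg ⟨hs.pair.z_flag, hl⟩).1 hz
        rw [hs.forgetLen_edge hl, map_add, ← hgd, ← hgd, vz _ hz, add_zero]
  · rw [g.forgetFun_of_not h, forgetLen_of_not h, forgetLen_of_not (g.not_spec hG h), hgd]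

end MGraph

namespace MTrop

variable {g n : ℕ}

/-- If `2g - 2 + n > 0`, the last leg of a stable curve can be forgotten. -/
lemma adm (hgn : 2 < 2 * g + n) (A : MTrop g (n + 1)) : A.curve.toMGraph.Adm where
  stable := A.stable
  connected := A.curve.connected
  big := by
    rw [A.curve.toMGraph.finsum_chi_univ, A.curve.genus_eq]
    push_cast
    omega

/-- The stable curve obtained by forgetting the last leg. -/
def forgetObj (hgn : 2 < 2 * g + n) (A : MTrop g (n + 1)) : MTrop g n where
  cone := A.cone
  curve :=
    { A.curve.toMGraph.forget (A.adm hgn) with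
      connected := (A.adm hgn).forget_connected_univ
      genus_eq := (A.adm hgn).forget_genus.trans A.curve.genus_eq
      d := fun x => A.curve.toMGraph.forgetLen A.curve.d x.1
      d_ι := fun x => (A.adm hgn).forgetLen_ι A.curve.d_ι x.2
      d_eq_zero := fun (x : A.curve.toMGraph.keep) =>
        ((A.adm hgn).forgetLen_eq_zero (fun _ _ => RPC.sharp) A.curve.d_eq_zero x.2).trans
          (Subtype.ext_iff (a1 := ⟨A.curve.toMGraph.forgetInv x.1, (A.adm hgn).forgetInv_mem x.2⟩)
            (a2 := x)).symm }
  stable := (A.adm hgn).forget_stable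

/-- The forgetful functor. -/
def forgetFunctor (hgn : 2 < 2 * g + n) : MTrop g (n + 1) ⥤ MTrop g n where
  obj A := A.forgetObj hgn
  map {A B} φ := Hom.mk' (A := A.forgetObj hgn) (B := B.forgetObj hgn) (@Hom.base _ _ A B φ)
    ((Hom.graph φ).forget (B.adm hgn) (A.adm hgn))
    (fun (x : B.curve.toMGraph.keep) => (Hom.graph φ).forgetLen (B.adm hgn) (A.adm hgn) (RPC.pull (Hom.base φ))
      A.curve.d_eq_zero (Hom.d_eq φ) x.2)
  map_id _ := hom_ext rfl (fun x => Subtype.ext (MGraph.Hom.forgetFun_id x.2))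
  map_comp {A B C} φ ψ := hom_ext rfl (fun (x : C.curve.toMGraph.keep) => Subtype.ext
    (MGraph.Hom.forgetFun_comp (Hom.graph ψ) (Hom.graph φ) (C.adm hgn) (B.adm hgn) x.2))

/-- The forgetful morphism `M_{g,n+1} → M_{g,n}`. -/
def forget (hgn : 2 < 2 * g + n) : BasedFunctor (based g (n + 1)) (based g n) where
  toFunctor := forgetFunctor hgn
  w := by rfl

/-- The function `h_{n+1}`: the weight of the vertex to which the last leg is attached. -/
def lastWeight (A : MTrop g (n + 1)) : ℤ :=
  A.curve.h (A.curve.r (A.curve.mark (Fin.last n)))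

end MTrop
/-! ### The cone over a tropical curve -/

namespace MGraph

variable {n : ℕ} {P Q R : Type} [AddCommMonoid P] [AddCommMonoid Q] [AddCommMonoid R]

/-- The points with coordinates in `P` of the disjoint union of the pieces of the cone over a graph
`G` with lengths `ℓ`: a vertex; a point on a leg at distance `t` from its root; a point on a finite
edge `{f, ι f}` at distance `t` from the root of `f` and `t'` from the root of `ι f`. -/
inductive PrePt (G : MGraph n) (ℓ : G.X → P) : Type
  | vertex (v : G.X) (hv : G.IsVertex v) : PrePt G ℓ
  | leg (l : G.X) (hl : G.IsLeg l) (t : P) : PrePt G ℓ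
  | edge (f : G.X) (hf : G.ι f ≠ f) (t t' : P) (h : t + t' = ℓ f) : PrePt G ℓ

/-- The gluing: the face of a leg or of an edge that corresponds to a flag `f` is identified with
the root of `f`, and the two descriptions of a finite edge by its two flags are identified. -/
inductive PtRel (G : MGraph n) (ℓ : G.X → P) : PrePt G ℓ → PrePt G ℓ → Prop
  | leg_zero (l : G.X) (hl : G.IsLeg l) :
      PtRel G ℓ (.leg l hl 0) (.vertex (G.r l) (G.isVertex_r l))
  | edge_zero (f : G.X) (hf : G.ι f ≠ f) (t' : P) (h : 0 + t' = ℓ f) :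
      PtRel G ℓ (.edge f hf 0 t' h) (.vertex (G.r f) (G.isVertex_r f))
  | edge_symm (f : G.X) (hf : G.ι f ≠ f) (hf' : G.ι (G.ι f) ≠ G.ι f) (t t' : P)
      (h : t + t' = ℓ f) (h' : t' + t = ℓ (G.ι f)) :
      PtRel G ℓ (.edge f hf t t' h) (.edge (G.ι f) hf' t' t h')

/-- The points with coordinates in `P` of the glued space. -/
def Pt (G : MGraph n) (ℓ : G.X → P) : Type := Quot (PtRel G ℓ)

/-- The map on points of the pieces induced by a homomorphism of monoids and a morphism of graphs
that are compatible with lengths. -/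
def PrePt.map {G H : MGraph n} {ℓ : G.X → P} {m : H.X → Q} (g : Hom G H) (k : P →+ Q)
    (h : ∀ x, m (g.toFun x) = k (ℓ x)) : PrePt G ℓ → PrePt H m
  | .vertex v hv => .vertex (g.toFun v) (g.isVertex hv)
  | .leg l hl t => .leg (g.toFun l) (g.isLeg hl) (k t)
  | .edge f hf t t' e =>
      open Classical in
      if hv : H.IsVertex (g.toFun f) then .vertex (g.toFun f) hv
      else .edge (g.toFun f) (fun h' => hf (g.injOn (by rw [g.map_ι, h']) (by
        rw [g.map_ι, h']; exact hv))) (k t) (k t') (by rw [h, ← map_add, e])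

/-- The induced map on points of the glued spaces. -/
def Pt.map {G H : MGraph n} {ℓ : G.X → P} {m : H.X → Q} (g : Hom G H) (k : P →+ Q)
    (h : ∀ x, m (g.toFun x) = k (ℓ x)) : Pt G ℓ → Pt H m :=
  Quot.lift (fun p => Quot.mk _ (PrePt.map g k h p)) (by
    intro a b hab
    cases hab with
    | leg_zero l hl =>
      simp only [PrePt.map, map_zero, g.map_r]
      exact Quot.sound (PtRel.leg_zero _ _)
    | edge_zero f hf t' e =>
      by_cases hv : H.IsVertex (g.toFun f)
      · simp only [PrePt.map, dif_pos hv]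
        congr 2
        rw [g.map_r]; exact hv.symm
      · simp only [PrePt.map, dif_neg hv, map_zero, g.map_r]
        exact Quot.sound (PtRel.edge_zero _ _ _ _)
    | edge_symm f hf hf' t t' e e' =>
      by_cases hv : H.IsVertex (g.toFun f)
      · have hv' : H.IsVertex (g.toFun (G.ι f)) := by
          rw [g.map_ι, isVertex_ι]; exact hv
        simp only [PrePt.map, dif_pos hv, dif_pos hv']
        congr 2
        rw [g.map_ι, hv.ι_eq]
      · have hv' : ¬ H.IsVertex (g.toFun (G.ι f)) := fun h' => by
          rw [g.map_ι, isVertex_ι] at h'; exact hv h'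
        simp only [PrePt.map, dif_neg hv, dif_neg hv', g.map_ι]
        exact Quot.sound (PtRel.edge_symm _ _ _ _ _ _ _))

lemma Pt.map_id {G : MGraph n} {ℓ : G.X → P} (k : P →+ P) (hk : ∀ t, k t = t) (g : Hom G G)
    (hg : ∀ x, g.toFun x = x) (h : ∀ x, ℓ (g.toFun x) = k (ℓ x)) (p : Pt G ℓ) :
    Pt.map g k h p = p := by
  induction p using Quot.ind with
  | mk p =>
    obtain rfl : k = AddMonoidHom.id P := AddMonoidHom.ext hk
    obtain rfl : g = Hom.id G := Hom.ext (funext hg)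
    cases p with
    | vertex v hv => rfl
    | leg l hl t => rfl
    | edge f hf t t' e =>
      have hv : ¬ G.IsVertex f := fun h' => hf h'.ι_eq
      exact congrArg (Quot.mk _) (dif_neg hv)

lemma Pt.map_map {G H K : MGraph n} {ℓ : G.X → P} {m : H.X → Q} {q : K.X → R} (g : Hom G H)
    (k : P →+ Q) (h : ∀ x, m (g.toFun x) = k (ℓ x)) (g' : Hom H K) (k' : Q →+ R)
    (h' : ∀ x, q (g'.toFun x) = k' (m x)) (g'' : Hom G K) (k'' : P →+ R)
    (h'' : ∀ x, q (g''.toFun x) = k'' (ℓ x)) (hg : ∀ x, g''.toFun x = g'.toFun (g.toFun x))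
    (hk : ∀ t, k'' t = k' (k t)) (p : Pt G ℓ) :
    Pt.map g' k' h' (Pt.map g k h p) = Pt.map g'' k'' h'' p := by
  obtain rfl : k'' = k'.comp k := AddMonoidHom.ext hk
  obtain rfl : g'' = g.comp g' := Hom.ext (funext hg)
  induction p using Quot.ind with
  | mk p =>
    cases p with
    | vertex v hv => rfl
    | leg l hl t => rfl
    | edge f hf t t' e =>
      refine congrArg (Quot.mk _) ?_
      by_cases hv : H.IsVertex (g.toFun f)
      · have hv' : K.IsVertex ((g.comp g').toFun f) := g'.isVertex hv
        simp only [PrePt.map, dif_pos hv, dif_pos hv']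
        rfl
      · by_cases hv' : K.IsVertex ((g.comp g').toFun f)
        · have hv'' : K.IsVertex (g'.toFun (g.toFun f)) := hv'
          simp only [PrePt.map, dif_neg hv, dif_pos hv', dif_pos hv'']
          rfl
        · have hv'' : ¬ K.IsVertex (g'.toFun (g.toFun f)) := hv'
          simp only [PrePt.map, dif_neg hv, dif_neg hv', dif_neg hv'']
          rfl

end MGraph

namespace TropicalCurve

variable {g n : ℕ} {σ : RPC}

/-- The cone over a tropical curve over `σ`, as a functor on the category of cones. A morphism from
`α` to `Cone Γ` consists of a morphism `a : α → σ` and of a point, with coordinates in `S_α`, of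
the space glued from the pieces of `Γ` with lengths `a^* d`. In other words, one glues the functors
represented by `σ` (for a vertex), by `σ × ℝ≥0` (for a leg) and by the fibre product of `σ` and
`ℝ≥0 × ℝ≥0` over `ℝ≥0` (for a finite edge `e`, where the maps are `d e` and the sum). -/
def Cone (Γ : TropicalCurve g n σ.S) : RPCᵒᵖ ⥤ Type where
  obj α := Σ a : α.unop ⟶ σ, MGraph.Pt Γ.toMGraph (fun x => RPC.pull a (Γ.d x))
  map β := TypeCat.ofHom (fun x =>
    ⟨β.unop ≫ x.1, MGraph.Pt.map (MGraph.Hom.id _) (RPC.pull β.unop) (fun _ => rfl) x.2⟩)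
  map_id α := by
    refine ConcreteCategory.hom_ext _ _ (fun x => ?_)
    exact Sigma.ext rfl (heq_of_eq (MGraph.Pt.map_id (RPC.pull (𝟙 _)) (fun _ => rfl) _
      (fun _ => rfl) (fun _ => rfl) x.2))
  map_comp β γ := by
    refine ConcreteCategory.hom_ext _ _ (fun x => ?_)
    exact Sigma.ext rfl (heq_of_eq (MGraph.Pt.map_map _ _ _ _ _ _ _ _ _ (fun _ => rfl)
      (fun _ => rfl) x.2).symm)

/-- The structure morphism `c : Cone Γ → σ`. -/
def coneProj (Γ : TropicalCurve g n σ.S) : Γ.Cone ⟶ yoneda.obj σ where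
  app _ := TypeCat.ofHom (fun x => x.1)

/-- The restriction to `Cone(v) = σ` of the quotient map. -/
def coneVertex (Γ : TropicalCurve g n σ.S) (v : Γ.X) (hv : Γ.IsVertex v) :
    yoneda.obj σ ⟶ Γ.Cone where
  app _ := TypeCat.ofHom (fun a => ⟨a, Quot.mk _ (.vertex v hv)⟩)

/-- The sections of `Cone Γ → σ`, as elements of `Cone Γ (σ)`. -/
def Section (Γ : TropicalCurve g n σ.S) : Type :=
  {x : Γ.Cone.obj (op σ) // Γ.coneProj.app (op σ) x = 𝟙 σ}

/-- The function `H` on sections: the value is `h(v)` if the image of the section is the image of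
`Cone(v)`, and zero if there is no such vertex. -/
def sectionWeight (Γ : TropicalCurve g n σ.S) (s : Γ.Section) : ℤ :=
  open Classical in
  if h : ∃ v, ∃ hv : Γ.IsVertex v,
    Subfunctor.range (yonedaEquiv.symm s.1) = Subfunctor.range (Γ.coneVertex v hv)
  then Γ.h h.choose else 0

end TropicalCurve

namespace MTrop

variable {g n : ℕ}

/-- For a morphism `(σ', Γ') → (σ, Γ)`, the fibre product of `Cone Γ` and `σ'` over `σ`. -/
def coneFiber {A B : MTrop g n} (φ : A ⟶ B) : RPCᵒᵖ ⥤ Type where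
  obj α := {x : B.curve.Cone.obj α × (α.unop ⟶ A.cone) // x.1.1 = x.2 ≫ Hom.base φ}
  map β := TypeCat.ofHom (fun x => ⟨(B.curve.Cone.map β x.1.1, β.unop ≫ x.1.2), by
    have h := x.2
    exact (congrArg (β.unop ≫ ·) h).trans (Category.assoc _ _ _).symm⟩)
  map_id α := by
    refine ConcreteCategory.hom_ext _ _ (fun x => ?_)
    apply Subtype.ext
    exact Prod.ext (by simp) (by simp)
  map_comp β γ := by
    refine ConcreteCategory.hom_ext _ _ (fun x => ?_)
    apply Subtype.ext
    exact Prod.ext (by simp) (by simp)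

/-- The projection to `Cone Γ`. -/
def coneFiberFst {A B : MTrop g n} (φ : A ⟶ B) : coneFiber φ ⟶ B.curve.Cone where
  app _ := TypeCat.ofHom (fun x => x.1.1)

/-- The pullback map to `Cone Γ'` over `σ'`. -/
def conePullback {A B : MTrop g n} (φ : A ⟶ B) : coneFiber φ ⟶ A.curve.Cone where
  app α := TypeCat.ofHom (fun x => ⟨x.1.2, MGraph.Pt.map (Hom.graph φ) (AddMonoidHom.id _)
    (fun y => by
      rw [Hom.d_eq, ← RPC.pull_comp, ← x.2]; rfl) x.1.1.2⟩)
  naturality α β f := by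
    refine ConcreteCategory.hom_ext _ _ (fun x => ?_)
    refine Sigma.ext rfl (heq_of_eq ?_)
    have h : ∀ y, RPC.pull (f.unop ≫ x.1.2) (A.curve.d ((Hom.graph φ).toFun y)) =
        RPC.pull f.unop (RPC.pull x.1.1.1 (B.curve.d y)) := fun y => by
      rw [Hom.d_eq, RPC.pull_comp, ← RPC.pull_comp x.1.2, ← x.2]
    refine (MGraph.Pt.map_map _ _ _ _ _ _ (Hom.graph φ) (RPC.pull f.unop) h (fun _ => rfl)
      (fun _ => rfl) x.1.1.2).trans
      (MGraph.Pt.map_map _ _ _ _ _ _ _ _ _ (fun _ => rfl) (fun _ => rfl) _).symm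

end MTrop
namespace MTrop

variable {g n : ℕ}

/-- The pullback of sections along a morphism `(σ', Γ') → (σ, Γ)`. -/
def sectionPullback {A B : MTrop g n} (φ : A ⟶ B) (s : B.curve.Section) : A.curve.Section :=
  ⟨(conePullback φ).app (op A.cone)
    ⟨(B.curve.Cone.map (Hom.base φ).op s.1, 𝟙 A.cone), by
      have h : s.1.1 = 𝟙 B.cone := s.2
      change Hom.base φ ≫ s.1.1 = 𝟙 A.cone ≫ Hom.base φ
      rw [h, Category.comp_id, Category.id_comp]⟩, rfl⟩

lemma sectionPullback_mk {A B : MTrop g n} (φ : A ⟶ B)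
    (p : MGraph.Pt B.curve.toMGraph (fun x => RPC.pull (𝟙 B.cone) (B.curve.d x))) :
    sectionPullback φ ⟨⟨𝟙 B.cone, p⟩, rfl⟩ = ⟨⟨𝟙 A.cone, MGraph.Pt.map (Hom.graph φ)
      (RPC.pull (Hom.base φ)) (fun x => Hom.d_eq φ x) p⟩, rfl⟩ := by
  apply Subtype.ext
  refine Sigma.ext rfl (heq_of_eq ?_)
  exact MGraph.Pt.map_map _ _ _ _ _ _ (Hom.graph φ) (RPC.pull (Hom.base φ))
    (fun x => Hom.d_eq φ x) (fun _ => rfl) (fun _ => rfl) p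

/-- The presheaf of sections of `Cone Γ → σ` on the category of tropical curves. -/
def sections (g n : ℕ) : (MTrop g n)ᵒᵖ ⥤ Type where
  obj A := A.unop.curve.Section
  map φ := TypeCat.ofHom (sectionPullback φ.unop)
  map_id A := by
    refine ConcreteCategory.hom_ext _ _ (fun s => ?_)
    obtain ⟨⟨a, p⟩, h⟩ := s
    obtain rfl : a = 𝟙 A.unop.cone := h
    refine (sectionPullback_mk (𝟙 A.unop) p).trans (Subtype.ext (Sigma.ext rfl (heq_of_eq ?_)))
    exact MGraph.Pt.map_id _ (fun _ => rfl) _ (fun _ => rfl) _ p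
  map_comp {A B C} φ ψ := by
    refine ConcreteCategory.hom_ext _ _ (fun s => ?_)
    obtain ⟨⟨a, p⟩, h⟩ := s
    obtain rfl : a = 𝟙 A.unop.cone := h
    refine (sectionPullback_mk (ψ.unop ≫ φ.unop) p).trans (Eq.symm ?_)
    refine (congrArg (sectionPullback ψ.unop) (sectionPullback_mk φ.unop p)).trans ?_
    refine (sectionPullback_mk ψ.unop _).trans (Subtype.ext (Sigma.ext rfl (heq_of_eq ?_)))
    exact MGraph.Pt.map_map _ _ _ _ _ _ _ _ _ (fun _ => rfl) (fun _ => rfl) p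

end MTrop

/-! ### Categories of points, fibre products and cartesian squares -/

/-- The category of points of a presheaf `F`, i.e. `F` viewed as a category fibered in sets: the
objects are pairs of an object `α` and an element of `F(α)`. -/
structure Pts {C : Type 1} [Category.{0} C] (F : Cᵒᵖ ⥤ Type) : Type 1 where
  /-- the base -/
  base : C
  /-- the point -/
  pt : F.obj (op base)

namespace Pts

variable {C : Type 1} [Category.{0} C] {F G : Cᵒᵖ ⥤ Type}

/-- A morphism of points: a morphism of the bases along which one point pulls back to the other. -/
@[ext]
structure Hom (x y : Pts F) : Type where
  /-- the morphism of the bases -/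
  base : x.base ⟶ y.base
  map_pt : F.map base.op y.pt = x.pt

instance : Category (Pts F) where
  Hom := Hom
  id x := ⟨𝟙 x.base, by simp⟩
  comp f g := ⟨f.base ≫ g.base, by simp [f.map_pt, g.map_pt]⟩

/-- The projection to the base category. -/
def proj (F : Cᵒᵖ ⥤ Type) : Pts F ⥤ C where
  obj x := x.base
  map f := f.base

/-- The category of points as a category over the base category. -/
abbrev based (F : Cᵒᵖ ⥤ Type) : BasedCategory.{0, 1} C := BasedCategory.ofFunctor (proj F)

/-- The functor on points induced by a morphism of presheaves. -/
def mapFunctor (η : F ⟶ G) : Pts F ⥤ Pts G where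
  obj x := ⟨x.base, η.app _ x.pt⟩
  map {x y} f := ⟨@Hom.base _ _ _ x y f, by
    rw [← NatTrans.naturality_apply, f.map_pt]⟩

/-- The functor on points over the base category. -/
def map (η : F ⟶ G) : BasedFunctor (based F) (based G) where
  toFunctor := mapFunctor η
  w := by rfl

end Pts

section TwoCartesian

variable {B : Type 1} [Category.{0} B] {𝒲 𝒳 𝒴 𝒵 : BasedCategory.{0, 1} B}

/-- The 2-fibre product of `𝒳` and `𝒴` over `𝒵` (all of them categories over `B`): the objects are
triples of an object `x` of `𝒳`, an object `y` of `𝒴` and an isomorphism `F x ≅ G y` over an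
identity of `B`. -/
abbrev TwoFiberProduct (F : BasedFunctor 𝒳 𝒵) (G : BasedFunctor 𝒴 𝒵) : Type 1 :=
  ObjectProperty.FullSubcategory
    (fun o : Limits.CategoricalPullback F.toFunctor G.toFunctor =>
      𝒵.p.IsHomLift (𝟙 (𝒳.p.obj o.fst)) o.iso.hom)

/-- The functor to the 2-fibre product induced by a 2-commutative square. -/
def toTwoFiberProduct {F : BasedFunctor 𝒳 𝒵} {G : BasedFunctor 𝒴 𝒵} {L : BasedFunctor 𝒲 𝒳}
    {R : BasedFunctor 𝒲 𝒴} (β : L.comp F ≅ R.comp G) : 𝒲.obj ⥤ TwoFiberProduct F G where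
  obj w := ⟨⟨L.obj w, R.obj w,
    ((BasedNatTrans.forgetful _ _).mapIso β).app w⟩, β.hom.isHomLift (L.w_obj w).symm⟩
  map {w w'} f := ObjectProperty.homMk
    { fst := L.map f
      snd := R.map f
      w := β.hom.toNatTrans.naturality f }
  map_id w := by
    apply ObjectProperty.hom_ext
    exact Limits.CategoricalPullback.hom_ext (L.map_id w) (R.map_id w)
  map_comp f f' := by
    apply ObjectProperty.hom_ext
    exact Limits.CategoricalPullback.hom_ext (L.map_comp f f') (R.map_comp f f')

/-- A 2-commutative square is 2-cartesian if the functor to the 2-fibre product is an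
equivalence. -/
def IsTwoCartesian {F : BasedFunctor 𝒳 𝒵} {G : BasedFunctor 𝒴 𝒵} {L : BasedFunctor 𝒲 𝒳}
    {R : BasedFunctor 𝒲 𝒴} (β : L.comp F ≅ R.comp G) : Prop :=
  (toTwoFiberProduct β).IsEquivalence

end TwoCartesian

/-! ### The universal curve -/

namespace MTrop

variable {g n : ℕ}

/-- The universal curve `X_{g,n}`, as a category over the category of cones: the objects are the
triples `(σ, Γ, s)` of a cone `σ`, a stable tropical curve `Γ` over `σ` and a section `s` of
`Cone Γ → σ`. -/
def universalCurve (g n : ℕ) : BasedCategory.{0, 1} RPC :=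
  BasedCategory.ofFunctor (Pts.proj (sections g n) ⋙ proj g n)

/-- The projection `X_{g,n} → M_{g,n}`, `(σ, Γ, s) ↦ (σ, Γ)`. -/
def universalCurveProj (g n : ℕ) : BasedFunctor (universalCurve g n) (based g n) where
  toFunctor := Pts.proj (sections g n)
  w := by rfl

/-- A cone `σ` as a category over the category of cones: the objects over `α` are the morphisms
`α → σ`. -/
abbrev coneStack (σ : RPC) : BasedCategory.{0, 1} RPC := Pts.based (yoneda.obj σ)

/-- The cone over a tropical curve, as a category over the category of cones. -/
abbrev curveStack (A : MTrop g n) : BasedCategory.{0, 1} RPC := Pts.based A.curve.Cone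

/-- A morphism `u : σ → M_{g,n}` that corresponds to the tropical curve `Γ` over `σ`, i.e. a
morphism together with an isomorphism over `σ` between `Γ` and the image of the identity of `σ`. -/
structure ClassifyingMap (A : MTrop g n) where
  /-- the morphism -/
  u : BasedFunctor (coneStack A.cone) (based g n)
  /-- the isomorphism with the given tropical curve -/
  iso : u.obj ⟨A.cone, 𝟙 A.cone⟩ ≅ A
  isHomLift : (proj g n).IsHomLift (𝟙 A.cone) iso.hom

/-- The structure morphism `c : Cone Γ → σ`. -/
def curveStackProj (A : MTrop g n) : BasedFunctor A.curveStack (coneStack A.cone) :=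
  Pts.map A.curve.coneProj

/-- A section of `Cone Γ → σ`, as an object of `Cone Γ` over `σ`. -/
def sectionPoint (A : MTrop g n) (s : A.curve.Section) : A.curveStack.obj :=
  ⟨A.cone, s.1⟩

/-- The tautological morphism in the category of points of `σ` from an object `a : α → σ` to the
identity of `σ`. -/
def toId {σ : RPC} (x : (coneStack σ).obj) :
    x ⟶ (⟨σ, 𝟙 σ⟩ : (coneStack σ).obj) :=
  ⟨x.pt, show x.pt ≫ 𝟙 σ = x.pt from Category.comp_id _⟩

/-- A 2-commutative square with sides `Cone Γ → σ → M_{g,n}` and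
`Cone Γ → M_{g,n+1} → M_{g,n}`, where `σ → M_{g,n}` is a given morphism corresponding to `Γ`. -/
structure CurveSquare (hgn : 2 < 2 * g + n) {A : MTrop g n} (C : ClassifyingMap A) where
  /-- the morphism `U : Cone Γ → M_{g,n+1}` -/
  U : BasedFunctor A.curveStack (based g (n + 1))
  /-- the 2-isomorphism -/
  β : A.curveStackProj.comp C.u ≅ U.comp (forget hgn)

/-- The morphism from the image of a point `x` of `Cone Γ` in `M_{g,n}` to `Γ`. -/
def CurveSquare.toCurve {hgn : 2 < 2 * g + n} {A : MTrop g n} {C : ClassifyingMap A}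
    (S : CurveSquare hgn C) (x : A.curveStack.obj) :
    (forgetFunctor hgn).obj (S.U.obj x) ⟶ A :=
  S.β.inv.app x ≫ C.u.map (toId (A.curveStackProj.obj x)) ≫ C.iso.hom

/-- Contravariance: for a morphism `φ : (σ', Γ') → (σ, Γ)`, the square of `Γ'` is compatible with
the square of `Γ`. On the fibre product of `Cone Γ` and `σ'` over `σ` there is an isomorphism
between the map to `M_{g,n+1}` through the pullback map to `Cone Γ'` and the map through `Cone Γ`,
which induces the morphism `φ` of tropical curves. -/
def CurveSquare.Compatible {hgn : 2 < 2 * g + n} {A B : MTrop g n} (φ : A ⟶ B)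
    {C : ClassifyingMap A} {D : ClassifyingMap B} (S : CurveSquare hgn C)
    (T : CurveSquare hgn D) : Prop :=
  ∃ ν : (Pts.map (conePullback φ)).comp S.U ≅ (Pts.map (coneFiberFst φ)).comp T.U,
    ∀ x : (Pts.based (coneFiber φ)).obj,
      (forgetFunctor hgn).map (ν.hom.app x) ≫ T.toCurve ((Pts.map (coneFiberFst φ)).obj x) =
        S.toCurve ((Pts.map (conePullback φ)).obj x) ≫ φ

end MTrop

end TropicalModuli

end

open CategoryTheory TropicalModuli

/-! The inverse of Φ is more natural than Φ itself. A curve with n+1 legs is sent to the curve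
without its last leg together with the position of that leg, which is a section of the cone
(`toSections`). If no vertex has to be deleted, the position is the vertex carrying the leg.
Otherwise the deleted vertex has weight 0 and two other flags, and the position is the point of the
joined edge, or of the prolonged leg, whose distances are the lengths of the pieces (`lastPt`).
Naturality under contractions is `Hom.map_lastPt`. Part (a) amounts to showing that `toSections` is
an equivalence.

Full faithfulness reduces to morphisms over isomorphisms of cones. Every morphism of curves is
cartesian (`exists_lift`), because a morphism of graphs that contracts everything contracted by `g`
factors through `g` (`exists_factor`); and pullbacks exist (`pullback`), by contracting the edges
whose length becomes zero. Over an isomorphism of cones nothing is contracted and graph morphisms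
are bijections. The removed part of the graph is then rigid: it consists of the last leg and
possibly a vertex with two flags, each of them opposite to a remaining flag or carrying a mark. The
normal form `Pt.loc` of the section tells whether a vertex was deleted, which flags were affected,
and into which lengths a joined edge was cut (`mem_loc_lastPt`). Hence an isomorphism of the
stabilized curves that respects the sections extends (`ForgetEquiv.ext`), and it does so in only one
way (`Hom.eq_of_forgetFun_eq`).

Essential surjectivity is a construction: a leg is attached at a vertex (`attach`), or at a new
vertex of weight 0 in the interior of an edge or leg (`sprout`). Genus and stability are handled
throughout by the local Euler characteristic `chi`, equal to 2h-2 on vertices and 1 on flags. It is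
additive over the fibers of a morphism, and its sum over the star of v is 2h(v)-2+val(v). A new leg
adds 1 to one star; a subdivision adds a star of sum 0.

The weights agree because a deleted vertex has weight 0 while the corresponding section runs through
no vertex, and otherwise the section is the vertex itself.

For (b), a point of the cone of Γ over α is a morphism a from α to σ and a point of the space glued
with lengths a^*d. An edge with a^*d = 0 collapses in this space, since the monoid of coordinates is
sharp, exactly as it is contracted in the pullback of Γ. So such points are the same as sections of
the pullback (`sectionAt_injective`, `sectionAt_surjective`), which identifies the cone of Γ with
the fibre product of σ and the universal curve; composing with Φ gives the 2-cartesian square.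
Contravariance comes from lifting φ to the two curves over a point of the fibre product
(`fiberHom`). -/

noncomputable section

namespace TropicalModuli

/-! ### Contractions of graphs -/

namespace MGraph

variable {n : ℕ}

/-- Two vertices of a subgraph are joined by a chain of flags of this subgraph. -/
abbrev Reach (G : MGraph n) (S : Set G.X) : G.X → G.X → Prop :=
  Relation.ReflTransGen (fun a b => ∃ f ∈ S, G.r f = a ∧ G.r (G.ι f) = b)

lemma Reach.symm {G : MGraph n} {S : Set G.X} (hS : ∀ x ∈ S, G.ι x ∈ S) {a b : G.X}
    (h : G.Reach S a b) : G.Reach S b a := by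
  induction h with
  | refl => exact Relation.ReflTransGen.refl
  | tail _ hs ih =>
    obtain ⟨f, hf, h1, h2⟩ := hs
    exact Relation.ReflTransGen.head ⟨G.ι f, hS f hf, h2, by rw [G.ι_ι, h1]⟩ ih

lemma IsVertex.of_ι {G : MGraph n} {x : G.X} (hx : G.IsVertex (G.ι x)) : G.IsVertex x :=
  isVertex_ι.1 hx

lemma not_isVertex_of_ι_ne {G : MGraph n} {x : G.X} (hx : G.ι x ≠ x) : ¬ G.IsVertex x :=
  fun h => hx h.ι_eq

/-- The first Betti number of a connected subgraph is nonnegative, hence so is its genus. -/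
lemma Connected.genus_nonneg {G : MGraph n} {S : Set G.X} (hS : G.Connected S)
    (hr : ∀ x ∈ S, G.r x ∈ S) : 0 ≤ G.genus S := by
  classical
  have : Nonempty G.X := hS.1.to_subtype.map Subtype.val
  let V := {v // v ∈ S ∧ G.IsVertex v}
  -- The underlying simple graph drops loops and merges parallel edges. It is still connected, so it
  -- satisfies #V ≤ #E + 1, and it has at most as many edges as `S`.
  let Γ : SimpleGraph V := SimpleGraph.fromRel
    (fun a b => ∃ f ∈ S, G.r f = a.1 ∧ G.r (G.ι f) = b.1)
  obtain ⟨x₀, hx₀⟩ := hS.1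
  have : Nonempty V := ⟨⟨G.r x₀, hr _ hx₀, G.isVertex_r _⟩⟩
  have hpre : ∀ (v : V) (w : G.X), G.Reach S v.1 w → ∀ hw : w ∈ S ∧ G.IsVertex w,
      Γ.Reachable v ⟨w, hw⟩ := by
    intro v w h
    induction h with
    | refl => exact fun _ => SimpleGraph.Reachable.refl _
    | @tail a b _ hs ih =>
      intro hb
      obtain ⟨f, hf, h1, h2⟩ := hs
      have ha : a ∈ S ∧ G.IsVertex a := h1 ▸ ⟨hr f hf, G.isVertex_r f⟩
      refine (ih ha).trans ?_
      by_cases hab : (⟨a, ha⟩ : V) = ⟨b, hb⟩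
      · rw [hab]
      · exact SimpleGraph.Adj.reachable
          ((SimpleGraph.fromRel_adj _ _ _).2 ⟨hab, Or.inl ⟨f, hf, h1, h2⟩⟩)
  have hconn : Γ.Connected := by
    refine SimpleGraph.connected_iff _ |>.2 ⟨fun v w => ?_, this⟩
    exact hpre v w.1 (hS.2 _ v.2.1 _ w.2.1 v.2.2 w.2.2) w.2
  have h1 := hconn.card_vert_le_card_edgeSet_add_one
  have hV : Nat.card V = {v ∈ S | G.IsVertex v}.ncard := rfl
  have hE : Nat.card Γ.edgeSet ≤ (G.edges S).ncard := by
    have hex : ∀ e ∈ Γ.edgeSet, ∃ f ∈ S, G.ι f ≠ f ∧ s(G.r f, G.r (G.ι f)) = e.map Subtype.val := by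
      intro e
      induction e with
      | _ a b =>
        intro he
        rw [SimpleGraph.mem_edgeSet, SimpleGraph.fromRel_adj] at he
        obtain ⟨hne, ⟨f, hf, h1, h2⟩ | ⟨f, hf, h1, h2⟩⟩ := he
        · refine ⟨f, hf, fun h => hne (Subtype.ext ?_), ?_⟩
          · rw [← h1, ← h2, h]
          · rw [Sym2.map_mk, h1, h2]
        · refine ⟨f, hf, fun h => hne (Subtype.ext ?_), ?_⟩
          · rw [← h1, ← h2, h]
          · rw [Sym2.map_mk, h1, h2, Sym2.eq_swap]
    -- A flag is chosen over each simple edge. The pair of this flag and its opposite determines the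
    -- end points, so distinct simple edges give distinct edges of `S`.
    choose! F hF1 hF2 hF3 using hex
    rw [Nat.card_coe_set_eq]
    refine Set.ncard_le_ncard_of_injOn (fun e => ({F e, G.ι (F e)} : Set G.X)) ?_ ?_
      (Set.toFinite _)
    · intro e he
      exact ⟨F e, hF1 e he, hF2 e he, rfl⟩
    · intro e he e' he' hee
      apply Sym2.map.injective Subtype.val_injective
      rw [← hF3 e he, ← hF3 e' he']
      have hee' : ({F e, G.ι (F e)} : Set G.X) = {F e', G.ι (F e')} := hee
      have : F e ∈ ({F e', G.ι (F e')} : Set G.X) := by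
        rw [← hee']; simp
      rcases this with h | h
      · rw [h]
      · rw [Set.mem_singleton_iff] at h
        rw [h, G.ι_ι, Sym2.eq_swap]
  rw [hV] at h1
  rw [genus]
  have : (0 : ℤ) ≤ ((∑ᶠ v ∈ S, G.h v : ℕ) : ℤ) := Int.natCast_nonneg _
  omega

namespace Hom

variable {G H K : MGraph n}

lemma surjective (g : Hom G H) : Function.Surjective g.toFun := by
  intro y
  by_cases hy : H.IsVertex y
  · exact (g.fiber_connected y hy).1
  · exact (g.flag y hy).exists

lemma exists_vertex (g : Hom G H) {w : H.X} (hw : H.IsVertex w) :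
    ∃ v, G.IsVertex v ∧ g.toFun v = w := by
  obtain ⟨x, rfl⟩ := g.surjective w
  exact ⟨G.r x, G.isVertex_r x, by rw [g.map_r, hw]⟩

lemma sum_eq (g : Hom G H) :
    ∑ᶠ x ∈ Set.univ, G.chi x = ∑ᶠ y ∈ Set.univ, H.chi y :=
  finsum_preimage g.toFun G.chi H.chi Set.univ (fun y _ => g.finsum_fiber_chi y)

lemma genus_univ (g : Hom G H) : H.genus Set.univ = G.genus Set.univ := by
  have := g.sum_eq
  rw [finsum_chi_univ, finsum_chi_univ] at this
  linarith

lemma connected_image (g : Hom G H) {T : Set H.X} (hT : G.Connected (g.toFun ⁻¹' T)) : H.Connected T := by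
  constructor
  · obtain ⟨x, hx⟩ := hT.1
    exact ⟨_, hx⟩
  · intro v hv w hw hvv hwv
    obtain ⟨v, hv', rfl⟩ := g.exists_vertex hvv
    obtain ⟨w, hw', rfl⟩ := g.exists_vertex hwv
    refine Relation.ReflTransGen.lift g.toFun ?_ _ _ (hT.2 v hv w hw hv' hw')
    rintro a b ⟨f, hf, rfl, rfl⟩
    exact ⟨g.toFun f, hf, by rw [g.map_r], by rw [g.map_r, g.map_ι]⟩

/-- The preimage of the star of `w` is the disjoint union of the stars of the vertices above `w`.
Euler characteristics add up, and every summand is positive by stability of `G`. -/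
lemma stable (g : Hom G H) (hG : G.Stable) : H.Stable := by
  intro w hw
  rw [← H.finsum_chi_star hw,
    ← finsum_preimage g.toFun G.chi H.chi _ (fun y _ => g.finsum_fiber_chi y)]
  set U : Set G.X := {u | G.IsVertex u ∧ g.toFun u = w} with hU
  have hset : g.toFun ⁻¹' {y | H.r y = w} = G.r ⁻¹' U := by
    ext x
    simp only [Set.mem_preimage, Set.mem_ofPred_eq, hU, g.map_r]
    exact ⟨fun h => ⟨G.isVertex_r x, h⟩, fun h => h.2⟩
  rw [hset, finsum_preimage G.r G.chi (fun u => ∑ᶠ x ∈ G.r ⁻¹' {u}, G.chi x) U (fun y _ => rfl),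
    finsum_mem_eq_finite_toFinset_sum _ (Set.toFinite U)]
  obtain ⟨v, hv, hvw⟩ := g.exists_vertex hw
  apply Finset.sum_pos
  · intro u hu
    have hu' := ((Set.Finite.mem_toFinset _).1 hu).1
    have := hG u hu'
    rwa [← G.finsum_chi_star hu'] at this
  · exact ⟨v, (Set.Finite.mem_toFinset _).2 ⟨hv, hvw⟩⟩

/-- Each step of the chain runs from the root of a flag to the root of the opposite flag. If the
image of the flag is a vertex, it is fixed by the involution, so the two roots have the same image.
-/
lemma apply_eq_of_reach (k : Hom G K) {S : Set G.X} (hS : ∀ x ∈ S, K.IsVertex (k.toFun x))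
    {a b : G.X} (h : G.Reach S a b) : k.toFun a = k.toFun b := by
  induction h with
  | refl => rfl
  | tail _ hs ih =>
    obtain ⟨f, hf, rfl, rfl⟩ := hs
    rw [ih, k.map_r, k.map_r, k.map_ι, (hS f hf).ι_eq]

/-- A morphism that contracts the flags contracted by `g` is constant on the fibers of `g`. -/
lemma apply_eq_of_apply_eq (g : Hom G H) (k : Hom G K)
    (h : ∀ x, H.IsVertex (g.toFun x) → K.IsVertex (k.toFun x)) {x y : G.X}
    (hxy : g.toFun x = g.toFun y) : k.toFun x = k.toFun y := by
  by_cases hx : H.IsVertex (g.toFun x)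
  · have hr : ∀ z, H.IsVertex (g.toFun z) → k.toFun z = k.toFun (G.r z) := fun z hz => by
      rw [k.map_r]; exact (h z hz).symm
    rw [hr x hx, hr y (hxy ▸ hx)]
    have hreach := (g.fiber_connected _ hx).2 (G.r x) (by
      rw [Set.mem_preimage, Set.mem_singleton_iff, g.map_r, hx]) (G.r y) (by
      rw [Set.mem_preimage, Set.mem_singleton_iff, g.map_r, ← hxy, hx])
      (G.isVertex_r x) (G.isVertex_r y)
    refine k.apply_eq_of_reach (fun z hz => h z ?_) hreach
    rw [Set.mem_preimage, Set.mem_singleton_iff] at hz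
    rwa [hz]
  · rw [g.injOn hxy hx]

/-- A morphism that contracts the flags contracted by `g` factors through `g`. -/
lemma exists_factor (g : Hom G H) (k : Hom G K)
    (h : ∀ x, H.IsVertex (g.toFun x) → K.IsVertex (k.toFun x)) :
    ∃ l : Hom H K, ∀ x, l.toFun (g.toFun x) = k.toFun x := by
  -- The factor is `k` composed with a set-theoretic section of `g`; the choice does not matter
  -- because `k` is constant on the fibers of `g`.
  choose s hs using g.surjective
  have hl : ∀ x, k.toFun (s (g.toFun x)) = k.toFun x := fun x =>
    g.apply_eq_of_apply_eq k h (hs _)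
  -- A fiber of the factor pulls back under `g` to a fiber of `k`. Connectedness and Euler
  -- characteristic of the latter therefore descend.
  have hpre : ∀ w, g.toFun ⁻¹' ((fun y => k.toFun (s y)) ⁻¹' {w}) = k.toFun ⁻¹' {w} := by
    intro w; ext x
    simp only [Set.mem_preimage, hl]
  have hιl : ∀ y, k.toFun (s (H.ι y)) = K.ι (k.toFun (s y)) := fun y => by
    rw [← hs y, ← g.map_ι, hl, hl, k.map_ι]
  have hml : ∀ i, k.toFun (s (H.mark i)) = K.mark i := fun i => by
    rw [← g.map_mark, hl, k.map_mark]
  refine ⟨⟨fun y => k.toFun (s y), fun y => ?_, hιl, hml, fun f hf => ?_, fun w hw => ?_,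
    fun w hw => ?_⟩, hl⟩
  · rw [← hs y, ← g.map_r, hl, hl, k.map_r]
  · obtain ⟨x, hx, hx'⟩ := k.flag f hf
    refine ⟨g.toFun x, (hl x).trans hx, fun y hy => ?_⟩
    rw [← hs y, hx' _ hy]
  · apply g.connected_image
    rw [hpre]; exact k.fiber_connected w hw
  · apply genus_of_finsum (g := fun y => k.toFun (s y)) hw hιl
    · intro y hy
      obtain ⟨i, rfl⟩ := (H.mark_leg y).1 hy
      rw [hml]; exact K.isLeg_mark i
    · rw [← k.finsum_fiber_chi, ← hpre]
      exact (finsum_preimage g.toFun G.chi H.chi _ (fun y _ => g.finsum_fiber_chi y)).symm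

end Hom

/-! ### The contraction of a set of edges -/

section Contract

variable (G : MGraph n) (S : Set G.X)

/-- The generating relation of the contraction: a contracted flag is identified with its root and
with the opposite flag. -/
def ContractRel (x y : G.X) : Prop := x ∈ S ∧ (y = G.r x ∨ y = G.ι x)

variable {G S}

/-- The property of being equal to `x` is invariant under the generating relation when `x` is an
uncontracted flag, so it descends to the quotient: the class of `x` is a singleton. -/
lemma contract_mk_eq (hι : ∀ x ∈ S, G.ι x ∈ S) {x y : G.X}
    (hx : ¬ G.IsVertex x) (hxS : x ∉ S)
    (h : Quot.mk (G.ContractRel S) y = Quot.mk (G.ContractRel S) x) : y = x := by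
  have key : ∀ a b, G.ContractRel S a b → (a = x) = (b = x) := by
    rintro a b ⟨ha, rfl | rfl⟩
    · refine propext ⟨?_, ?_⟩
      · rintro rfl; exact absurd ha hxS
      · rintro rfl; exact absurd (G.isVertex_r a) hx
    · refine propext ⟨?_, ?_⟩
      · rintro rfl; exact absurd ha hxS
      · rintro rfl; exact absurd (hι a ha) hxS
  have h2 := congrArg (Quot.lift (fun y => y = x) key) h
  exact h2.mpr rfl

/-- A chain of identifications turns into a chain of contracted flags: a flag and its root have the
same root, and the roots of a flag and of its opposite are joined by the flag itself. The class is
carried along in the induction because the chain has to stay inside one fiber. -/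
lemma contract_reach (hι : ∀ x ∈ S, G.ι x ∈ S) {x y : G.X}
    (h : Quot.mk (G.ContractRel S) x = Quot.mk (G.ContractRel S) y) :
    G.Reach {z | z ∈ S ∧ Quot.mk (G.ContractRel S) z = Quot.mk (G.ContractRel S) x}
      (G.r x) (G.r y) := by
  have key : ∀ x y, Relation.EqvGen (G.ContractRel S) x y → ∀ q : Quot (G.ContractRel S),
      Quot.mk _ x = q → G.Reach {z | z ∈ S ∧ Quot.mk (G.ContractRel S) z = q}
        (G.r x) (G.r y) := by
    intro x y h
    induction h with
    | rel x y h =>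
      rintro q rfl
      obtain ⟨hx, rfl | rfl⟩ := h
      · rw [G.r_r]
      · exact Relation.ReflTransGen.single ⟨x, ⟨hx, rfl⟩, rfl, rfl⟩
    | refl x => exact fun _ _ => Relation.ReflTransGen.refl
    | symm x y h ih =>
      intro q hq
      refine Reach.symm ?_ (ih q ((Quot.eqvGen_sound h).trans hq))
      rintro z ⟨hz, hzq⟩
      have e : Quot.mk (G.ContractRel S) z = Quot.mk _ (G.ι z) := Quot.sound ⟨hz, Or.inr rfl⟩
      exact ⟨hι z hz, e ▸ hzq⟩
    | trans x y z h1 _ ih1 ih2 =>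
      intro q hq
      exact (ih1 q hq).trans (ih2 q ((Quot.eqvGen_sound h1).symm.trans hq))
  exact key x y (Quot.eqvGen_exact h) _ rfl

lemma contract_connected (hι : ∀ x ∈ S, G.ι x ∈ S) (q : Quot (G.ContractRel S)) :
    G.Connected (Quot.mk (G.ContractRel S) ⁻¹' {q}) := by
  refine ⟨Quot.exists_rep q, ?_⟩
  intro v hv w hw hvv hwv
  have hv' : Quot.mk (G.ContractRel S) v = q := hv
  have hw' : Quot.mk (G.ContractRel S) w = q := hw
  have := contract_reach hι (hv'.trans hw'.symm)
  rw [hvv, hwv, hv'] at this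
  refine Relation.ReflTransGen.mono ?_ _ _ this
  rintro a b ⟨f, hf, h⟩
  exact ⟨f, hf.2, h⟩

/-- The contraction of a set of finite edges. -/
def contract (G : MGraph n) (S : Set G.X) (hS : ∀ x ∈ S, G.ι x ≠ x) (hι : ∀ x ∈ S, G.ι x ∈ S) :
    MGraph n where
  X := Quot (G.ContractRel S)
  finite := Finite.of_surjective _ Quot.mk_surjective
  r := Quot.lift (fun x => Quot.mk _ (G.r x)) (by
    rintro x y ⟨hx, rfl | rfl⟩
    · exact (congrArg _ (G.r_r x)).symm
    · rw [← (Quot.sound ⟨hx, Or.inl rfl⟩ : Quot.mk (G.ContractRel S) x = _),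
        ← (Quot.sound ⟨hι x hx, Or.inl rfl⟩ : Quot.mk (G.ContractRel S) (G.ι x) = _)]
      exact Quot.sound ⟨hx, Or.inr rfl⟩)
  ι := Quot.lift (fun x => Quot.mk _ (G.ι x)) (by
    rintro x y ⟨hx, rfl | rfl⟩
    · rw [(G.isVertex_r x).ι_eq, ← (Quot.sound ⟨hx, Or.inr rfl⟩ :
        Quot.mk (G.ContractRel S) x = Quot.mk _ (G.ι x))]
      exact Quot.sound ⟨hx, Or.inl rfl⟩
    · exact Quot.sound ⟨hι x hx, Or.inr rfl⟩)
  r_r := by rintro ⟨x⟩; exact congrArg _ (G.r_r x)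
  ι_ι := by rintro ⟨x⟩; exact congrArg _ (G.ι_ι x)
  ι_vertex := by
    rintro ⟨x⟩ h
    by_cases hv : G.IsVertex x
    · exact congrArg _ hv.ι_eq
    · by_cases hx : x ∈ S
      · exact (Quot.sound ⟨hx, Or.inr rfl⟩ : Quot.mk (G.ContractRel S) x = _).symm
      · exact absurd (contract_mk_eq hι hv hx h) hv
  -- The condition says that `q` is fixed by the new root map. The weight of such a vertex has to be
  -- the genus of its fiber; truncation to natural numbers loses nothing, by
  -- `Connected.genus_nonneg`.
  h q := open Classical in
    if Quot.lift (fun x => Quot.mk (G.ContractRel S) (G.r x)) (by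
      rintro x y ⟨hx, rfl | rfl⟩
      · exact (congrArg _ (G.r_r x)).symm
      · rw [← (Quot.sound ⟨hx, Or.inl rfl⟩ : Quot.mk (G.ContractRel S) x = _),
          ← (Quot.sound ⟨hι x hx, Or.inl rfl⟩ : Quot.mk (G.ContractRel S) (G.ι x) = _)]
        exact Quot.sound ⟨hx, Or.inr rfl⟩) q = q
    then (G.genus (Quot.mk (G.ContractRel S) ⁻¹' {q})).toNat else 0
  h_flag q hq := if_neg hq
  mark i := Quot.mk _ (G.mark i)
  mark_inj i j hij := by
    refine G.mark_inj (contract_mk_eq hι (G.isLeg_mark j).1 ?_ hij)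
    exact fun h => hS _ h (G.isLeg_mark j).2
  mark_leg := by
    rintro ⟨x⟩
    constructor
    · rintro ⟨h1, h2⟩
      have hv : ¬ G.IsVertex x := fun hv => h1 (congrArg _ hv)
      have hx : x ∉ S := fun hx =>
        h1 (Quot.sound ⟨hx, Or.inl rfl⟩ : Quot.mk (G.ContractRel S) x = _).symm
      obtain ⟨i, hi⟩ := (G.mark_leg x).1 ⟨hv, contract_mk_eq hι hv hx h2⟩
      exact ⟨i, congrArg _ hi⟩
    · rintro ⟨i, hi⟩
      rw [← hi]
      have hl := G.isLeg_mark i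
      refine ⟨fun h => ?_, congrArg _ hl.2⟩
      exact hl.1 (contract_mk_eq hι hl.1 (fun h => hS _ h hl.2) h)

/-- The quotient morphism to the contraction. -/
def contractHom (G : MGraph n) (S : Set G.X) (hS : ∀ x ∈ S, G.ι x ≠ x)
    (hι : ∀ x ∈ S, G.ι x ∈ S) : Hom G (G.contract S hS hι) where
  toFun := Quot.mk _
  map_r _ := rfl
  map_ι _ := rfl
  map_mark _ := rfl
  flag := by
    rintro ⟨x⟩ h
    have hv : ¬ G.IsVertex x := fun hv => h (congrArg (Quot.mk (G.ContractRel S)) hv)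
    have hx : x ∉ S := fun hx =>
      h (Quot.sound ⟨hx, Or.inl rfl⟩ : Quot.mk (G.ContractRel S) x = _).symm
    exact ⟨x, rfl, fun y hy => contract_mk_eq hι hv hx hy⟩
  fiber_connected q _ := contract_connected hι q
  fiber_genus q hq := by
    refine (Int.toNat_of_nonneg ((contract_connected hι q).genus_nonneg ?_)).symm.trans ?_
    · intro x hx
      obtain rfl : Quot.mk _ x = q := hx
      exact hq
    · exact congrArg Nat.cast (if_pos hq).symm

end Contract

end MGraph

/-! ### Tropical curves form a category fibered in groupoids -/

namespace MTrop

variable {g n : ℕ}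

/-- A flag fixed by the involution is a leg and goes to a leg. So the flags that become vertices are
those of the finite edges whose length is pulled back to zero, and the contracted set can be read
off from the morphism of cones alone. -/
lemma Hom.isVertex_iff {A B : MTrop g n} (φ : A ⟶ B) (x : B.curve.X) :
    A.curve.IsVertex ((Hom.graph φ).toFun x) ↔
      B.curve.IsVertex x ∨ (B.curve.ι x ≠ x ∧ RPC.pull (Hom.base φ) (B.curve.d x) = 0) := by
  by_cases hx : B.curve.ι x = x
  · simp only [hx, ne_eq, not_true_eq_false, false_and, or_false]
    refine ⟨fun h => ?_, fun h => (Hom.graph φ).isVertex h⟩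
    by_contra hn
    exact ((Hom.graph φ).isLeg ⟨hn, hx⟩).1 h
  · rw [Hom.contracts_iff φ x hx]
    simp only [ne_eq, hx, not_false_eq_true, true_and]
    exact ⟨Or.inr, fun h => h.resolve_left (fun h' => hx h'.ι_eq)⟩

/-- Every morphism of tropical curves is cartesian over the category of cones. -/
lemma exists_lift {A B C : MTrop g n} (φ : A ⟶ C) (ψ : B ⟶ C) (f : A.cone ⟶ B.cone)
    (hf : f ≫ Hom.base ψ = Hom.base φ) :
    ∃ χ : A ⟶ B, Hom.base χ = f ∧ χ ≫ ψ = φ := by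
  have hp : ∀ u, RPC.pull (Hom.base φ) u = RPC.pull f (RPC.pull (Hom.base ψ) u) := fun u => by
    rw [← hf, RPC.pull_comp]
  -- A length that vanishes on the cone of `B` also vanishes on the cone of `A`, so the graph
  -- morphism of `φ` contracts everything contracted by that of `ψ`.
  obtain ⟨l, hl⟩ := (Hom.graph ψ).exists_factor (Hom.graph φ) (fun x => by
    rw [Hom.isVertex_iff, Hom.isVertex_iff, hp]
    rintro (h | ⟨h, h'⟩)
    · exact Or.inl h
    · exact Or.inr ⟨h, by rw [h', map_zero]⟩)
  refine ⟨Hom.mk' f l (fun y => ?_), rfl, hom_ext hf hl⟩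
  obtain ⟨x, rfl⟩ := (Hom.graph ψ).surjective y
  rw [hl, Hom.d_eq, hp, ← Hom.d_eq]

/-- Graph morphisms run opposite to morphisms of curves and are surjective, so composition with `ψ`
can be cancelled on graphs. -/
lemma lift_unique {A B C : MTrop g n} {χ χ' : A ⟶ B} (ψ : B ⟶ C)
    (hb : Hom.base χ = Hom.base χ') (h : χ ≫ ψ = χ' ≫ ψ) : χ = χ' := by
  refine hom_ext hb (fun y => ?_)
  obtain ⟨x, rfl⟩ := (Hom.graph ψ).surjective y
  rw [← comp_graph, ← comp_graph, h]

/-- The morphism obtained by lifting along a cartesian morphism. -/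
def lift {A B C : MTrop g n} (φ : A ⟶ C) (ψ : B ⟶ C) (f : A.cone ⟶ B.cone)
    (hf : f ≫ Hom.base ψ = Hom.base φ) : A ⟶ B := (exists_lift φ ψ f hf).choose

@[simp] lemma lift_base {A B C : MTrop g n} (φ : A ⟶ C) (ψ : B ⟶ C) (f : A.cone ⟶ B.cone)
    (hf : f ≫ Hom.base ψ = Hom.base φ) : Hom.base (lift φ ψ f hf) = f :=
  (exists_lift φ ψ f hf).choose_spec.1

@[simp] lemma lift_comp {A B C : MTrop g n} (φ : A ⟶ C) (ψ : B ⟶ C) (f : A.cone ⟶ B.cone)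
    (hf : f ≫ Hom.base ψ = Hom.base φ) : lift φ ψ f hf ≫ ψ = φ :=
  (exists_lift φ ψ f hf).choose_spec.2

/-- Lifting the identity of `B` along `φ`, over the inverse of the base, gives a one-sided inverse;
uniqueness of lifts makes it two-sided. -/
lemma isIso_of_isIso_base {A B : MTrop g n} (φ : A ⟶ B) (h : IsIso (Hom.base φ)) :
    IsIso φ := by
  have hb : inv (Hom.base φ) ≫ Hom.base φ = Hom.base (𝟙 B) := IsIso.inv_hom_id _
  have h2 : lift (𝟙 B) φ (inv (Hom.base φ)) hb ≫ φ = 𝟙 B := lift_comp _ _ _ _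
  refine ⟨lift (𝟙 B) φ (inv (Hom.base φ)) hb, ?_, h2⟩
  refine lift_unique φ ?_ ?_
  · rw [comp_base, lift_base]; exact IsIso.hom_inv_id _
  · rw [Category.assoc, h2, Category.comp_id, Category.id_comp]

/-- The edges whose length becomes zero. -/
def contracted (B : MTrop g n) {τ : RPC} (f : τ ⟶ B.cone) : Set B.curve.X :=
  {x | B.curve.ι x ≠ x ∧ RPC.pull f (B.curve.d x) = 0}

lemma contracted_ι (B : MTrop g n) {τ : RPC} (f : τ ⟶ B.cone) :
    ∀ x ∈ B.contracted f, B.curve.ι x ∈ B.contracted f := fun x hx =>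
  ⟨fun h => hx.1 (by rw [B.curve.ι_ι] at h; exact h.symm), by rw [B.curve.d_ι]; exact hx.2⟩

/-- The graph of the pullback of a tropical curve. -/
abbrev pullbackGraph (B : MTrop g n) {τ : RPC} (f : τ ⟶ B.cone) : MGraph n :=
  B.curve.toMGraph.contract (B.contracted f) (fun _ h => h.1) (B.contracted_ι f)

/-- The pullback of a tropical curve along a morphism of cones. -/
def pullback (B : MTrop g n) {τ : RPC} (f : τ ⟶ B.cone) : MTrop g n where
  cone := τ
  curve :=
    { B.pullbackGraph f with
      connected := (B.curve.toMGraph.contractHom (B.contracted f) (fun _ h => h.1)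
        (B.contracted_ι f)).connected_image B.curve.connected
      genus_eq := (B.curve.toMGraph.contractHom (B.contracted f) (fun _ h => h.1)
        (B.contracted_ι f)).genus_univ.trans B.curve.genus_eq
      d := Quot.lift (fun x => RPC.pull f (B.curve.d x)) (by
        rintro x y ⟨hx, rfl | rfl⟩
        · rw [hx.2, (B.curve.d_eq_zero _).2 (B.curve.toMGraph.isVertex_r x).ι_eq, map_zero]
        · rw [B.curve.d_ι])
      d_ι := by rintro ⟨x⟩; exact congrArg (RPC.pull f) (B.curve.d_ι x)
      d_eq_zero := by
        rintro ⟨x⟩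
        change RPC.pull f (B.curve.d x) = 0 ↔
          Quot.mk (B.curve.toMGraph.ContractRel (B.contracted f)) (B.curve.ι x) = Quot.mk _ x
        by_cases hx : B.curve.ι x = x
        · rw [hx, (B.curve.d_eq_zero x).2 hx, map_zero]; simp
        · constructor
          · exact fun h => (Quot.sound ⟨⟨hx, h⟩, Or.inr rfl⟩ :
              Quot.mk (B.curve.toMGraph.ContractRel (B.contracted f)) x = _).symm
          -- An edge that is not contracted consists of two singleton classes, so the involution of
          -- the contraction acquires no new fixed point on it.
          · intro h
            by_contra hn
            exact hx (MGraph.contract_mk_eq (S := B.contracted f) 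
              (B.contracted_ι f) (MGraph.not_isVertex_of_ι_ne hx) (fun h' => hn h'.2) h) }
  stable := (B.curve.toMGraph.contractHom (B.contracted f) (fun _ h => h.1)
        (B.contracted_ι f)).stable B.stable

/-- The canonical morphism from the pullback of a tropical curve. -/
def pullbackHom (B : MTrop g n) {τ : RPC} (f : τ ⟶ B.cone) : B.pullback f ⟶ B :=
  Hom.mk' (A := B.pullback f) f (B.curve.toMGraph.contractHom (B.contracted f) (fun _ h => h.1)
    (B.contracted_ι f)) (fun _ => rfl)

end MTrop

/-! ### Points of the cone over a graph -/

namespace MGraph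

variable {n : ℕ} {P Q : Type} [AddCommMonoid P] [AddCommMonoid Q]

/-- The normal form of a point: the pairs of a vertex or flag and a distance that describe the
point. -/
def PrePt.loc {G : MGraph n} {ℓ : G.X → P} : PrePt G ℓ → Set (G.X × P)
  | .vertex v _ => {(v, 0)}
  | .leg l _ t => open Classical in if t = 0 then {(G.r l, 0)} else {(l, t)}
  | .edge f _ t t' _ => open Classical in
      if t = 0 then {(G.r f, 0)} else if t' = 0 then {(G.r (G.ι f), 0)} else {(f, t), (G.ι f, t')}

/-- The normal form of a point of the glued space, if no finite edge has length zero. -/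
def Pt.loc {G : MGraph n} {ℓ : G.X → P} (hℓ : ∀ x, ℓ x = 0 → G.ι x = x) :
    Pt G ℓ → Set (G.X × P) :=
  Quot.lift PrePt.loc (by
    intro a b hab
    cases hab with
    | leg_zero l hl => simp [PrePt.loc]
    | edge_zero f hf t' h => simp [PrePt.loc]
    | edge_symm f hf hf' t t' h h' =>
      simp only [PrePt.loc, G.ι_ι]
      by_cases ht : t = 0
      · by_cases ht' : t' = 0
        -- Both coordinates zero would force an edge of length zero, whose ends are glued although
        -- their normal forms differ. This is where `hℓ` is needed.
        · exact absurd (hℓ f (by rw [← h, ht, ht', add_zero])) hf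
        · simp [ht, ht']
      · by_cases ht' : t' = 0
        · simp [ht, ht']
        · simp [ht, ht', Set.pair_comm])

/-- The normal form of the point `v` is the singleton of `(v, 0)`. Without edges of length zero,
distinct vertices are therefore not glued together. -/
lemma Pt.vertex_injective {G : MGraph n} {ℓ : G.X → P} (hℓ : ∀ x, ℓ x = 0 → G.ι x = x) {v w : G.X}
    {hv : G.IsVertex v} {hw : G.IsVertex w}
    (h : (Quot.mk _ (.vertex v hv) : Pt G ℓ) = Quot.mk _ (.vertex w hw)) : v = w := by
  have := congrArg (Pt.loc hℓ) h
  simpa [Pt.loc, PrePt.loc] using this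

lemma Pt.vertex_eq {G : MGraph n} {ℓ : G.X → P} {v w : G.X} {hv : G.IsVertex v} (h : v = w) :
    (Quot.mk _ (.vertex v hv) : Pt G ℓ) = Quot.mk _ (.vertex w (h ▸ hv)) := by
  subst h; rfl

/-- On an edge of length zero the point with both coordinates zero lies on both faces, so the two
end points of such an edge are glued. -/
lemma Pt.vertex_eq_of_reach {G : MGraph n} {ℓ : G.X → P} {S : Set G.X}
    (hS : ∀ x ∈ S, G.ι x ≠ x → ℓ x = 0 ∧ ℓ (G.ι x) = 0) {v w : G.X} (h : G.Reach S v w)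
    (hv : G.IsVertex v) (hw : G.IsVertex w) :
    (Quot.mk _ (.vertex v hv) : Pt G ℓ) = Quot.mk _ (.vertex w hw) := by
  induction h with
  | refl => rfl
  | tail _ hs ih =>
    obtain ⟨f, hf, rfl, rfl⟩ := hs
    refine (ih (G.isVertex_r f)).trans ?_
    by_cases hι : G.ι f = f
    · exact Pt.vertex_eq (by rw [hι])
    · obtain ⟨h1, h2⟩ := hS f hf hι
      have hι' : G.ι (G.ι f) ≠ G.ι f := fun h => hι (by rw [G.ι_ι] at h; exact h.symm)
      refine (Quot.sound (PtRel.edge_zero f hι 0 (by rw [h1, add_zero]))).symm.trans ?_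
      refine (Quot.sound (PtRel.edge_symm f hι hι' 0 0 _ (by rw [h2, add_zero]))).trans ?_
      exact Quot.sound (PtRel.edge_zero (G.ι f) hι' 0 _)

lemma Pt.map_vertex {G H : MGraph n} {ℓ : G.X → P} {m : H.X → Q} (g : Hom G H) (k : P →+ Q)
    (h : ∀ x, m (g.toFun x) = k (ℓ x)) (v : G.X) (hv : G.IsVertex v) :
    Pt.map g k h (Quot.mk _ (.vertex v hv)) = Quot.mk _ (.vertex (g.toFun v) (g.isVertex hv)) := rfl

lemma Pt.map_leg {G H : MGraph n} {ℓ : G.X → P} {m : H.X → Q} (g : Hom G H) (k : P →+ Q)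
    (h : ∀ x, m (g.toFun x) = k (ℓ x)) (l : G.X) (hl : G.IsLeg l) (t : P) :
    Pt.map g k h (Quot.mk _ (.leg l hl t)) = Quot.mk _ (.leg (g.toFun l) (g.isLeg hl) (k t)) := rfl

lemma Pt.map_edge_contracted {G H : MGraph n} {ℓ : G.X → P} {m : H.X → Q} (g : Hom G H)
    (k : P →+ Q) (h : ∀ x, m (g.toFun x) = k (ℓ x)) (f : G.X) (hf : G.ι f ≠ f) (t t' : P)
    (e : t + t' = ℓ f) (hv : H.IsVertex (g.toFun f)) :
    Pt.map g k h (Quot.mk _ (.edge f hf t t' e)) = Quot.mk _ (.vertex (g.toFun f) hv) :=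
  congrArg (Quot.mk _) (dif_pos hv)

lemma Hom.ι_ne {G H : MGraph n} (g : Hom G H) {f : G.X} (hf : G.ι f ≠ f)
    (hv : ¬ H.IsVertex (g.toFun f)) : H.ι (g.toFun f) ≠ g.toFun f := fun h' =>
  hf (g.injOn (by rw [g.map_ι, h']) (by rw [g.map_ι, h']; exact hv))

lemma Pt.map_edge {G H : MGraph n} {ℓ : G.X → P} {m : H.X → Q} (g : Hom G H)
    (k : P →+ Q) (h : ∀ x, m (g.toFun x) = k (ℓ x)) (f : G.X) (hf : G.ι f ≠ f) (t t' : P)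
    (e : t + t' = ℓ f) (hf' : H.ι (g.toFun f) ≠ g.toFun f)
    (e' : k t + k t' = m (g.toFun f)) :
    Pt.map g k h (Quot.mk _ (.edge f hf t t' e)) =
      Quot.mk _ (.edge (g.toFun f) hf' (k t) (k t') e') :=
  congrArg (Quot.mk _) (dif_neg (not_isVertex_of_ι_ne hf'))

/-- A morphism of graphs that contracts exactly the edges of length zero, and is compatible with
lengths, induces an injection on the points of the glued spaces. -/
lemma Pt.map_injective {G H : MGraph n} {ℓ : G.X → P} {m : H.X → Q} (g : Hom G H) (k : P →+ Q)
    (h : ∀ x, m (g.toFun x) = k (ℓ x)) (hP : ∀ a b : P, a + b = 0 → a = 0)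
    (hm : ∀ y, H.ι y = y → m y = 0) (k' : Q →+ P) (hk' : ∀ t, k' (k t) = t) :
    Function.Injective (Pt.map g k h) := by
  choose s hs using g.surjective
  -- A contracted flag has length zero in `H`, and the left inverse `k'` transports this back to
  -- `G`.
  have hvz : ∀ x, H.IsVertex (g.toFun x) → ℓ x = 0 := fun x hx => by
    rw [← hk' (ℓ x), ← h, hm _ hx.ι_eq, map_zero]
  have hve : ∀ v w (hv : G.IsVertex v) (hw : G.IsVertex w), g.toFun v = g.toFun w →
      (Quot.mk _ (.vertex v hv) : Pt G ℓ) = Quot.mk _ (.vertex w hw) := by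
    intro v w hv hw hvw
    refine Pt.vertex_eq_of_reach ?_ ((g.fiber_connected _ (g.isVertex hv)).2 v rfl w hvw.symm
      hv hw) hv hw
    intro x hx _
    have hx' : g.toFun x = g.toFun v := hx
    have hxv : H.IsVertex (g.toFun x) := hx' ▸ g.isVertex hv
    exact ⟨hvz x hxv, hvz _ (by rw [g.map_ι, hxv.ι_eq]; exact hxv)⟩
  have hsf : ∀ x, ¬ H.IsVertex (g.toFun x) → s (g.toFun x) = x := fun x hx =>
    (g.injOn (hs _).symm hx).symm
  have hse : ∀ f, H.ι f ≠ f → G.ι (s f) ≠ s f := fun f hf h' => hf (by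
    rw [← hs f, ← g.map_ι, h'])
  have hsl : ∀ l, H.IsLeg l → G.IsLeg (s l) := by
    intro l hl
    obtain ⟨i, rfl⟩ := (H.mark_leg l).1 hl
    rw [← g.map_mark, hsf _ (by rw [g.map_mark]; exact hl.1)]
    exact G.isLeg_mark i
  have hsm : ∀ y, ℓ (s y) = k' (m y) := fun y => by rw [← hk' (ℓ (s y)), ← h, hs]
  -- A left inverse is built from a section `s` of `g`. Above a vertex `s` may choose a flag, hence
  -- the passage to its root; all vertices of one fiber give the same point by `hve`, so the choice
  -- is harmless.
  let inv0 : PrePt H m → Pt G ℓ := fun p => match p with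
    | .vertex w _ => Quot.mk _ (.vertex (G.r (s w)) (G.isVertex_r _))
    | .leg l hl t => Quot.mk _ (.leg (s l) (hsl l hl) (k' t))
    | .edge f hf t t' e => Quot.mk _ (.edge (s f) (hse f hf) (k' t) (k' t') (by
        rw [hsm, ← e, map_add]))
  have hgr : ∀ y, g.toFun (G.r (s (H.r y))) = H.r y := fun y => by rw [g.map_r, hs, H.r_r]
  let inv : Pt H m → Pt G ℓ := Quot.lift inv0 (by
    intro a b hab
    cases hab with
    | leg_zero l hl =>
      simp only [inv0, map_zero]
      refine (Quot.sound (PtRel.leg_zero _ _)).trans (hve _ _ _ _ ?_)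
      rw [hgr, g.map_r, hs]
    | edge_zero f hf t' e =>
      simp only [inv0, map_zero]
      refine (Quot.sound (PtRel.edge_zero _ _ _ _)).trans (hve _ _ _ _ ?_)
      rw [hgr, g.map_r, hs]
    | edge_symm f hf hf' t t' e e' =>
      have h1 : s (H.ι f) = G.ι (s f) := by
        apply g.injOn
        · rw [hs, g.map_ι, hs]
        · rw [hs]; exact not_isVertex_of_ι_ne hf'
      simp only [inv0, h1]
      exact Quot.sound (PtRel.edge_symm _ _ _ _ _ _ _))
  have hinv : ∀ p, inv (Pt.map g k h p) = p := by
    intro p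
    induction p using Quot.ind with
    | mk p =>
      cases p with
      | vertex v hv =>
        refine hve _ _ _ _ ?_
        rw [g.map_r, hs, ← g.map_r, hv]
      | leg l hl t =>
        change Quot.mk _ (PrePt.leg (s (g.toFun l)) _ (k' (k t))) = _
        simp only [hk', hsf l (g.isLeg hl).1]
      | edge f hf t t' e =>
        by_cases hv : H.IsVertex (g.toFun f)
        · rw [Pt.map_edge_contracted _ _ _ _ _ _ _ _ hv]
          -- Sharpness: the coordinates of a point on a contracted edge add up to zero, so both
          -- vanish and the point was already a vertex.
          have h0 := hvz f hv
          have ht : t = 0 := hP t t' (e.trans h0)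
          have ht' : t' = 0 := hP t' t ((add_comm _ _).trans (e.trans h0))
          subst ht ht'
          refine Eq.trans ?_ (Quot.sound (PtRel.edge_zero f hf 0 e)).symm
          refine hve _ _ _ _ ?_
          rw [g.map_r, hs, ← g.map_r]
        · rw [Pt.map_edge _ _ _ _ _ _ _ _ (g.ι_ne hf hv) (by rw [h, ← e, map_add])]
          change Quot.mk _ (PrePt.edge (s (g.toFun f)) _ (k' (k t)) (k' (k t')) _) = _
          simp only [hk', hsf f hv]
  exact Function.LeftInverse.injective hinv

/-- Vertices lift to vertices, legs lift through their marks and edges through any flag above;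
coordinates lift because `k` is invertible. -/
lemma Pt.map_surjective {G H : MGraph n} {ℓ : G.X → P} {m : H.X → Q} (g : Hom G H) (k : P →+ Q)
    (h : ∀ x, m (g.toFun x) = k (ℓ x)) (k' : Q →+ P) (hk' : ∀ t, k' (k t) = t)
    (hk : ∀ t, k (k' t) = t) :
    Function.Surjective (Pt.map g k h) := by
  intro p
  induction p using Quot.ind with
  | mk p =>
    cases p with
    | vertex v hv =>
      obtain ⟨w, hw, rfl⟩ := g.exists_vertex hv
      exact ⟨Quot.mk _ (.vertex w hw), rfl⟩
    | leg l hl t =>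
      obtain ⟨i, rfl⟩ := (H.mark_leg l).1 hl
      refine ⟨Quot.mk _ (.leg (G.mark i) (G.isLeg_mark i) (k' t)), ?_⟩
      rw [Pt.map_leg]
      simp only [hk, g.map_mark]
      rfl
    | edge f hf t t' e =>
      obtain ⟨x, rfl⟩ := g.surjective f
      have hx : G.ι x ≠ x := fun h' => hf (by rw [← g.map_ι, h'])
      refine ⟨Quot.mk _ (.edge x hx (k' t) (k' t') ?_), ?_⟩
      · rw [← map_add, e, h, hk']
      · rw [Pt.map_edge _ _ _ _ _ _ _ _ hf (by rw [hk, hk, e])]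
        simp only [hk]
        rfl

/-! ### Morphisms without contracted edges -/

namespace Hom

variable {G H : MGraph n}

/-- The hypothesis says that the identity of `G` contracts every flag contracted by `g`, so the
identity is constant on the fibers of `g`. -/
lemma injective_of_reflects (g : Hom G H) (hg : ∀ x, H.IsVertex (g.toFun x) → G.IsVertex x) :
    Function.Injective g.toFun := by
  intro x y hxy
  exact g.apply_eq_of_apply_eq (Hom.id G) hg hxy

/-- The fibers are singletons, so the additivity of the Euler characteristic reads 2h-2 = 2h-2 at a
vertex. -/
lemma h_eq_of_reflects (g : Hom G H) (hg : ∀ x, H.IsVertex (g.toFun x) → G.IsVertex x) (x : G.X) :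
    H.h (g.toFun x) = G.h x := by
  by_cases hx : G.IsVertex x
  · have h1 := g.finsum_fiber_chi (g.toFun x)
    have : g.toFun ⁻¹' {g.toFun x} = {x} := by
      ext z
      exact ⟨fun hz => g.injective_of_reflects hg hz, fun hz => congrArg g.toFun hz⟩
    rw [this, finsum_mem_singleton, chi_vertex hx, chi_vertex (g.isVertex hx)] at h1
    omega
  · rw [G.h_flag x hx, H.h_flag _ (fun h => hx (hg x h))]

/-- A bijection that is compatible with the structure is a morphism. -/
def ofBijective (f : G.X → H.X) (hf : Function.Bijective f) (hr : ∀ x, f (G.r x) = H.r (f x))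
    (hι : ∀ x, f (G.ι x) = H.ι (f x)) (hm : ∀ i, f (G.mark i) = H.mark i)
    (hh : ∀ x, G.IsVertex x → H.h (f x) = G.h x) : Hom G H where
  toFun := f
  map_r := hr
  map_ι := hι
  map_mark := hm
  flag y _ := hf.existsUnique y
  fiber_connected w hw := by
    obtain ⟨v, rfl⟩ := hf.2 w
    have : f ⁻¹' {f v} = {v} := by
      ext z
      exact ⟨fun hz => hf.1 hz, fun hz => congrArg f hz⟩
    rw [this]
    refine ⟨⟨v, rfl⟩, ?_⟩
    rintro a rfl b rfl _ _
    exact Relation.ReflTransGen.refl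
  fiber_genus w hw := by
    apply genus_of_finsum hw hι
    · intro x hx
      obtain ⟨i, rfl⟩ := (G.mark_leg x).1 hx
      rw [hm]
      exact H.isLeg_mark i
    · obtain ⟨v, rfl⟩ := hf.2 w
      have : f ⁻¹' {f v} = {v} := by
        ext z
        exact ⟨fun hz => hf.1 hz, fun hz => congrArg f hz⟩
      have hv : G.IsVertex v := hf.1 ((hr v).trans hw)
      rw [this, finsum_mem_singleton, chi_vertex hv, chi_vertex hw, hh v hv]

end Hom

/-- If no edge is contracted and no coordinate becomes zero, a point keeps its type (vertex,
interior of a leg, interior of an edge), so the normal form is natural. This transports the position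
of the last leg along isomorphisms. -/
lemma Pt.mem_loc_map {G H : MGraph n} {ℓ : G.X → P} {m : H.X → Q} (g : Hom G H) (k : P →+ Q)
    (h : ∀ x, m (g.toFun x) = k (ℓ x)) (hg : ∀ x, H.IsVertex (g.toFun x) → G.IsVertex x)
    (hk : ∀ t, k t = 0 → t = 0) (hℓ : ∀ x, ℓ x = 0 → G.ι x = x) (hm : ∀ x, m x = 0 → H.ι x = x)
    (p : Pt G ℓ) {x : G.X} {t : P} (hx : (x, t) ∈ Pt.loc hℓ p) :
    (g.toFun x, k t) ∈ Pt.loc hm (Pt.map g k h p) := by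
  have hk0 : ∀ t, k t = 0 ↔ t = 0 := fun t => ⟨hk t, fun ht => by rw [ht, map_zero]⟩
  induction p using Quot.ind with
  | mk p =>
    cases p with
    | vertex v hv =>
      obtain ⟨rfl, rfl⟩ := Prod.mk.inj (show (x, t) = (v, 0) from hx)
      rw [map_zero]; exact rfl
    | leg l hl s =>
      rw [Pt.map_leg]
      by_cases hs : s = 0
      · have hs' := (hk0 s).2 hs
        simp only [Pt.loc, PrePt.loc, if_pos hs, if_pos hs'] at hx ⊢
        obtain ⟨rfl, rfl⟩ := Prod.mk.inj (show (x, t) = _ from hx)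
        rw [map_zero, g.map_r]; exact rfl
      · have hs' := mt (hk0 s).1 hs
        simp only [Pt.loc, PrePt.loc, if_neg hs, if_neg hs'] at hx ⊢
        obtain ⟨rfl, rfl⟩ := Prod.mk.inj (show (x, t) = _ from hx)
        exact rfl
    | edge f hf s s' e =>
      have hv : ¬ H.IsVertex (g.toFun f) := fun h' => hf (hg f h').ι_eq
      rw [Pt.map_edge _ _ _ _ _ _ _ _ (g.ι_ne hf hv) (by rw [h, ← e, map_add])]
      by_cases hs : s = 0
      · have hs' := (hk0 s).2 hs
        simp only [Pt.loc, PrePt.loc, if_pos hs, if_pos hs'] at hx ⊢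
        obtain ⟨rfl, rfl⟩ := Prod.mk.inj (show (x, t) = _ from hx)
        rw [map_zero, g.map_r]; exact rfl
      have hks := mt (hk0 s).1 hs
      by_cases hs' : s' = 0
      · have hks' := (hk0 s').2 hs'
        simp only [Pt.loc, PrePt.loc, if_neg hs, if_neg hks, if_pos hs', if_pos hks'] at hx ⊢
        obtain ⟨rfl, rfl⟩ := Prod.mk.inj (show (x, t) = _ from hx)
        rw [map_zero, g.map_r, g.map_ι]; exact rfl
      · have hks' := mt (hk0 s').1 hs'
        simp only [Pt.loc, PrePt.loc, if_neg hs, if_neg hks, if_neg hs', if_neg hks'] at hx ⊢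
        rcases hx with hx | hx
        · obtain ⟨rfl, rfl⟩ := Prod.mk.inj hx
          exact Or.inl rfl
        · obtain ⟨rfl, rfl⟩ := Prod.mk.inj (show (x, t) = _ from hx)
          rw [g.map_ι]; exact Or.inr rfl

end MGraph

/-! ### The weight of a section -/

lemma RPC.pull_inv_left {σ τ : RPC} (f : σ ⟶ τ) [IsIso f] (t : τ.S) :
    RPC.pull (inv f) (RPC.pull f t) = t := by
  rw [← RPC.pull_comp, IsIso.inv_hom_id, RPC.pull_id]

lemma RPC.pull_inv_right {σ τ : RPC} (f : σ ⟶ τ) [IsIso f] (t : σ.S) :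
    RPC.pull f (RPC.pull (inv f) t) = t := by
  rw [← RPC.pull_comp, IsIso.hom_inv_id, RPC.pull_id]

namespace TropicalCurve

variable {g n : ℕ} {σ : RPC}

/-- The section given by a point with coordinates in `S_σ`. -/
abbrev mkSection (Γ : TropicalCurve g n σ.S) (p : MGraph.Pt Γ.toMGraph Γ.d) : Γ.Section :=
  ⟨⟨𝟙 σ, p⟩, rfl⟩

lemma exists_mkSection {Γ : TropicalCurve g n σ.S} (s : Γ.Section) : ∃ p, s = Γ.mkSection p := by
  obtain ⟨⟨a, p⟩, h⟩ := s
  obtain rfl : a = 𝟙 σ := h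
  exact ⟨p, rfl⟩

lemma mkSection_injective (Γ : TropicalCurve g n σ.S) : Function.Injective Γ.mkSection := by
  intro p q h
  have := congrArg Subtype.val h
  exact eq_of_heq (Sigma.mk.inj this).2

/-- If the images agree, the universal point of the cone of `v` is a pullback of the section along
some endomorphism of `σ`. Comparing the projections to `σ` shows that this endomorphism is the
identity. -/
lemma range_eq_iff (Γ : TropicalCurve g n σ.S) (p : MGraph.Pt Γ.toMGraph Γ.d) (v : Γ.X)
    (hv : Γ.IsVertex v) :
    Subfunctor.range (yonedaEquiv.symm (Γ.mkSection p).1) = Subfunctor.range (Γ.coneVertex v hv) ↔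
      p = Quot.mk _ (.vertex v hv) := by
  constructor
  · intro h
    have h1 : (⟨𝟙 σ, Quot.mk _ (.vertex v hv)⟩ : Γ.Cone.obj (op σ)) ∈
        (Subfunctor.range (yonedaEquiv.symm (Γ.mkSection p).1)).obj (op σ) := by
      rw [h]
      exact ⟨𝟙 σ, rfl⟩
    obtain ⟨a, ha⟩ := h1
    have ha' : Γ.Cone.map (Quiver.Hom.op a) ⟨𝟙 σ, p⟩ = ⟨𝟙 σ, Quot.mk _ (.vertex v hv)⟩ := ha
    obtain rfl : a = 𝟙 σ := by
      have := congrArg Sigma.fst ha'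
      exact (Category.comp_id a).symm.trans this
    have hid : Γ.Cone.map (Quiver.Hom.op (𝟙 σ)) ⟨𝟙 σ, p⟩ = ⟨𝟙 σ, p⟩ :=
      Functor.map_id_apply Γ.Cone (op σ) _
    exact eq_of_heq (Sigma.mk.inj (hid.symm.trans ha')).2
  · rintro rfl
    congr 1

/-- The vertex chosen in the definition of the weight is unique by `Pt.vertex_injective`, because
over `σ` itself every finite edge has nonzero length. -/
lemma sectionWeight_vertex (Γ : TropicalCurve g n σ.S) (v : Γ.X) (hv : Γ.IsVertex v) :
    Γ.sectionWeight (Γ.mkSection (Quot.mk _ (.vertex v hv))) = Γ.h v := by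
  have hex : ∃ w, ∃ hw : Γ.IsVertex w,
      Subfunctor.range (yonedaEquiv.symm (Γ.mkSection (Quot.mk _ (.vertex v hv))).1) =
        Subfunctor.range (Γ.coneVertex w hw) := ⟨v, hv, (Γ.range_eq_iff _ v hv).2 rfl⟩
  rw [sectionWeight, dif_pos hex]
  obtain ⟨hw, h⟩ := hex.choose_spec
  have := MGraph.Pt.vertex_injective (fun x => (Γ.d_eq_zero x).1) ((Γ.range_eq_iff _ _ hw).1 h)
  rw [← this]

lemma sectionWeight_of_forall_ne (Γ : TropicalCurve g n σ.S) (p : MGraph.Pt Γ.toMGraph Γ.d)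
    (hp : ∀ v (hv : Γ.IsVertex v), p ≠ Quot.mk _ (.vertex v hv)) :
    Γ.sectionWeight (Γ.mkSection p) = 0 := by
  rw [sectionWeight, dif_neg]
  rintro ⟨v, hv, h⟩
  exact hp v hv ((Γ.range_eq_iff _ _ hv).1 h)

end TropicalCurve

namespace MTrop

variable {g n : ℕ}

/-- Pullback along an isomorphism of cones kills no length, so no edge is contracted. -/
lemma Hom.reflects {A B : MTrop g n} (φ : A ⟶ B) [IsIso (Hom.base φ)] (x : B.curve.X)
    (hx : A.curve.IsVertex ((Hom.graph φ).toFun x)) : B.curve.IsVertex x := by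
  refine ((Hom.isVertex_iff φ x).1 hx).resolve_right ?_
  rintro ⟨h1, h2⟩
  apply h1
  rw [← B.curve.d_eq_zero, ← RPC.pull_inv_left (Hom.base φ) (B.curve.d x), h2, map_zero]

/-- Vertices go to vertices of the same weight. Conversely, a section that becomes a vertex was one
already, because pullback of points is injective and every vertex lifts. -/
lemma sectionWeight_sectionPullback {A B : MTrop g n} (φ : A ⟶ B) [IsIso (Hom.base φ)]
    (s : B.curve.Section) :
    A.curve.sectionWeight (sectionPullback φ s) = B.curve.sectionWeight s := by
  obtain ⟨p, rfl⟩ := TropicalCurve.exists_mkSection s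
  refine (congrArg _ (sectionPullback_mk φ p)).trans ?_
  by_cases hp : ∃ v, ∃ hv : B.curve.IsVertex v, p = Quot.mk _ (.vertex v hv)
  · obtain ⟨v, hv, rfl⟩ := hp
    rw [TropicalCurve.sectionWeight_vertex, ← (Hom.graph φ).h_eq_of_reflects (Hom.reflects φ)]
    exact TropicalCurve.sectionWeight_vertex A.curve _ ((Hom.graph φ).isVertex hv)
  · push Not at hp
    rw [TropicalCurve.sectionWeight_of_forall_ne _ _ hp]
    refine TropicalCurve.sectionWeight_of_forall_ne A.curve _ (fun w hw h => ?_)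
    obtain ⟨v, hv, rfl⟩ := (Hom.graph φ).exists_vertex hw
    refine hp v hv (MGraph.Pt.map_injective (Hom.graph φ) (RPC.pull (Hom.base φ))
      (fun x => Hom.d_eq φ x) (fun _ _ => RPC.sharp) (fun y => (A.curve.d_eq_zero y).2)
      (RPC.pull (inv (Hom.base φ))) (RPC.pull_inv_left _) h)

end MTrop

/-! ### The position of the last leg -/

namespace MGraph

variable {n : ℕ} {P Q : Type} [AddCommMonoid P] [AddCommMonoid Q]

lemma Pt.edge_eq {n : ℕ} {G : MGraph n} {ℓ : G.X → P} {f f' : G.X} {hf : G.ι f ≠ f} {t t' s s' : P}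
    {h : t + t' = ℓ f} (h1 : f = f') (h2 : t = s) (h3 : t' = s') :
    (Quot.mk _ (.edge f hf t t' h) : Pt G ℓ) =
      Quot.mk _ (.edge f' (h1 ▸ hf) s s' (by rw [← h1, ← h2, ← h3, h])) := by
  subst h1 h2 h3; rfl

lemma Pt.leg_eq {n : ℕ} {G : MGraph n} {ℓ : G.X → P} {f f' : G.X} {hf : G.IsLeg f} {t t' : P}
    (h1 : f = f') (h2 : t = t') :
    (Quot.mk _ (.leg f hf t) : Pt G ℓ) = Quot.mk _ (.leg f' (h1 ▸ hf) t') := by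
  subst h1 h2; rfl

/-- A remaining vertex or flag, as an element of the graph without the last leg. -/
def Adm.of {G : MGraph (n + 1)} (hG : G.Adm) (x : G.X) (hx : x ∈ G.keep) : (G.forget hG).X :=
  ⟨x, hx⟩

/-- The inclusion of the vertices and flags of the graph without the last leg. -/
def Adm.val {G : MGraph (n + 1)} (hG : G.Adm) (x : (G.forget hG).X) : G.X := x.1

@[simp] lemma Adm.val_of {G : MGraph (n + 1)} (hG : G.Adm) (x : G.X) (hx : x ∈ G.keep) :
    hG.val (hG.of x hx) = x := rfl

lemma Adm.val_mem {G : MGraph (n + 1)} (hG : G.Adm) (x : (G.forget hG).X) : hG.val x ∈ G.keep :=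
  x.2

lemma Adm.val_injective {G : MGraph (n + 1)} (hG : G.Adm) : Function.Injective hG.val :=
  Subtype.val_injective

lemma Adm.val_r {G : MGraph (n + 1)} (hG : G.Adm) (x : (G.forget hG).X) :
    hG.val ((G.forget hG).r x) = G.r (hG.val x) := rfl

lemma Adm.val_ι {G : MGraph (n + 1)} (hG : G.Adm) (x : (G.forget hG).X) :
    hG.val ((G.forget hG).ι x) = G.forgetInv (hG.val x) := rfl

lemma Adm.val_mark {G : MGraph (n + 1)} (hG : G.Adm) (i : Fin n) :
    hG.val ((G.forget hG).mark i) = G.forgetMark i := rfl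

lemma Adm.isVertex_iff {G : MGraph (n + 1)} (hG : G.Adm) (x : (G.forget hG).X) :
    (G.forget hG).IsVertex x ↔ G.IsVertex (hG.val x) := forget_isVertex

lemma Hom.val_forget {G H : MGraph (n + 1)} (g : Hom G H) (hG : G.Adm) (hH : H.Adm)
    (x : (G.forget hG).X) : hH.val ((g.forget hG hH).toFun x) = g.forgetFun (hG.val x) := rfl

/-- The edge lengths of the graph without the last leg. -/
def Adm.len {G : MGraph (n + 1)} (hG : G.Adm) (d : G.X → P) (x : (G.forget hG).X) : P :=
  G.forgetLen d (hG.val x)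

lemma Hom.len_forget {G H : MGraph (n + 1)} (g : Hom G H) (hG : G.Adm) (hH : H.Adm) (k : P →+ Q)
    {d : G.X → P} {d' : H.X → Q} (hd' : ∀ x, d' x = 0 ↔ H.ι x = x)
    (hgd : ∀ x, d' (g.toFun x) = k (d x)) (x : (G.forget hG).X) :
    hH.len d' ((g.forget hG hH).toFun x) = k (hG.len d x) :=
  g.forgetLen hG hH k hd' hgd (hG.val_mem x)

/-- By connectedness some edge leaves the vertex that is deleted; the opposite flag of this edge
remains and is affected. -/
lemma Adm.exists_spec {G : MGraph (n + 1)} (hG : G.Adm) (hb : G.Bad) : ∃ x, G.Spec x := by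
  obtain ⟨y, h1, h2⟩ := hG.exists_out hb
  refine ⟨G.ι y, hG.spec ⟨fun h => h2 ?_, fun h => h2 h.2⟩ ⟨hb, by rw [G.ι_ι, h1]⟩⟩
  rw [h]; rfl

lemma Spec.partner_ne {G : MGraph (n + 1)} {x : G.X} (h : G.Spec x) : G.ι (G.partner x) ≠ x :=
  fun h' => h.pair.ne (by rw [← h', G.ι_ι, h'])

lemma Spec.ι_ne {G : MGraph (n + 1)} {x : G.X} (h : G.Spec x) : G.ι x ≠ x :=
  fun h' => h.r_ne (by rw [← h.r_ι, h'])

/-- Apart from the last leg, the only flags at the deleted vertex are the opposite of `x` and the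
partner of `x`. So there are at most two affected flags, and they are the two flags of one joined
edge when there are two. -/
lemma Spec.eq_or {G : MGraph (n + 1)} {x y : G.X} (hx : G.Spec x) (hy : G.Spec y) :
    y = x ∨ (G.ι (G.partner x) ≠ G.partner x ∧ y = G.ι (G.partner x)) := by
  rcases hx.pair.all _ hy.r_ι with h | h | h | h
  · exact absurd (IsVertex.of_ι (h ▸ G.isVertex_lastVertex)) hy.not_vertex
  · refine absurd ?_ hy.mem_keep.1
    rw [← G.ι_ι y, h, G.isLeg_lastLeg.2]
  · left
    rw [← G.ι_ι y, h, G.ι_ι]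
  · right
    have : y = G.ι (G.partner x) := by rw [← h, G.ι_ι]
    refine ⟨fun h' => hy.r_ne ?_, this⟩
    rw [this, h', hx.pair.r_z]

lemma Adm.forget_isLeg {G : MGraph (n + 1)} (hG : G.Adm) {x : G.X} (h : G.Spec x)
    (hl : G.ι (G.partner x) = G.partner x) : (G.forget hG).IsLeg (hG.of x h.mem_keep) :=
  ⟨fun h' => h.not_vertex (forget_isVertex.1 h'), hG.val_injective (h.forgetInv_leg hl)⟩

lemma Adm.forget_ι_ne {G : MGraph (n + 1)} (hG : G.Adm) {x : G.X} (h : G.Spec x)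
    (hl : G.ι (G.partner x) ≠ G.partner x) :
    (G.forget hG).ι (hG.of x h.mem_keep) ≠ (hG.of x h.mem_keep) := fun h' =>
  h.partner_ne ((Spec.forgetInv_edge hl).symm.trans (congrArg Subtype.val h'))

lemma Adm.len_edge {G : MGraph (n + 1)} (hG : G.Adm) {d : G.X → P} {x : G.X} (h : G.Spec x)
    (hl : G.ι (G.partner x) ≠ G.partner x) :
    d x + d (G.partner x) = hG.len d (hG.of x h.mem_keep) := (h.forgetLen_edge hl).symm

/-- The point on the edge or leg that contains an affected flag, at the position of the last
leg. -/
def Adm.specPt {G : MGraph (n + 1)} (hG : G.Adm) (d : G.X → P) {x : G.X} (h : G.Spec x) :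
    Pt (G.forget hG) (hG.len d) :=
  open Classical in
  if hl : G.ι (G.partner x) = G.partner x then
    Quot.mk _ (.leg (hG.of x h.mem_keep) (hG.forget_isLeg h hl) (d x))
  else Quot.mk _ (.edge (hG.of x h.mem_keep) (hG.forget_ι_ne h hl) (d x) (d (G.partner x))
    (hG.len_edge h hl))

lemma Adm.specPt_leg {G : MGraph (n + 1)} (hG : G.Adm) (d : G.X → P) {x : G.X} (h : G.Spec x)
    (hl : G.ι (G.partner x) = G.partner x) : hG.specPt d h =
    Quot.mk _ (.leg (hG.of x h.mem_keep) (hG.forget_isLeg h hl) (d x)) := dif_pos hl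

lemma Adm.specPt_edge {G : MGraph (n + 1)} (hG : G.Adm) (d : G.X → P) {x : G.X} (h : G.Spec x)
    (hl : G.ι (G.partner x) ≠ G.partner x) : hG.specPt d h =
    Quot.mk _ (.edge (hG.of x h.mem_keep) (hG.forget_ι_ne h hl) (d x) (d (G.partner x))
    (hG.len_edge h hl)) := dif_neg hl

/-- Two distinct affected flags are opposite flags of the joined edge, and they describe the same
point by the symmetry relation of the gluing. So the flag chosen in `lastPt` is immaterial. -/
lemma Adm.specPt_eq {G : MGraph (n + 1)} (hG : G.Adm) {d : G.X → P} (hd : ∀ x, d (G.ι x) = d x)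
    {x y : G.X} (hx : G.Spec x) (hy : G.Spec y) : hG.specPt d hx = hG.specPt d hy := by
  rcases hx.eq_or hy with rfl | ⟨hl, rfl⟩
  · rfl
  · obtain ⟨hs, hp⟩ := hG.spec_symm hx hl
    have hl' : G.ι (G.partner (G.ι (G.partner x))) ≠ G.partner (G.ι (G.partner x)) := by
      rw [hp, G.ι_ι]; exact hx.ι_ne.symm
    rw [hG.specPt_edge d hx hl, hG.specPt_edge d hy hl']
    have e1 : hG.of (G.ι (G.partner x)) hy.mem_keep =
        (G.forget hG).ι (hG.of x hx.mem_keep) := hG.val_injective (Spec.forgetInv_edge hl).symm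
    have e2 : d (G.partner (G.ι (G.partner x))) = d x := by rw [hp, hd]
    refine Eq.trans ?_ (Pt.edge_eq e1 (hd _) e2).symm
    exact Quot.sound (PtRel.edge_symm _ _ _ _ _ _ _)

/-- The position of the last leg on the cone over the graph without this leg. -/
def Adm.lastPt {G : MGraph (n + 1)} (hG : G.Adm) (d : G.X → P) :
    Pt (G.forget hG) (hG.len d) :=
  open Classical in
  if hb : G.Bad then hG.specPt d (hG.exists_spec hb).choose_spec
  else Quot.mk _ (.vertex (hG.of G.lastVertex (vertex_mem_keep G.isVertex_lastVertex (fun h => hb h.1)))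
    ((hG.isVertex_iff _).2 G.isVertex_lastVertex))

lemma Adm.lastPt_of_spec {G : MGraph (n + 1)} (hG : G.Adm) {d : G.X → P}
    (hd : ∀ x, d (G.ι x) = d x) {x : G.X} (hx : G.Spec x) : hG.lastPt d = hG.specPt d hx := by
  exact (dif_pos hx.bad).trans (hG.specPt_eq hd _ _)

lemma Adm.lastPt_of_not_bad {G : MGraph (n + 1)} (hG : G.Adm) (d : G.X → P) (hb : ¬ G.Bad) :
    hG.lastPt d = Quot.mk _ (.vertex (hG.of G.lastVertex (vertex_mem_keep G.isVertex_lastVertex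
      (fun h => hb h.1))) ((hG.isVertex_iff _).2 G.isVertex_lastVertex)) := dif_neg hb

/-- The position remembers what stabilization forgets: whether a vertex was deleted, the vertex
carrying the leg if not, and the affected flags with their individual lengths if so. -/
lemma Adm.mem_loc_lastPt {G : MGraph (n + 1)} (hG : G.Adm) {d : G.X → P}
    (hι : ∀ x, d (G.ι x) = d x) (hd : ∀ x, d x = 0 ↔ G.ι x = x)
    (hℓ : ∀ y : (G.forget hG).X, hG.len d y = 0 → (G.forget hG).ι y = y)
    (x : (G.forget hG).X) (t : P) :
    (x, t) ∈ Pt.loc hℓ (hG.lastPt d) ↔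
      (¬ G.Bad ∧ hG.val x = G.lastVertex ∧ t = 0) ∨ (G.Spec (hG.val x) ∧ t = d (hG.val x)) := by
  by_cases hb : G.Bad
  · simp only [hb, not_true_eq_false, false_and, false_or]
    have key : ∀ z (hz : G.Spec z), ((x, t) ∈ Pt.loc hℓ (hG.lastPt d) ↔
        (hG.val x = z ∧ t = d z) ∨ (G.ι (G.partner z) ≠ G.partner z ∧ hG.val x = G.ι (G.partner z) ∧
          t = d (G.partner z))) := by
      intro z hz
      -- An affected flag belongs to a finite edge of `G`, so its length is nonzero and the position
      -- is not on the corresponding face.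
      have h0 : d z ≠ 0 := fun h => hz.ι_ne ((hd z).1 h)
      rw [hG.lastPt_of_spec hι hz]
      by_cases hl : G.ι (G.partner z) = G.partner z
      · rw [hG.specPt_leg d hz hl]
        simp only [Pt.loc, PrePt.loc, if_neg h0, hl, ne_eq, not_true_eq_false, false_and, or_false]
        rw [Set.mem_singleton_iff, Prod.mk_inj, ← hG.val_injective.eq_iff, hG.val_of]
      · have h1 : d (G.partner z) ≠ 0 := fun h => hl ((hd _).1 h)
        rw [hG.specPt_edge d hz hl]
        simp only [Pt.loc, PrePt.loc, if_neg h0, if_neg h1, ne_eq, hl, not_false_eq_true, true_and]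
        rw [Set.mem_insert_iff, Set.mem_singleton_iff, Prod.mk_inj, Prod.mk_inj,
          ← hG.val_injective.eq_iff, ← hG.val_injective.eq_iff, hG.val_ι, hG.val_of,
          Spec.forgetInv_edge hl]
    constructor
    · obtain ⟨z, hz⟩ := hG.exists_spec hb
      rw [key z hz]
      rintro (⟨h1, h2⟩ | ⟨hl, h1, h2⟩)
      · rw [h1]; exact ⟨hz, h2⟩
      · rw [h1, h2, hι]; exact ⟨(hG.spec_symm hz hl).1, rfl⟩
    · rintro ⟨h1, h2⟩
      exact (key (hG.val x) h1).2 (Or.inl ⟨rfl, h2⟩)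
  · rw [hG.lastPt_of_not_bad d hb]
    have : ¬ G.Spec (hG.val x) := fun h => hb h.bad
    simp only [hb, this, not_false_eq_true, true_and, false_and, or_false]
    simp only [Pt.loc, PrePt.loc]
    rw [Set.mem_singleton_iff, Prod.mk_inj, ← hG.val_injective.eq_iff, hG.val_of]

/-- The position of the last leg commutes with contraction. If the target still needs stabilization,
affected flags go to affected flags. If it no longer does, one of the pieces at the deleted vertex
was contracted, its coordinate becomes zero, and the position moves to the vertex carrying the last
leg. -/
lemma Hom.map_lastPt {G H : MGraph (n + 1)} (g : Hom G H) (hG : G.Adm) (hH : H.Adm) (k : P →+ Q)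
    {d : G.X → P} {d' : H.X → Q} (hι : ∀ x, d (G.ι x) = d x) (hι' : ∀ x, d' (H.ι x) = d' x)
    (hd' : ∀ x, d' x = 0 ↔ H.ι x = x) (hgd : ∀ x, d' (g.toFun x) = k (d x)) :
    Pt.map (g.forget hG hH) k (g.len_forget hG hH k hd' hgd) (hG.lastPt d) =
      hH.lastPt d' := by
  by_cases hb : G.Bad
  · obtain ⟨x, hx⟩ := hG.exists_spec hb
    rw [hG.lastPt_of_spec hι hx]
    by_cases hb' : H.Bad
    · obtain ⟨h1, h2, h3⟩ := g.spec_bad hG hH hb' hx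
      have e1 : (g.forget hG hH).toFun (hG.of x hx.mem_keep) = hH.of (g.toFun x) h2.mem_keep :=
        hH.val_injective (g.forgetFun_flag h1)
      rw [hH.lastPt_of_spec hι' h2]
      by_cases hl : G.ι (G.partner x) = G.partner x
      · have hl' : H.ι (H.partner (g.toFun x)) = H.partner (g.toFun x) := by
          rw [h3, ← g.map_ι, hl]
        rw [hG.specPt_leg d hx hl, hH.specPt_leg d' h2 hl', Pt.map_leg]
        exact Pt.leg_eq e1 (hgd x).symm
      · have hl' : H.ι (H.partner (g.toFun x)) ≠ H.partner (g.toFun x) := by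
          rw [h3]
          exact g.ι_ne hl (h3 ▸ h2.pair.z_flag)
        rw [hG.specPt_edge d hx hl, hH.specPt_edge d' h2 hl', Pt.map_edge]
        · exact Pt.edge_eq e1 (hgd x).symm (by rw [h3, hgd])
        · rw [e1]; exact hH.forget_ι_ne h2 hl'
        · rw [← map_add, hG.len_edge hx hl]
          exact (g.len_forget hG hH k hd' hgd _).symm
    · rw [hH.lastPt_of_not_bad d' hb']
      -- If the piece of `x` is contracted, the first coordinate becomes zero and the point lies on
      -- the face at the last vertex. If the partner is contracted too, the whole joined edge goes
      -- to this vertex.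
      by_cases hv : H.IsVertex (g.toFun x)
      · have e1 : g.forgetFun x = g.toFun (G.partner x) := g.forgetFun_vertex hv
        have hk : k (d x) = 0 := by rw [← hgd, hd', hv.ι_eq]
        by_cases hl : G.ι (G.partner x) = G.partner x
        · rw [hG.specPt_leg d hx hl, Pt.map_leg]
          refine (Pt.leg_eq rfl hk).trans ((Quot.sound (PtRel.leg_zero _ _)).trans
            (Pt.vertex_eq (Subtype.ext ?_)))
          change H.r (g.forgetFun x) = H.lastVertex
          rw [e1, ← g.map_r, hx.pair.r_z, g.map_lastVertex]
        · rw [hG.specPt_edge d hx hl]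
          by_cases hz : H.IsVertex (g.toFun (G.partner x))
          · rw [Pt.map_edge_contracted _ _ _ _ _ _ _ _ (forget_isVertex.2 (by
              change H.IsVertex (g.forgetFun x); rw [e1]; exact hz))]
            refine Pt.vertex_eq (Subtype.ext ?_)
            exact e1.trans (g.eq_lastVertex hx.pair.r_z hz)
          · have hne : (H.forget hH).ι ((g.forget hG hH).toFun (hG.of x hx.mem_keep)) ≠
                (g.forget hG hH).toFun (hG.of x hx.mem_keep) := by
              refine (g.forget hG hH).ι_ne (hG.forget_ι_ne hx hl) (fun h => hz ?_)
              rw [← e1]; exact forget_isVertex.1 h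
            rw [Pt.map_edge _ _ _ _ _ _ _ _ hne (by
              rw [← map_add, hG.len_edge hx hl]
              exact (g.len_forget hG hH k hd' hgd _).symm)]
            refine (Pt.edge_eq rfl hk rfl).trans ((Quot.sound (PtRel.edge_zero _ _ _ _)).trans
              (Pt.vertex_eq (Subtype.ext ?_)))
            change H.r (g.forgetFun x) = H.lastVertex
            rw [e1, ← g.map_r, hx.pair.r_z, g.map_lastVertex]
      · have e1 : g.forgetFun x = g.toFun x := g.forgetFun_flag hv
        have hz := g.contracted_of_pair hG hb hb' hx.pair
          (fun h' => hv ((g.isVertex_map_ι x).1 h'))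
        have hl : G.ι (G.partner x) ≠ G.partner x := fun hl =>
          (g.isLeg ⟨hx.pair.z_flag, hl⟩).1 hz
        have hk : k (d (G.partner x)) = 0 := by rw [← hgd, hd', hz.ι_eq]
        have hne : (H.forget hH).ι ((g.forget hG hH).toFun (hG.of x hx.mem_keep)) ≠
            (g.forget hG hH).toFun (hG.of x hx.mem_keep) := by
          refine (g.forget hG hH).ι_ne (hG.forget_ι_ne hx hl) (fun h => hv ?_)
          rw [← e1]; exact forget_isVertex.1 h
        have hne' : (H.forget hH).ι ((H.forget hH).ι ((g.forget hG hH).toFun (hG.of x hx.mem_keep))) ≠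
            (H.forget hH).ι ((g.forget hG hH).toFun (hG.of x hx.mem_keep)) := by
          rw [(H.forget hH).ι_ι]; exact hne.symm
        have hlen : k (d x) + k (d (G.partner x)) =
            hH.len d' ((g.forget hG hH).toFun (hG.of x hx.mem_keep)) := by
          rw [← map_add, hG.len_edge hx hl]
          exact (g.len_forget hG hH k hd' hgd _).symm
        have hlen' : k (d (G.partner x)) + k (d x) =
            hH.len d' ((H.forget hH).ι ((g.forget hG hH).toFun (hG.of x hx.mem_keep))) := by
          rw [add_comm, hlen]
          exact (hH.forgetLen_ι hι' (hH.val_mem ((g.forget hG hH).toFun (hG.of x hx.mem_keep)))).symm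
        rw [hG.specPt_edge d hx hl, Pt.map_edge _ _ _ _ _ _ _ _ hne hlen]
        -- Now the piece of the partner is contracted and the second coordinate vanishes; reading
        -- the edge from its opposite flag reduces to the relation for a vanishing first coordinate.
        refine (Quot.sound (PtRel.edge_symm _ _ hne' _ _ _ hlen')).trans ?_
        refine (Pt.edge_eq rfl hk rfl).trans ((Quot.sound (PtRel.edge_zero _ _ _ _)).trans
              (Pt.vertex_eq (Subtype.ext ?_)))
        change H.r (H.forgetInv (g.forgetFun x)) = H.lastVertex
        rw [Hom.forgetInv_of_not_bad hb', e1, ← g.map_ι, ← g.map_r, hx.r_ι, g.map_lastVertex]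
  · have hb' : ¬ H.Bad := fun h => hb (g.bad_of_bad hG h).1
    rw [hG.lastPt_of_not_bad d hb, hH.lastPt_of_not_bad d' hb', Pt.map_vertex]
    refine Pt.vertex_eq (Subtype.ext ?_)
    change g.forgetFun G.lastVertex = _
    rw [g.forgetFun_of_not (fun h => hb h.1), g.map_lastVertex]
    rfl

end MGraph

/-! ### The functor that records the position of the last leg -/

namespace MTrop

variable {g n : ℕ}

/-- The section of the cone over the curve without the last leg, at the position of this leg. -/
def lastSection (hgn : 2 < 2 * g + n) (A : MTrop g (n + 1)) : (A.forgetObj hgn).curve.Section :=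
  (A.forgetObj hgn).curve.mkSection ((A.adm hgn).lastPt A.curve.d)

/-- The functor `M_{g,n+1} → X_{g,n}` that remembers the position of the last leg. -/
def toSections (hgn : 2 < 2 * g + n) : MTrop g (n + 1) ⥤ Pts (sections g n) where
  obj A := ⟨A.forgetObj hgn, A.lastSection hgn⟩
  map {A B} φ := ⟨(forgetFunctor hgn).map φ, by
    refine (sectionPullback_mk ((forgetFunctor hgn).map φ) _).trans ?_
    exact congrArg (A.forgetObj hgn).curve.mkSection
      ((Hom.graph φ).map_lastPt (B.adm hgn) (A.adm hgn) (RPC.pull (Hom.base φ)) B.curve.d_ι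
        A.curve.d_ι A.curve.d_eq_zero (Hom.d_eq φ))⟩
  map_id A := Pts.Hom.ext ((forgetFunctor hgn).map_id A)
  map_comp φ ψ := Pts.Hom.ext ((forgetFunctor hgn).map_comp φ ψ)

/-- A deleted vertex has weight 0, and then the section is in the interior of an edge or leg, where
its weight is 0 by convention. Otherwise the section is the vertex carrying the leg. -/
lemma sectionWeight_lastSection (hgn : 2 < 2 * g + n) (A : MTrop g (n + 1)) :
    (A.forgetObj hgn).curve.sectionWeight (A.lastSection hgn) = A.lastWeight := by
  by_cases hb : A.curve.toMGraph.Bad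
  · have h0 : A.lastWeight = 0 := by
      exact congrArg Nat.cast ((A.adm hgn).h_lastVertex hb).1
    rw [h0]
    refine TropicalCurve.sectionWeight_of_forall_ne _ _ (fun v hv h => ?_)
    obtain ⟨x, hx⟩ := (A.adm hgn).exists_spec hb
    have hℓ : ∀ y : (A.forgetObj hgn).curve.X, (A.forgetObj hgn).curve.d y = 0 →
      (A.forgetObj hgn).curve.ι y = y := fun y => ((A.forgetObj hgn).curve.d_eq_zero y).1
    have h1 := ((A.adm hgn).mem_loc_lastPt A.curve.d_ι A.curve.d_eq_zero hℓ ((A.adm hgn).of x hx.mem_keep)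
      (A.curve.d x)).2 (Or.inr ⟨hx, rfl⟩)
    have h2 := congrArg (MGraph.Pt.loc hℓ) h
    -- The normal form of a vertex contains only that vertex, while the normal form of the position
    -- contains the flag `x`.
    have h3 : ((A.adm hgn).of x hx.mem_keep, A.curve.d x) = (v, 0) := h2.subset h1
    obtain ⟨rfl, -⟩ := Prod.mk.inj h3
    exact hx.not_vertex (MGraph.forget_isVertex.1 hv)
  · have := (A.adm hgn).lastPt_of_not_bad A.curve.d hb
    rw [lastSection, this]
    exact TropicalCurve.sectionWeight_vertex _ _ _

end MTrop

/-! ### Isomorphisms of graphs with an additional leg -/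

namespace MGraph

variable {n : ℕ} {P Q : Type} [AddCommMonoid P] [AddCommMonoid Q]

lemma Spec.forgetInv_eq_iff {G : MGraph (n + 1)} {x : G.X} (h : G.Spec x) :
    G.forgetInv x = x ↔ G.ι (G.partner x) = G.partner x := by
  refine ⟨fun h' => ?_, fun hl => h.forgetInv_leg hl⟩
  by_contra hl
  rw [Spec.forgetInv_edge hl] at h'
  exact h.partner_ne h'

lemma lastVertex_ne_lastLeg (G : MGraph (n + 1)) : G.lastVertex ≠ G.lastLeg := fun h =>
  G.isLeg_lastLeg.1 (h ▸ G.isVertex_lastVertex)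

lemma lastLeg_notMem_keep (G : MGraph (n + 1)) : G.lastLeg ∉ G.keep := fun h => h.1 rfl

lemma notMem_keep_of_r {G : MGraph (n + 1)} (hb : G.Bad) {x : G.X} (h : G.r x = G.lastVertex) :
    x ∉ G.keep := fun hx => hx.2 ⟨hb, h⟩

/-- Provides a reference element for `ForgetEquiv.ext`. If nothing is deleted, any remaining element
serves, so the extension needs no case distinction in its arguments. -/
lemma Adm.exists_base {G : MGraph (n + 1)} (hG : G.Adm) :
    ∃ x : (G.forget hG).X, G.Bad → G.Spec (hG.val x) := by
  by_cases hb : G.Bad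
  · obtain ⟨x, hx⟩ := hG.exists_spec hb
    exact ⟨hG.of x hx.mem_keep, fun _ => hx⟩
  · exact ⟨hG.of _ (vertex_mem_keep G.isVertex_lastVertex (fun h => hb h.1)),
      fun h => absurd h hb⟩

/-- What is removed is the last leg and possibly a vertex with two flags; both flags can be
addressed through one affected flag, as its opposite and its partner. -/
lemma cases_of_notMem_keep {G : MGraph (n + 1)} {x₀ : G.X} (h₀ : G.Bad → G.Spec x₀) {x : G.X}
    (hx : x ∉ G.keep) : x = G.lastLeg ∨
      (G.Spec x₀ ∧ (x = G.lastVertex ∨ x = G.ι x₀ ∨ x = G.partner x₀)) := by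
  by_cases hl : x = G.lastLeg
  · exact Or.inl hl
  · right
    have hbr : G.Bad ∧ G.r x = G.lastVertex := by
      by_contra h
      exact hx ⟨hl, h⟩
    refine ⟨h₀ hbr.1, ?_⟩
    rcases (h₀ hbr.1).pair.all x hbr.2 with h | h | h | h
    · exact Or.inl h
    · exact absurd h hl
    · exact Or.inr (Or.inl h)
    · exact Or.inr (Or.inr h)

/-- A bijection between the graphs without the last leg that is compatible with the structure and
with the position of the last leg. -/
structure ForgetEquiv {G H : MGraph (n + 1)} (hG : G.Adm) (hH : H.Adm)
    (k : (G.forget hG).X → (H.forget hH).X) : Prop where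
  inj : Function.Injective k
  map_r : ∀ x, k ((G.forget hG).r x) = (H.forget hH).r (k x)
  map_ι : ∀ x, k ((G.forget hG).ι x) = (H.forget hH).ι (k x)
  map_mark : ∀ i, k ((G.forget hG).mark i) = (H.forget hH).mark i
  bad : G.Bad ↔ H.Bad
  vertex : ∀ x, hG.val x = G.lastVertex → hH.val (k x) = H.lastVertex
  spec : ∀ x, G.Spec (hG.val x) ↔ H.Spec (hH.val (k x))

namespace ForgetEquiv

variable {G H : MGraph (n + 1)} {hG : G.Adm} {hH : H.Adm} {k : (G.forget hG).X → (H.forget hH).X}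

/-- The extension of a map between the graphs without the last leg. The flag `x₀` is one of the
affected flags, if the graph without the last leg is unstable. -/
def ext (k : (G.forget hG).X → (H.forget hH).X) (x₀ : (G.forget hG).X) (x : G.X) : H.X :=
  open Classical in
  if hx : x ∈ G.keep then hH.val (k (hG.of x hx))
  else if x = G.lastLeg then H.lastLeg
  else if x = G.lastVertex then H.lastVertex
  else if x = G.ι (hG.val x₀) then H.ι (hH.val (k x₀))
  else H.partner (hH.val (k x₀))

lemma ext_keep {x₀ : (G.forget hG).X} {x : G.X} (hx : x ∈ G.keep) :
    ext k x₀ x = hH.val (k (hG.of x hx)) := dif_pos hx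

lemma ext_val {x₀ : (G.forget hG).X} (x : (G.forget hG).X) :
    ext k x₀ (hG.val x) = hH.val (k x) := ext_keep (hG.val_mem x)

lemma ext_lastLeg {x₀ : (G.forget hG).X} : ext k x₀ G.lastLeg = H.lastLeg :=
  (dif_neg G.lastLeg_notMem_keep).trans (if_pos rfl)

lemma ext_lastVertex (hk : ForgetEquiv hG hH k) {x₀ : (G.forget hG).X} :
    ext k x₀ G.lastVertex = H.lastVertex := by
  by_cases hx : G.lastVertex ∈ G.keep
  · rw [ext_keep hx]
    exact hk.vertex _ rfl
  · exact (dif_neg hx).trans ((if_neg G.lastVertex_ne_lastLeg).trans (if_pos rfl))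

lemma ext_ι {x₀ : (G.forget hG).X} (h₀ : G.Spec (hG.val x₀)) :
    ext k x₀ (G.ι (hG.val x₀)) = H.ι (hH.val (k x₀)) := by
  rw [ext, dif_neg (notMem_keep_of_r h₀.bad h₀.r_ι), if_neg h₀.pair.y_ne, if_neg, if_pos rfl]
  exact fun h => h₀.pair.y_flag (h ▸ G.isVertex_lastVertex)

lemma ext_partner {x₀ : (G.forget hG).X} (h₀ : G.Spec (hG.val x₀)) :
    ext k x₀ (G.partner (hG.val x₀)) = H.partner (hH.val (k x₀)) := by
  rw [ext, dif_neg (notMem_keep_of_r h₀.bad h₀.pair.r_z), if_neg h₀.pair.z_ne, if_neg,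
    if_neg h₀.pair.ne]
  exact fun h => h₀.pair.z_flag (h ▸ G.isVertex_lastVertex)

variable (hk : ForgetEquiv hG hH k)
include hk

/-- An affected flag is fixed by the new involution exactly if its partner is a leg, and `k`
commutes with the new involutions. -/
lemma leg_iff {x : (G.forget hG).X} (h : G.Spec (hG.val x)) :
    H.ι (H.partner (hH.val (k x))) = H.partner (hH.val (k x)) ↔
      G.ι (G.partner (hG.val x)) = G.partner (hG.val x) := by
  rw [← h.forgetInv_eq_iff, ← ((hk.spec x).1 h).forgetInv_eq_iff, ← hG.val_ι, ← hH.val_ι,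
    hG.val_injective.eq_iff, hH.val_injective.eq_iff, ← hk.map_ι, hk.inj.eq_iff]

lemma ι_partner {x y : (G.forget hG).X} (h : G.Spec (hG.val x))
    (hl : G.ι (G.partner (hG.val x)) ≠ G.partner (hG.val x))
    (hy : hG.val y = G.ι (G.partner (hG.val x))) :
    hH.val (k y) = H.ι (H.partner (hH.val (k x))) := by
  have : y = (G.forget hG).ι x := hG.val_injective (by
    rw [hy, hG.val_ι, Spec.forgetInv_edge hl])
  rw [this, hk.map_ι, hH.val_ι, Spec.forgetInv_edge (fun h' => hl ((hk.leg_iff h).1 h'))]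

lemma forgetInv_of_not_spec {x : (G.forget hG).X} (h : ¬ G.Spec (hG.val x)) :
    H.forgetInv (hH.val (k x)) = H.ι (hH.val (k x)) := by
  refine forgetInv_of_not (fun h' => h ((hk.spec x).2 ?_))
  exact hH.spec (hH.val_mem _) h'

lemma ext_r {x₀ : (G.forget hG).X} (h₀ : G.Bad → G.Spec (hG.val x₀)) (x : G.X) :
    ext k x₀ (G.r x) = H.r (ext k x₀ x) := by
  by_cases hx : x ∈ G.keep
  · obtain ⟨x, rfl⟩ : ∃ y, hG.val y = x := ⟨hG.of x hx, rfl⟩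
    rw [← hG.val_r, ext_val, ext_val, hk.map_r, hH.val_r]
  · rcases cases_of_notMem_keep h₀ hx with rfl | ⟨hs, rfl | rfl | rfl⟩
    · rw [ext_lastLeg]
      exact hk.ext_lastVertex
    · rw [hk.ext_lastVertex, show G.r G.lastVertex = G.lastVertex from G.isVertex_lastVertex,
        hk.ext_lastVertex]
      exact H.isVertex_lastVertex.symm
    · rw [ext_ι hs, hs.r_ι, hk.ext_lastVertex, ((hk.spec _).1 hs).r_ι]
    · rw [ext_partner hs, hs.pair.r_z, hk.ext_lastVertex, ((hk.spec _).1 hs).pair.r_z]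

lemma ext_map_ι {x₀ : (G.forget hG).X} (h₀ : G.Bad → G.Spec (hG.val x₀)) (x : G.X) :
    ext k x₀ (G.ι x) = H.ι (ext k x₀ x) := by
  by_cases hx : x ∈ G.keep
  · obtain ⟨x, rfl⟩ : ∃ y, hG.val y = x := ⟨hG.of x hx, rfl⟩
    rw [ext_val]
    by_cases hs : G.Spec (hG.val x)
    · have hs₀ := h₀ hs.bad
      -- An affected flag is either the reference flag or the opposite flag of the joined edge, and
      -- the extension was prescribed on the removed halves of both.
      rcases hs₀.eq_or hs with h | ⟨hl, h⟩
      · obtain rfl := hG.val_injective h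
        exact ext_ι hs
      · rw [h, G.ι_ι, ext_partner hs₀, hk.ι_partner hs₀ hl h, H.ι_ι]
    · have h1 : G.forgetInv (hG.val x) = G.ι (hG.val x) :=
        forgetInv_of_not (fun h => hs (hG.spec hx h))
      rw [← h1, ← hG.val_ι, ext_val, hk.map_ι, hH.val_ι, hk.forgetInv_of_not_spec hs]
  · rcases cases_of_notMem_keep h₀ hx with rfl | ⟨hs, rfl | rfl | rfl⟩
    · rw [G.isLeg_lastLeg.2, ext_lastLeg, H.isLeg_lastLeg.2]
    · rw [G.isVertex_lastVertex.ι_eq, hk.ext_lastVertex, H.isVertex_lastVertex.ι_eq]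
    · rw [ext_ι hs, G.ι_ι, H.ι_ι, ext_val]
    · rw [ext_partner hs]
      by_cases hl : G.ι (G.partner (hG.val x₀)) = G.partner (hG.val x₀)
      · rw [hl, ext_partner hs, (hk.leg_iff hs).2 hl]
      · obtain ⟨y, hy⟩ : ∃ y, hG.val y = G.ι (G.partner (hG.val x₀)) :=
          ⟨hG.of _ (hG.spec_symm hs hl).1.mem_keep, rfl⟩
        rw [← hy, ext_val, hk.ι_partner hs hl hy]

lemma ext_mark {x₀ : (G.forget hG).X} (h₀ : G.Bad → G.Spec (hG.val x₀)) (i : Fin (n + 1)) :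
    ext k x₀ (G.mark i) = H.mark i := by
  induction i using Fin.lastCases with
  | last => exact ext_lastLeg
  | cast i =>
    have hki : hH.val (k ((G.forget hG).mark i)) = H.forgetMark i := by
      rw [hk.map_mark, hH.val_mark]
    by_cases h : G.Bad ∧ G.r (G.mark i.castSucc) = G.lastVertex
    · obtain ⟨hs, hp⟩ := hG.spec_mark i h
      have hs₀ := h₀ hs.bad
      -- The partner of this affected flag is a leg, so it is the only affected flag and must be the
      -- reference flag.
      have hx : hG.val x₀ = G.forgetMark i := by
        rcases hs.eq_or hs₀ with h' | ⟨hl, h'⟩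
        · exact h'
        · rw [hp] at hl
          exact absurd (G.isLeg_mark _).2 hl
      obtain rfl : x₀ = (G.forget hG).mark i := hG.val_injective hx
      have hpx : G.partner (hG.val ((G.forget hG).mark i)) = G.mark i.castSucc := hp
      rw [← hpx, ext_partner hs₀, hki]
      have hsH := (hk.spec _).1 hs₀
      rw [hki] at hsH
      -- Otherwise the mark would not move under forgetting, and the affected flag would be a leg of
      -- `H`, fixed by the old involution.
      have h' : H.Bad ∧ H.r (H.mark i.castSucc) = H.lastVertex := by
        by_contra h'
        rw [forgetMark_of_not h'] at hsH
        exact hsH.ι_ne (H.isLeg_mark _).2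
      exact (hH.spec_mark i h').2
    · have hm := forgetMark_of_not h
      have hsG : ¬ G.Spec (hG.val ((G.forget hG).mark i)) := by
        rw [hG.val_mark, hm]
        exact fun h' => h'.ι_ne (G.isLeg_mark _).2
      rw [← hm, ← hG.val_mark, ext_val, hki]
      refine forgetMark_of_not (fun h' => hsG ((hk.spec _).2 ?_))
      rw [hki]
      exact (hH.spec_mark i h').1

lemma ext_h {x₀ : (G.forget hG).X} (h₀ : G.Bad → G.Spec (hG.val x₀))
    (hh : ∀ x, H.h (hH.val (k x)) = G.h (hG.val x)) {x : G.X} (hv : G.IsVertex x) :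
    H.h (ext k x₀ x) = G.h x := by
  by_cases hx : x ∈ G.keep
  · rw [ext_keep hx, hh, hG.val_of]
  · rcases cases_of_notMem_keep h₀ hx with rfl | ⟨hs, rfl | rfl | rfl⟩
    · exact absurd hv G.isLeg_lastLeg.1
    · rw [hk.ext_lastVertex, (hG.h_lastVertex hs.bad).1, (hH.h_lastVertex (hk.bad.1 hs.bad)).1]
    · exact absurd hv hs.pair.y_flag
    · exact absurd hv hs.pair.z_flag

/-- Unaffected flags keep their length when the leg is forgotten. For affected flags the stabilized
curve only knows the sum of the two pieces, or nothing at all on a leg; the individual lengths come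
from the section through `hκ`. -/
lemma ext_d {x₀ : (G.forget hG).X} (h₀ : G.Bad → G.Spec (hG.val x₀)) {d : G.X → P} {d' : H.X → Q}
    (hι : ∀ x, d (G.ι x) = d x) (hι' : ∀ x, d' (H.ι x) = d' x)
    (hd : ∀ x, G.ι x = x → d x = 0) (hd' : ∀ x, H.ι x = x → d' x = 0) (κ : P →+ Q)
    (hlen : ∀ x, hH.len d' (k x) = κ (hG.len d x))
    (hκ : ∀ x, G.Spec (hG.val x) → d' (hH.val (k x)) = κ (d (hG.val x))) (x : G.X) :
    d' (ext k x₀ x) = κ (d x) := by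
  by_cases hx : x ∈ G.keep
  · obtain ⟨x, rfl⟩ : ∃ y, hG.val y = x := ⟨hG.of x hx, rfl⟩
    rw [ext_val]
    by_cases hs : G.Spec (hG.val x)
    · exact hκ x hs
    · have h1 : hG.len d x = d (hG.val x) :=
        forgetLen_of_not (fun h => hs (hG.spec hx h))
      have h2 : hH.len d' (k x) = d' (hH.val (k x)) :=
        forgetLen_of_not (fun h => hs ((hk.spec x).2 (hH.spec (hH.val_mem _) h)))
      rw [← h1, ← h2, hlen]
  · rcases cases_of_notMem_keep h₀ hx with rfl | ⟨hs, rfl | rfl | rfl⟩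
    · rw [ext_lastLeg, hd _ G.isLeg_lastLeg.2, hd' _ H.isLeg_lastLeg.2, map_zero]
    · rw [hk.ext_lastVertex, hd _ G.isVertex_lastVertex.ι_eq, hd' _ H.isVertex_lastVertex.ι_eq,
        map_zero]
    · rw [ext_ι hs, hι, hι', hκ x₀ hs]
    · rw [ext_partner hs]
      by_cases hl : G.ι (G.partner (hG.val x₀)) = G.partner (hG.val x₀)
      · rw [hd _ hl, hd' _ ((hk.leg_iff hs).2 hl), map_zero]
      · obtain ⟨y, hy⟩ : ∃ y, hG.val y = G.ι (G.partner (hG.val x₀)) :=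
          ⟨hG.of _ (hG.spec_symm hs hl).1.mem_keep, rfl⟩
        rw [← hι, ← hy, ← hκ y (hy ▸ (hG.spec_symm hs hl).1), hk.ι_partner hs hl hy, hι']

lemma ext_leftInverse {k' : (H.forget hH).X → (G.forget hG).X} (hk' : ForgetEquiv hH hG k')
    (hkk : ∀ x, k' (k x) = x) {x₀ : (G.forget hG).X} (h₀ : G.Bad → G.Spec (hG.val x₀)) (x : G.X) :
    ext k' (k x₀) (ext k x₀ x) = x := by
  by_cases hx : x ∈ G.keep
  · obtain ⟨x, rfl⟩ : ∃ y, hG.val y = x := ⟨hG.of x hx, rfl⟩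
    rw [ext_val, ext_val, hkk]
  · rcases cases_of_notMem_keep h₀ hx with rfl | ⟨hs, rfl | rfl | rfl⟩
    · rw [ext_lastLeg, ext_lastLeg]
    · rw [hk.ext_lastVertex, hk'.ext_lastVertex]
    · rw [ext_ι hs, ext_ι ((hk.spec _).1 hs), hkk]
    · rw [ext_partner hs, ext_partner ((hk.spec _).1 hs), hkk]

end ForgetEquiv

/-- A morphism that contracts no edges is determined by the induced morphism of the graphs without
the last leg. -/
lemma Hom.eq_of_forgetFun_eq {G H : MGraph (n + 1)} (hG : G.Adm) (g g' : Hom G H)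
    (hg : ∀ x, H.IsVertex (g.toFun x) → G.IsVertex x)
    (hg' : ∀ x, H.IsVertex (g'.toFun x) → G.IsVertex x)
    (h : ∀ x ∈ G.keep, g.forgetFun x = g'.forgetFun x) (x : G.X) : g.toFun x = g'.toFun x := by
  have key : ∀ g : Hom G H, (∀ x, H.IsVertex (g.toFun x) → G.IsVertex x) → ∀ x ∈ G.keep,
      g.forgetFun x = g.toFun x := by
    intro g hg x hx
    by_cases hv : G.IsVertex x
    · exact g.forgetFun_of_not (nonspec_of_vertex hx hv)
    · exact g.forgetFun_flag (fun h => hv (hg x h))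
  have hkeep : ∀ x ∈ G.keep, g.toFun x = g'.toFun x := fun x hx => by
    rw [← key g hg x hx, ← key g' hg' x hx, h x hx]
  obtain ⟨x₀, h₀⟩ := hG.exists_base
  by_cases hx : x ∈ G.keep
  · exact hkeep x hx
  · rcases cases_of_notMem_keep h₀ hx with rfl | ⟨hs, rfl | rfl | rfl⟩
    · rw [g.map_lastLeg, g'.map_lastLeg]
    · rw [g.map_lastVertex, g'.map_lastVertex]
    · rw [g.map_ι, g'.map_ι, hkeep _ (hG.val_mem x₀)]
    -- The partner is pinned down by its mark if it is a leg, and by its remaining opposite flag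
    -- otherwise.
    · by_cases hl : G.ι (G.partner (hG.val x₀)) = G.partner (hG.val x₀)
      · obtain ⟨i, hi⟩ := exists_mark ⟨hs.pair.z_flag, hl⟩ hs.pair.z_ne
        rw [← hi, g.map_mark, g'.map_mark]
      · have hmem := (hG.spec_symm hs hl).1.mem_keep
        rw [← G.ι_ι (G.partner _), g.map_ι, g'.map_ι, hkeep _ hmem]

end MGraph

/-! ### Full faithfulness of the position functor -/

namespace MTrop

variable {g n : ℕ}

/-- A morphism of sections carries one position to the other, and over an isomorphism of cones
normal forms are natural. So the data read off in `mem_loc_lastPt` are carried along. -/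
lemma mem_loc_of_map (hgn : 2 < 2 * g + n) {A B : MTrop g (n + 1)}
    (θ : (toSections hgn).obj A ⟶ (toSections hgn).obj B) [IsIso (Hom.base (Pts.Hom.base θ))]
    (x : (B.forgetObj hgn).curve.X) (t : B.cone.S)
    (h : (¬ B.curve.toMGraph.Bad ∧ (B.adm hgn).val x = B.curve.toMGraph.lastVertex ∧ t = 0) ∨
      (B.curve.toMGraph.Spec ((B.adm hgn).val x) ∧ t = B.curve.d ((B.adm hgn).val x))) :
    (¬ A.curve.toMGraph.Bad ∧ (A.adm hgn).val ((Hom.graph (Pts.Hom.base θ)).toFun x) =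
        A.curve.toMGraph.lastVertex ∧ RPC.pull (Hom.base (Pts.Hom.base θ)) t = 0) ∨
      (A.curve.toMGraph.Spec ((A.adm hgn).val ((Hom.graph (Pts.Hom.base θ)).toFun x)) ∧
        RPC.pull (Hom.base (Pts.Hom.base θ)) t =
          A.curve.d ((A.adm hgn).val ((Hom.graph (Pts.Hom.base θ)).toFun x))) := by
  have hℓ : ∀ C : MTrop g (n + 1), ∀ y : (C.forgetObj hgn).curve.X,
      (C.forgetObj hgn).curve.d y = 0 → (C.forgetObj hgn).curve.ι y = y :=
    fun C y => ((C.forgetObj hgn).curve.d_eq_zero y).1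
  have hpt : MGraph.Pt.map (Hom.graph (Pts.Hom.base θ)) (RPC.pull (Hom.base (Pts.Hom.base θ)))
      (fun x => Hom.d_eq (Pts.Hom.base θ) x) ((B.adm hgn).lastPt B.curve.d) =
        (A.adm hgn).lastPt A.curve.d := by
    apply TropicalCurve.mkSection_injective (A.forgetObj hgn).curve
    refine (sectionPullback_mk (Pts.Hom.base θ) _).symm.trans ?_
    exact Pts.Hom.map_pt θ
  have h1 := ((B.adm hgn).mem_loc_lastPt B.curve.d_ι B.curve.d_eq_zero (hℓ B) x t).2 h
  have h2 := MGraph.Pt.mem_loc_map (Hom.graph (Pts.Hom.base θ))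
    (RPC.pull (Hom.base (Pts.Hom.base θ))) (fun x => Hom.d_eq (Pts.Hom.base θ) x)
    (Hom.reflects (Pts.Hom.base θ)) (fun t ht => by
      rw [← RPC.pull_inv_left (Hom.base (Pts.Hom.base θ)) t, ht, map_zero]) (hℓ B) (hℓ A) _ h1
  rw [hpt] at h2
  exact ((A.adm hgn).mem_loc_lastPt A.curve.d_ι A.curve.d_eq_zero (hℓ A) _ _).1 h2

/-- Of the two alternatives of `mem_loc_of_map`, the one about a vertex is impossible for a flag,
because nothing is contracted. -/
lemma spec_of_map (hgn : 2 < 2 * g + n) {A B : MTrop g (n + 1)}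
    (θ : (toSections hgn).obj A ⟶ (toSections hgn).obj B) [IsIso (Hom.base (Pts.Hom.base θ))]
    (x : (B.forgetObj hgn).curve.X) (h : B.curve.toMGraph.Spec ((B.adm hgn).val x)) :
    A.curve.toMGraph.Spec ((A.adm hgn).val ((Hom.graph (Pts.Hom.base θ)).toFun x)) ∧
      A.curve.d ((A.adm hgn).val ((Hom.graph (Pts.Hom.base θ)).toFun x)) =
        RPC.pull (Hom.base (Pts.Hom.base θ)) (B.curve.d ((B.adm hgn).val x)) := by
  rcases mem_loc_of_map hgn θ x _ (Or.inr ⟨h, rfl⟩) with ⟨-, h2, -⟩ | ⟨h1, h2⟩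
  · refine absurd (((B.adm hgn).isVertex_iff x).1 (Hom.reflects (Pts.Hom.base θ) x ?_))
      h.not_vertex
    refine ((A.adm hgn).isVertex_iff _).2 ?_
    rw [h2]
    exact A.curve.toMGraph.isVertex_lastVertex
  · exact ⟨h1, h2.symm⟩

lemma vertex_of_map (hgn : 2 < 2 * g + n) {A B : MTrop g (n + 1)}
    (θ : (toSections hgn).obj A ⟶ (toSections hgn).obj B) [IsIso (Hom.base (Pts.Hom.base θ))]
    (x : (B.forgetObj hgn).curve.X) (hb : ¬ B.curve.toMGraph.Bad)
    (h : (B.adm hgn).val x = B.curve.toMGraph.lastVertex) :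
    ¬ A.curve.toMGraph.Bad ∧ (A.adm hgn).val ((Hom.graph (Pts.Hom.base θ)).toFun x) =
        A.curve.toMGraph.lastVertex := by
  rcases mem_loc_of_map hgn θ x 0 (Or.inl ⟨hb, h, rfl⟩) with ⟨h1, h2, -⟩ | ⟨h1, h2⟩
  · exact ⟨h1, h2⟩
  · refine absurd ?_ h1.not_vertex
    refine ((A.adm hgn).isVertex_iff _).1 ((Hom.graph (Pts.Hom.base θ)).isVertex ?_)
    refine ((B.adm hgn).isVertex_iff _).2 ?_
    rw [h]
    exact B.curve.toMGraph.isVertex_lastVertex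

lemma bad_of_map (hgn : 2 < 2 * g + n) {A B : MTrop g (n + 1)}
    (θ : (toSections hgn).obj A ⟶ (toSections hgn).obj B) [IsIso (Hom.base (Pts.Hom.base θ))]
    (hb : B.curve.toMGraph.Bad) : A.curve.toMGraph.Bad := by
  obtain ⟨x, hx⟩ := (B.adm hgn).exists_spec hb
  exact (spec_of_map hgn θ ((B.adm hgn).of x hx.mem_keep) hx).1.bad

lemma sectionPullback_comp {A B C : MTrop g n} (χ : A ⟶ B) (ψ : B ⟶ C) (s : C.curve.Section) :
    sectionPullback (χ ≫ ψ) s = sectionPullback χ (sectionPullback ψ s) :=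
  ConcreteCategory.congr_hom ((sections g n).map_comp ψ.op χ.op) s

lemma sectionPullback_id {A : MTrop g n} (s : A.curve.Section) : sectionPullback (𝟙 A) s = s :=
  ConcreteCategory.congr_hom ((sections g n).map_id (op A)) s

lemma sectionPullback_pt {x y : Pts (sections g n)} (θ : x ⟶ y) :
    sectionPullback (Pts.Hom.base θ) y.pt = x.pt := Pts.Hom.map_pt θ

/-- Morphisms of sections over isomorphisms of cones are isomorphisms. -/
lemma isIso_pts {x y : Pts (sections g n)} (θ : x ⟶ y)
    (h : IsIso (Hom.base (Pts.Hom.base θ))) : IsIso θ := by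
  have := isIso_of_isIso_base (Pts.Hom.base θ) h
  refine ⟨⟨inv (Pts.Hom.base θ), ?_⟩, ?_, ?_⟩
  · change sectionPullback (inv (Pts.Hom.base θ)) x.pt = y.pt
    refine (congrArg (sectionPullback (inv (Pts.Hom.base θ))) (sectionPullback_pt θ)).symm.trans
      ((sectionPullback_comp _ (Pts.Hom.base θ) _).symm.trans ?_)
    exact (congrArg (fun m => sectionPullback m y.pt)
      (IsIso.inv_hom_id (Pts.Hom.base θ))).trans (sectionPullback_id _)
  · exact Pts.Hom.ext (IsIso.hom_inv_id (Pts.Hom.base θ))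
  · exact Pts.Hom.ext (IsIso.inv_hom_id (Pts.Hom.base θ))

/-- The forward implications hold for every morphism of sections over an isomorphism of cones; the
converses come from the inverse. The graph map runs from `B` to `A`. -/
lemma forgetEquiv_of_iso (hgn : 2 < 2 * g + n) {A B : MTrop g (n + 1)}
    (θ : (toSections hgn).obj A ≅ (toSections hgn).obj B)
    [IsIso (Hom.base (Pts.Hom.base θ.hom))] [IsIso (Hom.base (Pts.Hom.base θ.inv))] :
    MGraph.ForgetEquiv (B.adm hgn) (A.adm hgn) (Hom.graph (Pts.Hom.base θ.hom)).toFun := by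
  have hinv : ∀ x, (Hom.graph (Pts.Hom.base θ.inv)).toFun
      ((Hom.graph (Pts.Hom.base θ.hom)).toFun x) = x := fun x => by
    have h1 : Pts.Hom.base θ.inv ≫ Pts.Hom.base θ.hom = 𝟙 _ :=
      congrArg Pts.Hom.base θ.inv_hom_id
    rw [← comp_graph, h1]
    rfl
  refine ⟨Function.LeftInverse.injective hinv, (Hom.graph (Pts.Hom.base θ.hom)).map_r,
    (Hom.graph (Pts.Hom.base θ.hom)).map_ι, (Hom.graph (Pts.Hom.base θ.hom)).map_mark,
    ⟨bad_of_map hgn θ.hom, bad_of_map hgn θ.inv⟩, ?_, ?_⟩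
  · intro x hx
    refine (vertex_of_map hgn θ.hom x (fun hb => ((B.adm hgn).val_mem x).2 ⟨hb, ?_⟩) hx).2
    rw [hx]
    exact B.curve.toMGraph.isVertex_lastVertex
  · intro x
    refine ⟨fun h => (spec_of_map hgn θ.hom x h).1, fun h => ?_⟩
    have := (spec_of_map hgn θ.inv _ h).1
    exact hinv x ▸ this

/-- Every isomorphism between the positions of last legs is induced by a morphism. -/
lemma exists_preimage_of_isIso (hgn : 2 < 2 * g + n) {A B : MTrop g (n + 1)}
    (θ : (toSections hgn).obj A ⟶ (toSections hgn).obj B)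
    (hθ : IsIso (Hom.base (Pts.Hom.base θ))) : ∃ φ : A ⟶ B, (toSections hgn).map φ = θ := by
  have := isIso_pts θ hθ
  obtain ⟨θ, rfl⟩ : ∃ e : (toSections hgn).obj A ≅ (toSections hgn).obj B, e.hom = θ :=
    ⟨asIso θ, rfl⟩
  have hθ' : IsIso (Hom.base (Pts.Hom.base θ.inv)) :=
    ⟨Hom.base (Pts.Hom.base θ.hom),
      congrArg (fun f => Hom.base (Pts.Hom.base f)) θ.inv_hom_id,
      congrArg (fun f => Hom.base (Pts.Hom.base f)) θ.hom_inv_id⟩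
  have hk := forgetEquiv_of_iso hgn θ
  have hk' : MGraph.ForgetEquiv (A.adm hgn) (B.adm hgn) (Hom.graph (Pts.Hom.base θ.inv)).toFun :=
    @forgetEquiv_of_iso _ _ hgn _ _ θ.symm hθ' hθ
  have hinv : ∀ x, (Hom.graph (Pts.Hom.base θ.inv)).toFun
      ((Hom.graph (Pts.Hom.base θ.hom)).toFun x) = x := fun x => by
    have h1 : Pts.Hom.base θ.inv ≫ Pts.Hom.base θ.hom = 𝟙 _ :=
      congrArg Pts.Hom.base θ.inv_hom_id
    rw [← comp_graph, h1]
    rfl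
  have hinv' : ∀ x, (Hom.graph (Pts.Hom.base θ.hom)).toFun
      ((Hom.graph (Pts.Hom.base θ.inv)).toFun x) = x := fun x => by
    have h1 : Pts.Hom.base θ.hom ≫ Pts.Hom.base θ.inv = 𝟙 _ :=
      congrArg Pts.Hom.base θ.hom_inv_id
    rw [← comp_graph, h1]
    rfl
  obtain ⟨x₀, h₀⟩ := (B.adm hgn).exists_base
  have h₁ : A.curve.toMGraph.Bad → A.curve.toMGraph.Spec
      ((A.adm hgn).val ((Hom.graph (Pts.Hom.base θ.hom)).toFun x₀)) := fun hb =>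
    (hk.spec x₀).1 (h₀ (hk.bad.2 hb))
  have hbij : Function.Bijective (MGraph.ForgetEquiv.ext
      (hG := B.adm hgn) (hH := A.adm hgn) (Hom.graph (Pts.Hom.base θ.hom)).toFun x₀) := by
    refine ⟨Function.LeftInverse.injective (hk.ext_leftInverse hk' hinv h₀), fun y => ?_⟩
    have := hk'.ext_leftInverse hk hinv' h₁ y
    -- The inverse extension starts from the image of the reference element, so returning leads back
    -- to `x₀`.
    rw [show (Hom.graph (Pts.Hom.base θ.inv)).toFun
      ((Hom.graph (Pts.Hom.base θ.hom)).toFun x₀) = x₀ from hinv x₀] at this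
    exact ⟨_, this⟩
  let γ : MGraph.Hom B.curve.toMGraph A.curve.toMGraph := MGraph.Hom.ofBijective _ hbij
    (hk.ext_r h₀) (hk.ext_map_ι h₀) (hk.ext_mark h₀)
    (fun x hx => hk.ext_h h₀ ((Hom.graph (Pts.Hom.base θ.hom)).h_eq_of_reflects
      (Hom.reflects (Pts.Hom.base θ.hom))) hx)
  let f : A.cone ⟶ B.cone := (proj g n).map (Pts.Hom.base θ.hom)
  have hγd : ∀ x, A.curve.d (γ.toFun x) = RPC.pull f (B.curve.d x) :=
    hk.ext_d h₀ B.curve.d_ι A.curve.d_ι (fun x => (B.curve.d_eq_zero x).2)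
      (fun x => (A.curve.d_eq_zero x).2) (RPC.pull f)
      (Hom.d_eq (Pts.Hom.base θ.hom)) (fun x hx => (spec_of_map hgn θ.hom x hx).2)
  refine ⟨Hom.mk' (A := A) (B := B) f γ hγd, ?_⟩
  refine Pts.Hom.ext (hom_ext rfl (fun x => ?_))
  apply (A.adm hgn).val_injective
  refine ((γ.val_forget (B.adm hgn) (A.adm hgn) x)).trans ?_
  refine Eq.trans ?_ (MGraph.ForgetEquiv.ext_val (x₀ := x₀) x)
  by_cases hv : B.curve.toMGraph.IsVertex ((B.adm hgn).val x)
  · exact γ.forgetFun_of_not (MGraph.Hom.nonspec_of_vertex ((B.adm hgn).val_mem x) hv)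
  -- The extension is injective and commutes with roots, so it turns no flag into a vertex; hence
  -- the map induced on remaining elements is its plain restriction.
  · refine γ.forgetFun_flag (fun h => hv ?_)
    apply hbij.1
    exact (hk.ext_r h₀ _).trans h

/-- A morphism of sections is a vertical one followed by the image of the canonical morphism from
the pullback of `B`. Only the vertical part needs the extension of isomorphisms. -/
lemma toSections_full (hgn : 2 < 2 * g + n) : (toSections (g := g) hgn).Full where
  map_surjective {A B} θ := by
    let f : A.cone ⟶ B.cone := (proj g n).map (Pts.Hom.base θ)
    let c := B.pullbackHom f
    let χ := lift (Pts.Hom.base θ) ((forgetFunctor hgn).map c) (𝟙 _) (Category.id_comp f)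
    have hχ : χ ≫ (forgetFunctor hgn).map c = Pts.Hom.base θ := lift_comp _ _ _ _
    -- The position on the pullback of `B` is the pullback of the position on `B`, so the vertical
    -- part respects sections.
    have hpt : (sections g n).map χ.op ((toSections hgn).obj (B.pullback f)).pt =
        ((toSections hgn).obj A).pt := by
      refine (congrArg (sectionPullback χ) (sectionPullback_pt ((toSections hgn).map c)).symm).trans
        ((sectionPullback_comp χ ((forgetFunctor hgn).map c) _).symm.trans ?_)
      exact (congrArg (fun m => sectionPullback m _) hχ).trans (sectionPullback_pt θ)
    obtain ⟨φ, hφ⟩ := exists_preimage_of_isIso hgn (A := A) (B := B.pullback f) ⟨χ, hpt⟩ (by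
      rw [show Hom.base χ = 𝟙 _ from lift_base _ _ _ _]; exact IsIso.id _)
    refine ⟨φ ≫ c, ?_⟩
    rw [Functor.map_comp, hφ]
    exact Pts.Hom.ext hχ

/-- Both morphisms factor through the same pullback of `B`. Their vertical parts contract nothing
and agree after forgetting, which determines them on the removed elements as well. -/
lemma toSections_faithful (hgn : 2 < 2 * g + n) : (toSections (g := g) hgn).Faithful where
  map_injective {A B} φ φ' h := by
    have hF : (forgetFunctor hgn).map φ = (forgetFunctor hgn).map φ' := congrArg Pts.Hom.base h
    have hb : Hom.base φ = Hom.base φ' := congrArg (fun m => (proj g n).map m) hF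
    let c := B.pullbackHom (Hom.base φ)
    let χ := lift φ c (𝟙 _) (Category.id_comp _)
    let χ' := lift φ' c (𝟙 _) ((Category.id_comp _).trans hb)
    have hχ : χ ≫ c = φ := lift_comp _ _ _ _
    have hχ' : χ' ≫ c = φ' := lift_comp _ _ _ _
    have e : Hom.base χ = 𝟙 _ := lift_base _ _ _ _
    have e' : Hom.base χ' = 𝟙 _ := lift_base _ _ _ _
    have hχχ : (forgetFunctor hgn).map χ = (forgetFunctor hgn).map χ' := by
      refine lift_unique ((forgetFunctor hgn).map c) (e.trans e'.symm) ?_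
      rw [← Functor.map_comp, ← Functor.map_comp, hχ, hχ', hF]
    have i1 : IsIso (Hom.base χ) := by rw [e]; exact IsIso.id _
    have i2 : IsIso (Hom.base χ') := by rw [e']; exact IsIso.id _
    have : χ = χ' := by
      refine hom_ext (e.trans e'.symm) (fun x => ?_)
      refine MGraph.Hom.eq_of_forgetFun_eq ((B.pullback (Hom.base φ)).adm hgn) (Hom.graph χ)
        (Hom.graph χ') (Hom.reflects χ) (Hom.reflects χ') (fun x hx => ?_) x
      have := congrArg (fun m => (A.adm hgn).val ((Hom.graph m).toFun
        (((B.pullback (Hom.base φ)).adm hgn).of x hx))) hχχ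
      exact this
    rw [← hχ, ← hχ', this]

end MTrop

/-! ### Attaching a leg and subdividing an edge or a leg -/

namespace MGraph

variable {n : ℕ} {P : Type} [AddCommMonoid P]

lemma stable_iff_finsum (G : MGraph n) :
    G.Stable ↔ ∀ v, G.IsVertex v → 0 < ∑ᶠ x ∈ {x | G.r x = v}, G.chi x := by
  refine forall₂_congr (fun v hv => ?_)
  rw [G.finsum_chi_star hv]

/-- The graph with an additional leg at the vertex `v`. -/
abbrev attach (G : MGraph n) (v : G.X) (hv : G.IsVertex v) : MGraph (n + 1) where
  X := Option G.X
  r x := some (x.elim v G.r)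
  ι := Option.map G.ι
  r_r x := by
    cases x with
    | none => exact congrArg some hv
    | some x => exact congrArg some (G.r_r x)
  ι_ι x := by
    cases x with
    | none => rfl
    | some x => exact congrArg some (G.ι_ι x)
  ι_vertex x hx := by
    cases x with
    | none => rfl
    | some x => exact congrArg some (G.ι_vertex x (Option.some.inj hx))
  h x := x.elim 0 G.h
  h_flag x hx := by
    cases x with
    | none => rfl
    | some x => exact G.h_flag x (fun h => hx (congrArg some h))
  mark := Fin.lastCases (motive := fun _ => Option G.X) none (fun i => some (G.mark i))
  mark_inj i j hij := by
    induction i using Fin.lastCases with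
    | last =>
      induction j using Fin.lastCases with
      | last => rfl
      | cast j => simp at hij
    | cast i =>
      induction j using Fin.lastCases with
      | last => simp at hij
      | cast j =>
        simp only [Fin.lastCases_castSucc, Option.some.injEq] at hij
        rw [G.mark_inj hij]
  mark_leg x := by
    cases x with
    | none => exact ⟨fun _ => ⟨Fin.last n, by simp⟩, fun _ => ⟨Option.some_ne_none _, rfl⟩⟩
    | some x =>
      have h1 : (some (G.r x) ≠ some x ∧ some (G.ι x) = some x) ↔ ∃ i, G.mark i = x := by
        rw [← G.mark_leg x, Ne, Option.some_inj, Option.some_inj]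
      refine h1.trans ⟨?_, ?_⟩
      · rintro ⟨i, rfl⟩
        exact ⟨i.castSucc, by simp⟩
      · rintro ⟨i, hi⟩
        induction i using Fin.lastCases with
        | last => simp at hi
        | cast i => exact ⟨i, by simpa using hi⟩

section Attach

variable {G : MGraph n} {v : G.X} {hv : G.IsVertex v}

lemma attach_isVertex {x : G.X} : (G.attach v hv).IsVertex (some x) ↔ G.IsVertex x :=
  Option.some_inj

lemma attach_not_isVertex : ¬ (G.attach v hv).IsVertex none := Option.some_ne_none v

lemma attach_mark_castSucc (i : Fin n) :
    (G.attach v hv).mark i.castSucc = some (G.mark i) := by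
  simp [attach]

lemma attach_lastLeg : (G.attach v hv).lastLeg = none := by
  simp [attach, lastLeg]

lemma attach_lastVertex : (G.attach v hv).lastVertex = some v := by
  rw [lastVertex, attach_lastLeg]; rfl

lemma attach_chi (x : G.X) : (G.attach v hv).chi (some x) = G.chi x := by
  by_cases h : G.IsVertex x
  · rw [chi_vertex h, chi_vertex (attach_isVertex.2 h)]; rfl
  · rw [chi_flag h, chi_flag (fun h' => h (attach_isVertex.1 h'))]

lemma attach_chi_image (S : Set G.X) :
    ∑ᶠ x ∈ (some '' S : Set (G.attach v hv).X), (G.attach v hv).chi x = ∑ᶠ x ∈ S, G.chi x := by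
  refine (finsum_mem_image (Option.some_injective _).injOn).trans ?_
  exact finsum_mem_congr rfl (fun x _ => attach_chi x)

lemma attach_chi_insert (S : Set G.X) :
    ∑ᶠ x ∈ (insert none (some '' S) : Set (G.attach v hv).X), (G.attach v hv).chi x =
      1 + ∑ᶠ x ∈ S, G.chi x := by
  rw [finsum_mem_insert _ (by simp) (Set.toFinite _), attach_chi_image,
    chi_flag attach_not_isVertex]

lemma attach_star_self : ∑ᶠ x ∈ {x | (G.attach v hv).r x = some v}, (G.attach v hv).chi x =
    1 + ∑ᶠ x ∈ {x | G.r x = v}, G.chi x := by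
  rw [← attach_chi_insert]
  refine finsum_mem_congr (Set.ext (fun x => ?_)) (fun _ _ => rfl)
  cases x with
  | none => exact ⟨fun _ => Or.inl rfl, fun _ => rfl⟩
  | some x =>
    change some (G.r x) = some v ↔ _
    simp

lemma attach_star_ne {u : G.X} (hu : u ≠ v) :
    ∑ᶠ x ∈ {x | (G.attach v hv).r x = some u}, (G.attach v hv).chi x =
      ∑ᶠ x ∈ {x | G.r x = u}, G.chi x := by
  rw [← attach_chi_image (hv := hv)]
  refine finsum_mem_congr (Set.ext (fun x => ?_)) (fun _ _ => rfl)
  cases x with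
  | none =>
    change some v = some u ↔ _
    simp [hu.symm]
  | some x =>
    change some (G.r x) = some u ↔ _
    simp

lemma attach_sum : ∑ᶠ x ∈ Set.univ, (G.attach v hv).chi x = 1 + ∑ᶠ x ∈ Set.univ, G.chi x := by
  rw [← attach_chi_insert]
  refine finsum_mem_congr (Set.ext (fun x => ?_)) (fun _ _ => rfl)
  cases x <;> simp

lemma attach_genus : (G.attach v hv).genus Set.univ = G.genus Set.univ := by
  have h := attach_sum (G := G) (hv := hv)
  rw [finsum_chi_univ, finsum_chi_univ] at h
  push_cast at h
  omega

lemma attach_connected (h : G.Connected Set.univ) : (G.attach v hv).Connected Set.univ := by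
  refine ⟨⟨none, trivial⟩, ?_⟩
  intro a _ b _ ha hb
  cases a with
  | none => exact absurd ha attach_not_isVertex
  | some a =>
    cases b with
    | none => exact absurd hb attach_not_isVertex
    | some b =>
      have := h.2 a trivial b trivial (attach_isVertex.1 ha) (attach_isVertex.1 hb)
      refine Relation.ReflTransGen.lift (p := fun a b => ∃ f ∈ Set.univ,
        (G.attach v hv).r f = a ∧ (G.attach v hv).r ((G.attach v hv).ι f) = b) some ?_ _ _ this
      rintro x y ⟨f, -, h1, h2⟩
      exact ⟨some f, trivial, congrArg some h1, congrArg some h2⟩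

/-- The new leg adds 1 to the star of `v`, and the star of the last vertex is unstable without this
leg exactly if its sum is at most 1. -/
lemma attach_bad :
    (G.attach v hv).Bad ↔ ∑ᶠ x ∈ {x | G.r x = v}, G.chi x ≤ 0 := by
  rw [bad_iff, attach_lastVertex, attach_star_self]
  omega

/-- At `v` a star of sum zero is enough, since the leg adds 1. This is the situation at the middle
vertex of a subdivision. -/
lemma attach_stable (h : ∀ u, G.IsVertex u → u ≠ v → 0 < ∑ᶠ x ∈ {x | G.r x = u}, G.chi x)
    (h0 : 0 ≤ ∑ᶠ x ∈ {x | G.r x = v}, G.chi x) : (G.attach v hv).Stable := by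
  rw [stable_iff_finsum]
  intro u hu
  cases u with
  | none => exact absurd hu attach_not_isVertex
  | some u =>
    by_cases huv : u = v
    · subst huv
      rw [attach_star_self]
      omega
    · rw [attach_star_ne huv]
      exact h u (attach_isVertex.1 hu) huv

end Attach

/-- The vertices and flags after a subdivision: a vertex in the middle with two flags, one of them
opposite to the subdivided flag. -/
inductive Subdivided (X : Type) : Type
  | old (x : X) : Subdivided X
  | mid : Subdivided X
  | near : Subdivided X
  | far : Subdivided X

instance (X : Type) [Finite X] : Finite (Subdivided X) :=
  Finite.of_surjective (α := Option (Option (Option X)))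
    (fun x => x.elim .mid (fun x => x.elim .near (fun x => x.elim .far .old))) (fun x => by
      cases x with
      | old x => exact ⟨some (some (some x)), rfl⟩
      | mid => exact ⟨none, rfl⟩
      | near => exact ⟨some none, rfl⟩
      | far => exact ⟨some (some none), rfl⟩)

open Classical in
/-- The involution after a subdivision. -/
def subdivInv (G : MGraph n) (f : G.X) : Subdivided G.X → Subdivided G.X
  -- The order of the tests matters: if `f` is a leg, then `ι f = f`, only the first test applies,
  -- and `far` takes over as the leg.
  | .old x => if x = f then .near else if x = G.ι f then .far else .old (G.ι x)
  | .mid => .mid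
  | .near => .old f
  | .far => if G.ι f = f then .far else .old (G.ι f)

open Classical in
/-- The graph with an additional vertex of weight zero on the edge or leg of the flag `f`. -/
abbrev subdivide (G : MGraph n) (f : G.X) (hf : ¬ G.IsVertex f) : MGraph n where
  X := Subdivided G.X
  r
    | .old x => .old (G.r x)
    | _ => .mid
  ι := G.subdivInv f
  r_r x := by
    cases x with
    | old x => exact congrArg Subdivided.old (G.r_r x)
    | _ => rfl
  ι_ι x := by
    cases x with
    | old x =>
      by_cases h1 : x = f
      · simp [subdivInv, h1]
      · by_cases h2 : x = G.ι f
        · subst h2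
          simp [subdivInv, h1]
        · have h3 : G.ι x ≠ f := fun h => h2 (by rw [← h, G.ι_ι])
          have h4 : G.ι x ≠ G.ι f := fun h => h1 (by rw [← G.ι_ι x, h, G.ι_ι])
          simp [subdivInv, h1, h2, h3, h4, G.ι_ι]
    | mid => rfl
    | near => simp [subdivInv]
    | far =>
      by_cases h : G.ι f = f <;> simp [subdivInv, h]
  ι_vertex x hx := by
    cases x with
    | old x =>
      have hx' : G.IsVertex x := Subdivided.old.inj hx
      have h1 : x ≠ f := by rintro rfl; exact hf hx'
      have h2 : x ≠ G.ι f := by rintro rfl; exact hf (isVertex_ι.1 hx')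
      simp [subdivInv, h1, h2, hx'.ι_eq]
    | mid => rfl
    | near => cases hx
    | far => cases hx
  h
    | .old x => G.h x
    | _ => 0
  h_flag x hx := by
    cases x with
    | old x => exact G.h_flag x (fun h => hx (congrArg _ h))
    | _ => rfl
  -- A subdivided leg becomes a flag of a finite edge, so its mark moves to the outer flag.
  mark i := if G.mark i = f then .far else .old (G.mark i)
  mark_inj i j hij := by
    apply G.mark_inj
    by_cases hi : G.mark i = f <;> by_cases hj : G.mark j = f
    · rw [hi, hj]
    · simp [hi, hj] at hij
    · simp [hi, hj] at hij
    · simpa [hi, hj] using hij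
  mark_leg x := by
    have hfl : G.ι f = f ↔ ∃ i, G.mark i = f := by
      rw [← G.mark_leg f]
      exact ⟨fun h => ⟨hf, h⟩, fun h => h.2⟩
    cases x with
    | old x =>
      by_cases h1 : x = f
      · simp only [subdivInv, h1, if_true]
        refine ⟨fun h => (by simp at h), ?_⟩
        rintro ⟨i, hi⟩
        by_cases hi' : G.mark i = f <;> simp [hi'] at hi
      · by_cases h2 : x = G.ι f
        · simp only [subdivInv, h2]
          have h3 : G.ι f ≠ f := fun h => h1 (h2.trans h)
          refine ⟨fun h => (by simp [h3] at h), ?_⟩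
          rintro ⟨i, hi⟩
          by_cases hi' : G.mark i = f
          · simp [hi'] at hi
          · simp only [hi', if_false, Subdivided.old.injEq] at hi
            have := (G.isLeg_mark i).2
            rw [hi, G.ι_ι] at this
            exact absurd this.symm h3
        · simp only [subdivInv, h1, if_false, h2, ne_eq, Subdivided.old.injEq]
          refine (G.mark_leg x).trans (exists_congr (fun i => ?_))
          by_cases hi' : G.mark i = f
          · simp [hi', Ne.symm h1]
          · simp [hi']
    | mid =>
      refine ⟨fun h => absurd rfl h.1, ?_⟩
      rintro ⟨i, hi⟩
      by_cases hi' : G.mark i = f <;> simp [hi'] at hi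
    | near =>
      refine ⟨fun h => (by simp [subdivInv] at h), ?_⟩
      rintro ⟨i, hi⟩
      by_cases hi' : G.mark i = f <;> simp [hi'] at hi
    | far =>
      have : G.subdivInv f .far = .far ↔ G.ι f = f := by
        by_cases h : G.ι f = f <;> simp [subdivInv, h]
      rw [this, hfl]
      refine ⟨fun h => ?_, fun h => ⟨by simp, ?_⟩⟩
      · obtain ⟨i, hi⟩ := h.2
        exact ⟨i, if_pos hi⟩
      · obtain ⟨i, hi⟩ := h
        by_cases hi' : G.mark i = f
        · exact ⟨i, hi'⟩
        · simp [hi'] at hi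

section Subdivide

variable {G : MGraph n} {f : G.X} {hf : ¬ G.IsVertex f}

lemma subdivide_isVertex {x : G.X} : (G.subdivide f hf).IsVertex (.old x) ↔ G.IsVertex x :=
  ⟨Subdivided.old.inj, congrArg _⟩

lemma subdivide_isVertex_mid : (G.subdivide f hf).IsVertex .mid := rfl

lemma subdivide_not_isVertex_near : ¬ (G.subdivide f hf).IsVertex .near := nofun

lemma subdivide_not_isVertex_far : ¬ (G.subdivide f hf).IsVertex .far := nofun

lemma subdivide_ι_self : (G.subdivide f hf).ι (.old f) = .near := if_pos rfl

lemma subdivide_ι_ι (h : G.ι f ≠ f) : (G.subdivide f hf).ι (.old (G.ι f)) = .far :=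
  (if_neg h).trans (if_pos rfl)

lemma subdivide_ι_of_ne {x : G.X} (h1 : x ≠ f) (h2 : x ≠ G.ι f) :
    (G.subdivide f hf).ι (.old x) = .old (G.ι x) := (if_neg h1).trans (if_neg h2)

lemma subdivide_ι_far_leg (h : G.ι f = f) : (G.subdivide f hf).ι .far = .far := if_pos h

lemma subdivide_ι_far_edge (h : G.ι f ≠ f) :
    (G.subdivide f hf).ι .far = .old (G.ι f) := if_neg h

lemma subdivide_chi (x : G.X) : (G.subdivide f hf).chi (.old x) = G.chi x := by
  by_cases h : G.IsVertex x
  · rw [chi_vertex h, chi_vertex (subdivide_isVertex.2 h)]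
  · rw [chi_flag h, chi_flag (fun h' => h (subdivide_isVertex.1 h'))]

lemma subdivide_chi_image (S : Set G.X) :
    ∑ᶠ x ∈ (Subdivided.old '' S : Set (G.subdivide f hf).X), (G.subdivide f hf).chi x =
      ∑ᶠ x ∈ S, G.chi x := by
  refine (finsum_mem_image (fun x _ y _ h => Subdivided.old.inj h)).trans ?_
  exact finsum_mem_congr rfl (fun x _ => subdivide_chi x)

/-- A vertex of weight 0 with two flags contributes -2 + 1 + 1, which is why subdivision preserves
the genus. -/
lemma subdivide_chi_new :
    ∑ᶠ x ∈ ({.mid, .near, .far} : Set (G.subdivide f hf).X), (G.subdivide f hf).chi x = 0 := by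
  rw [finsum_mem_insert _ (by simp) (Set.toFinite _), finsum_mem_pair (fun h => by cases h),
    chi_vertex subdivide_isVertex_mid, chi_flag subdivide_not_isVertex_near,
    chi_flag subdivide_not_isVertex_far]
  rfl

lemma subdivide_star (u : G.X) :
    ∑ᶠ x ∈ {x | (G.subdivide f hf).r x = .old u}, (G.subdivide f hf).chi x =
      ∑ᶠ x ∈ {x | G.r x = u}, G.chi x := by
  rw [← subdivide_chi_image (hf := hf)]
  refine finsum_mem_congr (Set.ext (fun x => ?_)) (fun _ _ => rfl)
  cases x <;> simp [subdivide]

lemma subdivide_star_mid :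
    ∑ᶠ x ∈ {x | (G.subdivide f hf).r x = .mid}, (G.subdivide f hf).chi x = 0 := by
  refine Eq.trans (finsum_mem_congr (Set.ext (fun x => ?_)) (fun _ _ => rfl)) subdivide_chi_new
  cases x <;> simp [subdivide]

lemma subdivide_sum :
    ∑ᶠ x ∈ Set.univ, (G.subdivide f hf).chi x = ∑ᶠ x ∈ Set.univ, G.chi x := by
  have h : (Set.univ : Set (G.subdivide f hf).X) =
      Subdivided.old '' Set.univ ∪ {.mid, .near, .far} := by
    ext x
    cases x <;> simp
  rw [h, finsum_mem_union _ (Set.toFinite _) (Set.toFinite _), subdivide_chi_image,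
    subdivide_chi_new, add_zero]
  rw [Set.disjoint_left]
  rintro _ ⟨x, -, rfl⟩
  simp

lemma subdivide_genus : (G.subdivide f hf).genus Set.univ = G.genus Set.univ := by
  have h := subdivide_sum (G := G) (hf := hf)
  rw [finsum_chi_univ, finsum_chi_univ] at h
  omega

/-- Old chains survive, with a passage through the subdivided edge replaced by a detour through the
middle vertex; the middle vertex itself is reached from the root of `f`. -/
lemma subdivide_connected (h : G.Connected Set.univ) :
    (G.subdivide f hf).Connected Set.univ := by
  have hs : ∀ x : (G.subdivide f hf).X, ∀ a b, (G.subdivide f hf).r x = a →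
      (G.subdivide f hf).r ((G.subdivide f hf).ι x) = b →
      (G.subdivide f hf).Reach Set.univ a b := fun x a b h1 h2 =>
    Relation.ReflTransGen.single ⟨x, trivial, h1, h2⟩
  have hfm : (G.subdivide f hf).Reach Set.univ (.old (G.r f)) .mid :=
    hs (.old f) _ _ rfl (by rw [subdivide_ι_self])
  have hmid : ∀ y, G.ι f ≠ f → y = f ∨ y = G.ι f →
      (G.subdivide f hf).Reach Set.univ (.old (G.r y)) .mid := by
    rintro y hne (rfl | rfl)
    · exact hfm
    · exact hs (.old (G.ι f)) _ _ rfl (by rw [subdivide_ι_ι hne])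
  have hold : ∀ a b, G.Reach Set.univ a b →
      (G.subdivide f hf).Reach Set.univ (.old a) (.old b) := by
    intro a b hab
    induction hab with
    | refl => exact Relation.ReflTransGen.refl
    | tail _ hst ih =>
      obtain ⟨y, -, rfl, rfl⟩ := hst
      refine ih.trans ?_
      by_cases hy : G.ι y = y
      · rw [hy]
      · by_cases hyf : y = f ∨ y = G.ι f
        · have hne : G.ι f ≠ f := by
            rcases hyf with rfl | rfl
            · exact hy
            · rw [G.ι_ι] at hy; exact Ne.symm hy
          refine (hmid y hne hyf).trans (Reach.symm (S := Set.univ) (fun _ _ => trivial) (hmid _ hne ?_))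
          rcases hyf with rfl | rfl
          · exact Or.inr rfl
          · exact Or.inl (G.ι_ι f)
        · push Not at hyf
          exact hs (.old y) _ _ rfl (by rw [subdivide_ι_of_ne hyf.1 hyf.2])
  have hroot : ∀ a, (G.subdivide f hf).IsVertex a →
      (G.subdivide f hf).Reach Set.univ (.old (G.r f)) a := by
    intro a ha
    cases a with
    | old a =>
      exact hold _ _ (h.2 _ trivial _ trivial (G.isVertex_r f) (subdivide_isVertex.1 ha))
    | mid => exact hfm
    | near => exact absurd ha subdivide_not_isVertex_near
    | far => exact absurd ha subdivide_not_isVertex_far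
  refine ⟨⟨.mid, trivial⟩, fun a _ b _ ha hb => ?_⟩
  exact (Reach.symm (S := Set.univ) (fun _ _ => trivial) (hroot a ha)).trans (hroot b hb)

open Classical in
/-- The lengths after a subdivision. -/
def subdivLen (G : MGraph n) (f : G.X) (d : G.X → P) (t t' : P) : Subdivided G.X → P
  | .old x => if x = f then t else if x = G.ι f then t' else d x
  | .mid => 0
  | .near => t
  | .far => if G.ι f = f then 0 else t'

variable {d : G.X → P} {t t' : P}

lemma subdivLen_self : G.subdivLen f d t t' (.old f) = t := if_pos rfl

lemma subdivLen_ι (h : G.ι f ≠ f) : G.subdivLen f d t t' (.old (G.ι f)) = t' :=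
  (if_neg h).trans (if_pos rfl)

lemma subdivLen_of_ne {x : G.X} (h1 : x ≠ f) (h2 : x ≠ G.ι f) :
    G.subdivLen f d t t' (.old x) = d x := (if_neg h1).trans (if_neg h2)

lemma subdivLen_far_leg (h : G.ι f = f) : G.subdivLen f d t t' .far = 0 := if_pos h

lemma subdivLen_far_edge (h : G.ι f ≠ f) : G.subdivLen f d t t' .far = t' := if_neg h

end Subdivide

end MGraph

/-! ### Every section is the position of a last leg -/

namespace TropicalCurve

variable {g n : ℕ} {P : Type} [AddCommMonoid P]

/-- The tropical curve with an additional leg at the vertex `v`. -/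
abbrev attach (Γ : TropicalCurve g n P) (v : Γ.X) (hv : Γ.IsVertex v) :
    TropicalCurve g (n + 1) P where
  toMGraph := Γ.toMGraph.attach v hv
  connected := MGraph.attach_connected Γ.connected
  genus_eq := MGraph.attach_genus.trans Γ.genus_eq
  d x := x.elim 0 Γ.d
  d_ι x := by
    cases x with
    | none => rfl
    | some x => exact Γ.d_ι x
  d_eq_zero x := by
    cases x with
    | none => exact ⟨fun _ => rfl, fun _ => rfl⟩
    | some x => exact (Γ.d_eq_zero x).trans Option.some_inj.symm

/-- The subdivision of a tropical curve on the edge or leg of the flag `f`. -/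
abbrev subdivide (Γ : TropicalCurve g n P) (f : Γ.X) (hf : ¬ Γ.IsVertex f) (t t' : P) (ht : t ≠ 0)
    (ht' : Γ.ι f ≠ f → t' ≠ 0) : TropicalCurve g n P where
  toMGraph := Γ.toMGraph.subdivide f hf
  connected := MGraph.subdivide_connected Γ.connected
  genus_eq := MGraph.subdivide_genus.trans Γ.genus_eq
  d := Γ.toMGraph.subdivLen f Γ.d t t'
  d_ι x := by
    cases x with
    | old x =>
      by_cases h1 : x = f
      · rw [h1, MGraph.subdivide_ι_self, MGraph.subdivLen_self]
        rfl
      · by_cases h2 : x = Γ.ι f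
        · have h : Γ.ι f ≠ f := fun h => h1 (h2.trans h)
          rw [h2, MGraph.subdivide_ι_ι h, MGraph.subdivLen_ι h, MGraph.subdivLen_far_edge h]
        · have h3 : Γ.ι x ≠ f := fun h => h2 (by rw [← h, Γ.ι_ι])
          have h4 : Γ.ι x ≠ Γ.ι f := fun h => h1 (by rw [← Γ.ι_ι x, h, Γ.ι_ι])
          rw [MGraph.subdivide_ι_of_ne h1 h2, MGraph.subdivLen_of_ne h3 h4,
            MGraph.subdivLen_of_ne h1 h2, Γ.d_ι]
    | mid => rfl
    | near => exact MGraph.subdivLen_self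
    | far =>
      by_cases h : Γ.ι f = f
      · rw [MGraph.subdivide_ι_far_leg h]
      · rw [MGraph.subdivide_ι_far_edge h, MGraph.subdivLen_ι h, MGraph.subdivLen_far_edge h]
  d_eq_zero x := by
    cases x with
    | old x =>
      by_cases h1 : x = f
      · rw [h1, MGraph.subdivide_ι_self, MGraph.subdivLen_self]
        exact ⟨fun h => absurd h ht, nofun⟩
      · by_cases h2 : x = Γ.ι f
        · have h : Γ.ι f ≠ f := fun h => h1 (h2.trans h)
          rw [h2, MGraph.subdivide_ι_ι h, MGraph.subdivLen_ι h]
          exact ⟨fun h' => absurd h' (ht' h), nofun⟩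
        · rw [MGraph.subdivide_ι_of_ne h1 h2, MGraph.subdivLen_of_ne h1 h2, Γ.d_eq_zero]
          exact ⟨congrArg _, MGraph.Subdivided.old.inj⟩
    | mid => exact ⟨fun _ => rfl, fun _ => rfl⟩
    | near => exact ⟨fun h => absurd h ht, nofun⟩
    | far =>
      by_cases h : Γ.ι f = f
      · rw [MGraph.subdivide_ι_far_leg h, MGraph.subdivLen_far_leg h]
        simp
      · rw [MGraph.subdivide_ι_far_edge h, MGraph.subdivLen_far_edge h]
        exact ⟨fun h' => absurd h' (ht' h), nofun⟩

end TropicalCurve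

/-! ### Forgetting a newly attached leg recovers the original graph -/

namespace MGraph

variable {n : ℕ} {P : Type} [AddCommMonoid P]

section Attach

variable {G : MGraph n} {v : G.X} {hv : G.IsVertex v}

/-- A leg at a vertex of a stable graph can be removed again without deleting anything, since the
star of `v` is already positive without it. -/
lemma Stable.attach_not_bad (hst : G.Stable) : ¬ (G.attach v hv).Bad := fun h => by
  have := (stable_iff_finsum G).1 hst v hv
  have := attach_bad.1 h
  omega

lemma Stable.some_mem_keep (hst : G.Stable) (x : G.X) :
    (some x : (G.attach v hv).X) ∈ (G.attach v hv).keep := by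
  refine ⟨?_, fun h => hst.attach_not_bad h.1⟩
  rw [attach_lastLeg]
  exact Option.some_ne_none x

/-- Forgetting a leg that was attached at a vertex. -/
def attachHom (hst : G.Stable) (hG : (G.attach v hv).Adm) : Hom G ((G.attach v hv).forget hG) :=
  Hom.ofBijective (fun x => hG.of (some x) (hst.some_mem_keep x)) (by
    refine ⟨fun x y h => Option.some.inj (congrArg hG.val h), fun y => ?_⟩
    obtain ⟨y, hy, rfl⟩ : ∃ z hz, hG.of z hz = y := ⟨hG.val y, hG.val_mem y, rfl⟩
    cases y with
    | none => exact absurd attach_lastLeg.symm hy.1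
    | some y => exact ⟨y, rfl⟩)
  (fun _ => rfl)
  (fun x => hG.val_injective (by
    rw [hG.val_ι, hG.val_of, hG.val_of]
    exact (forgetInv_of_not (G := G.attach v hv) (x := some x)
      (fun h => hst.attach_not_bad h.1)).symm))
  (fun i => hG.val_injective (by
    rw [hG.val_mark, hG.val_of, forgetMark_of_not (fun h => hst.attach_not_bad h.1),
      attach_mark_castSucc]))
  (fun _ _ => rfl)

end Attach

section Subdivide

variable {G : MGraph n} {f : G.X} {hf : ¬ G.IsVertex f}

/-- The subdivided graph with an additional leg at the new vertex. -/
abbrev sprout (G : MGraph n) (f : G.X) (hf : ¬ G.IsVertex f) : MGraph (n + 1) :=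
  (G.subdivide f hf).attach .mid subdivide_isVertex_mid

/-- An old vertex or flag, as a vertex or flag of the subdivided graph with an additional leg. -/
abbrev sproutOld (G : MGraph n) (f : G.X) (hf : ¬ G.IsVertex f) (x : G.X) : (G.sprout f hf).X :=
  some (Subdivided.old x)

/-- Old stars do not change. The middle vertex has weight 0 and two flags, and the new leg makes its
star positive. -/
lemma sprout_stable (hst : G.Stable) : (G.sprout f hf).Stable := by
  refine attach_stable (fun u hu hne => ?_) subdivide_star_mid.ge
  cases u with
  | old u =>
    rw [subdivide_star]
    exact (stable_iff_finsum G).1 hst u (subdivide_isVertex.1 hu)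
  | mid => exact absurd rfl hne
  | near => exact absurd hu subdivide_not_isVertex_near
  | far => exact absurd hu subdivide_not_isVertex_far

lemma sprout_bad : (G.sprout f hf).Bad := attach_bad.2 subdivide_star_mid.le

lemma sproutOld_mem_keep (x : G.X) : G.sproutOld f hf x ∈ (G.sprout f hf).keep := by
  refine ⟨?_, fun h => ?_⟩
  · rw [attach_lastLeg]
    exact Option.some_ne_none _
  · have h2 := h.2
    rw [attach_lastVertex] at h2
    cases h2

lemma spec_sproutOld (hG : (G.sprout f hf).Adm) : (G.sprout f hf).Spec (G.sproutOld f hf f) := by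
  refine hG.spec (sproutOld_mem_keep f) ⟨sprout_bad, ?_⟩
  rw [attach_lastVertex]
  change some ((G.subdivide f hf).r ((G.subdivide f hf).ι (.old f))) = some .mid
  rw [subdivide_ι_self]

/-- By elimination: the partner is a flag at the middle vertex different from the new leg and from
`near`, and only `far` is left. -/
lemma partner_sproutOld (hG : (G.sprout f hf).Adm) :
    (G.sprout f hf).partner (G.sproutOld f hf f) = some .far := by
  have hs := spec_sproutOld hG
  have h1 := hs.pair.r_z
  have h2 := hs.pair.z_flag
  have h3 := hs.pair.z_ne
  have h4 := hs.pair.ne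
  rw [attach_lastVertex] at h1
  rw [attach_lastLeg] at h3
  have e : (G.sprout f hf).ι (G.sproutOld f hf f) = some .near := congrArg some subdivide_ι_self
  rw [e] at h4
  generalize (G.sprout f hf).partner (G.sproutOld f hf f) = z at h1 h2 h3 h4
  cases z with
  | none => exact absurd rfl h3
  | some z =>
    cases z with
    | old z => cases h1
    | mid => exact absurd rfl h2
    | near => exact absurd rfl h4
    | far => rfl

lemma ι_partner_eq_iff (hG : (G.sprout f hf).Adm) :
    (G.sprout f hf).ι ((G.sprout f hf).partner (G.sproutOld f hf f)) =
      (G.sprout f hf).partner (G.sproutOld f hf f) ↔ G.ι f = f := by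
  rw [partner_sproutOld hG]
  change some ((G.subdivide f hf).ι .far) = some .far ↔ _
  by_cases h : G.ι f = f
  · rw [subdivide_ι_far_leg h]; simp [h]
  · rw [subdivide_ι_far_edge h]; simp [h]

lemma spec_sproutOld_ι (hG : (G.sprout f hf).Adm) (h : G.ι f ≠ f) :
    (G.sprout f hf).Spec (G.sproutOld f hf (G.ι f)) ∧
      (G.sprout f hf).partner (G.sproutOld f hf (G.ι f)) = some .near := by
  have := hG.spec_symm (spec_sproutOld hG) (fun h' => h ((ι_partner_eq_iff hG).1 h'))
  rw [partner_sproutOld hG] at this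
  have e : (G.sprout f hf).ι (some .far) = G.sproutOld f hf (G.ι f) :=
    congrArg some (subdivide_ι_far_edge h)
  have e' : (G.sprout f hf).ι (G.sproutOld f hf f) = some .near := congrArg some subdivide_ι_self
  rwa [e, e'] at this

lemma sproutOld_not_spec {x : G.X} (h1 : x ≠ f) (h2 : x ≠ G.ι f) :
    ¬ ((G.sprout f hf).Bad ∧ (G.sprout f hf).r ((G.sprout f hf).ι (G.sproutOld f hf x)) =
      (G.sprout f hf).lastVertex) := by
  rintro ⟨-, h⟩
  rw [attach_lastVertex] at h
  have e : (G.sprout f hf).ι (G.sproutOld f hf x) = G.sproutOld f hf (G.ι x) :=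
    congrArg some (subdivide_ι_of_ne h1 h2)
  rw [e] at h
  cases h

/-- Stabilization undoes the subdivision: across the middle vertex, `f` is joined again to its old
opposite, or becomes a leg again if it was one. -/
lemma forgetInv_sproutOld (hG : (G.sprout f hf).Adm) (x : G.X) :
    (G.sprout f hf).forgetInv (G.sproutOld f hf x) = G.sproutOld f hf (G.ι x) := by
  by_cases h1 : x = f
  · subst h1
    by_cases h : G.ι x = x
    · rw [(spec_sproutOld hG).forgetInv_leg ((ι_partner_eq_iff hG).2 h), h]
    · rw [Spec.forgetInv_edge (fun h' => h ((ι_partner_eq_iff hG).1 h')), partner_sproutOld hG]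
      exact congrArg some (subdivide_ι_far_edge h)
  · by_cases h2 : x = G.ι f
    · have h : G.ι f ≠ f := fun h => h1 (h2.trans h)
      obtain ⟨-, hp⟩ := spec_sproutOld_ι hG h
      have e : (G.sprout f hf).ι (some .near) = G.sproutOld f hf f := rfl
      rw [h2, Spec.forgetInv_edge (by rw [hp, e]; nofun), hp, e, G.ι_ι]
    · rw [forgetInv_of_not (sproutOld_not_spec h1 h2)]
      exact congrArg some (subdivide_ι_of_ne h1 h2)

lemma forgetMark_sprout (hG : (G.sprout f hf).Adm) (i : Fin n) :
    (G.sprout f hf).forgetMark i = G.sproutOld f hf (G.mark i) := by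
  by_cases h : G.mark i = f
  · have hm : (G.sprout f hf).mark i.castSucc = some .far := by
      rw [attach_mark_castSucc]
      exact congrArg some (if_pos h)
    have hb : (G.sprout f hf).Bad ∧ (G.sprout f hf).r ((G.sprout f hf).mark i.castSucc) =
        (G.sprout f hf).lastVertex := by
      rw [hm, attach_lastVertex]
      exact ⟨sprout_bad, rfl⟩
    have ho := (spec_sproutOld hG).other
    rw [partner_sproutOld hG] at ho
    refine (if_pos hb).trans ?_
    rw [hm, ho, h, ι_ι]
  · have hm : (G.sprout f hf).mark i.castSucc = G.sproutOld f hf (G.mark i) := by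
      rw [attach_mark_castSucc]
      exact congrArg some (if_neg h)
    rw [forgetMark_of_not, hm]
    rw [hm, attach_lastVertex]
    rintro ⟨-, h'⟩
    cases h'

/-- Forgetting the leg at the new vertex of a subdivided graph. -/
def sproutHom (hG : (G.sprout f hf).Adm) : Hom G ((G.sprout f hf).forget hG) :=
  Hom.ofBijective (fun x => hG.of (G.sproutOld f hf x) (sproutOld_mem_keep x)) (by
    refine ⟨fun x y h => Subdivided.old.inj (Option.some.inj (congrArg hG.val h)), fun y => ?_⟩
    obtain ⟨y, hy, rfl⟩ : ∃ z hz, hG.of z hz = y := ⟨hG.val y, hG.val_mem y, rfl⟩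
    have h2 := hy.2
    rw [attach_lastVertex] at h2
    cases y with
    | none => exact absurd attach_lastLeg.symm hy.1
    | some y =>
      cases y with
      | old y => exact ⟨y, rfl⟩
      | _ => exact absurd ⟨sprout_bad, rfl⟩ h2)
  (fun _ => rfl)
  (fun x => hG.val_injective (by
    rw [hG.val_ι, hG.val_of, hG.val_of]
    exact (forgetInv_sproutOld hG x).symm))
  (fun i => hG.val_injective (by rw [hG.val_mark, hG.val_of, forgetMark_sprout hG]))
  (fun _ _ => rfl)

/-- The pieces `t` and `t'` are added up again on an edge. On a leg the piece `t` is discarded, in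
accordance with the convention that legs have length zero. -/
lemma len_sproutOld (hG : (G.sprout f hf).Adm) {d : G.X → P} {d' : (G.sprout f hf).X → P} {t t' : P}
    (hd' : ∀ x, d' (some x) = G.subdivLen f d t t' x) (hd : ∀ x, d (G.ι x) = d x)
    (hl : G.ι f = f → d f = 0) (ht : G.ι f ≠ f → t + t' = d f) (x : G.X) :
    (G.sprout f hf).forgetLen d' (G.sproutOld f hf x) = d x := by
  by_cases h1 : x = f
  · subst h1
    by_cases h : G.ι x = x
    · rw [(spec_sproutOld hG).forgetLen_leg ((ι_partner_eq_iff hG).2 h), hl h]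
    · rw [(spec_sproutOld hG).forgetLen_edge (fun h' => h ((ι_partner_eq_iff hG).1 h')),
        partner_sproutOld hG, hd', hd', subdivLen_self, subdivLen_far_edge h, ht h]
  · by_cases h2 : x = G.ι f
    · have h : G.ι f ≠ f := fun h => h1 (h2.trans h)
      obtain ⟨hs, hp⟩ := spec_sproutOld_ι hG h
      have e : (G.sprout f hf).ι (some .near) = G.sproutOld f hf f := rfl
      rw [h2, hs.forgetLen_edge (by rw [hp, e]; nofun), hp, hd', hd', subdivLen_ι h, hd, ← ht h]
      exact add_comm t' t
    · rw [forgetLen_of_not (sproutOld_not_spec h1 h2), hd', subdivLen_of_ne h1 h2]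

end Subdivide

end MGraph

/-! ### Realizing a section by a leg -/

namespace MTrop

variable {g n : ℕ}

/-- A leg attached at `v` creates no instability when it is forgotten, so the curve and the position
`v` come back unchanged, over the identity of the cone. -/
lemma exists_of_vertex (hgn : 2 < 2 * g + n) (A : MTrop g n) (v : A.curve.X)
    (hv : A.curve.IsVertex v) :
    ∃ (Γ : TropicalCurve g (n + 1) A.cone.S) (h : Γ.toMGraph.Stable)
      (θ : (toSections hgn).obj ⟨A.cone, Γ, h⟩ ⟶ ⟨A, A.curve.mkSection (Quot.mk _ (.vertex v hv))⟩),
      (proj g n).map (Pts.Hom.base θ) = 𝟙 A.cone := by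
  have hst : (A.curve.attach v hv).toMGraph.Stable :=
    MGraph.attach_stable (hv := hv) (fun u hu _ => (MGraph.stable_iff_finsum _).1 A.stable u hu)
      ((MGraph.stable_iff_finsum _).1 A.stable v hv).le
  let B : MTrop g (n + 1) := ⟨A.cone, A.curve.attach v hv, hst⟩
  have hb : ¬ B.curve.toMGraph.Bad := MGraph.Stable.attach_not_bad (hv := hv) A.stable
  let θ : B.forgetObj hgn ⟶ A := Hom.mk' (A := B.forgetObj hgn) (𝟙 A.cone)
    (MGraph.attachHom (hv := hv) A.stable (B.adm hgn))
    (fun x => MGraph.forgetLen_of_not (fun h => hb h.1))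
  refine ⟨A.curve.attach v hv, hst, ⟨θ, ?_⟩, rfl⟩
  refine (sectionPullback_mk θ _).trans (congrArg (B.forgetObj hgn).curve.mkSection ?_)
  refine Eq.trans ?_ ((B.adm hgn).lastPt_of_not_bad B.curve.d hb).symm
  have e : (B.adm hgn).val ((Hom.graph θ).toFun v) = B.curve.toMGraph.lastVertex :=
    (MGraph.attach_lastVertex (hv := hv)).symm
  exact MGraph.Pt.vertex_eq (Subtype.ext e)

/-- Interior points of legs and of edges are treated together: the flag is subdivided at distance
`t` from its root and the leg is attached in the middle. The conditions on `t'` are empty if `f` is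
a leg. -/
lemma exists_of_flag (hgn : 2 < 2 * g + n) (A : MTrop g n) (f : A.curve.X)
    (hf : ¬ A.curve.IsVertex f) (t t' : A.cone.S) (ht : t ≠ 0) (ht' : A.curve.ι f ≠ f → t' ≠ 0)
    (htt : A.curve.ι f ≠ f → t + t' = A.curve.d f) (p : MGraph.Pt A.curve.toMGraph A.curve.d)
    (hleg : ∀ h : A.curve.ι f = f, p = Quot.mk _ (.leg f ⟨hf, h⟩ t))
    (hedge : ∀ h : A.curve.ι f ≠ f, p = Quot.mk _ (.edge f h t t' (htt h))) :
    ∃ (Γ : TropicalCurve g (n + 1) A.cone.S) (h : Γ.toMGraph.Stable)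
      (θ : (toSections hgn).obj ⟨A.cone, Γ, h⟩ ⟶ ⟨A, A.curve.mkSection p⟩),
      (proj g n).map (Pts.Hom.base θ) = 𝟙 A.cone := by
  let Γ : TropicalCurve g (n + 1) A.cone.S :=
    (A.curve.subdivide f hf t t' ht ht').attach .mid
      (MGraph.subdivide_isVertex_mid (hf := hf))
  have hst : Γ.toMGraph.Stable := MGraph.sprout_stable (hf := hf) A.stable
  let B : MTrop g (n + 1) := ⟨A.cone, Γ, hst⟩
  have hlen : ∀ x, B.curve.toMGraph.forgetLen B.curve.d
      (A.curve.toMGraph.sproutOld f hf x) = A.curve.d x :=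
    MGraph.len_sproutOld (hf := hf) (B.adm hgn) (fun _ => rfl) A.curve.d_ι (A.curve.d_eq_zero f).2 htt
  let θ : B.forgetObj hgn ⟶ A := Hom.mk' (A := B.forgetObj hgn) (𝟙 A.cone)
    (MGraph.sproutHom (hf := hf) (B.adm hgn)) hlen
  refine ⟨Γ, hst, ⟨θ, ?_⟩, rfl⟩
  refine (sectionPullback_mk θ _).trans (congrArg (B.forgetObj hgn).curve.mkSection ?_)
  have hs := MGraph.spec_sproutOld (hf := hf) (B.adm hgn)
  have hp := MGraph.partner_sproutOld (hf := hf) (B.adm hgn)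
  have hiff := MGraph.ι_partner_eq_iff (hf := hf) (B.adm hgn)
  refine Eq.trans ?_ ((B.adm hgn).lastPt_of_spec B.curve.d_ι hs).symm
  have e1 : B.curve.d (A.curve.toMGraph.sproutOld f hf f) = t := MGraph.subdivLen_self
  by_cases h : A.curve.ι f = f
  · rw [hleg h]
    refine Eq.trans ?_ ((B.adm hgn).specPt_leg B.curve.d hs (hiff.2 h)).symm
    exact MGraph.Pt.leg_eq rfl e1.symm
  · rw [hedge h]
    refine Eq.trans ?_ ((B.adm hgn).specPt_edge B.curve.d hs (fun h' => h (hiff.1 h'))).symm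
    have e2 : B.curve.d (B.curve.toMGraph.partner (A.curve.toMGraph.sproutOld f hf f)) = t' :=
      (congrArg B.curve.d hp).trans (MGraph.subdivLen_far_edge (d := A.curve.d) (t := t) h)
    refine (MGraph.Pt.map_edge _ _ _ _ _ _ _ _
      ((B.adm hgn).forget_ι_ne hs (fun h' => h (hiff.1 h'))) ?_).trans
        (MGraph.Pt.edge_eq rfl e1.symm e2.symm)
    exact (htt h).trans (hlen f).symm

/-- Every section is the position of a last leg. -/
lemma exists_of_section (hgn : 2 < 2 * g + n) (x : Pts (sections g n)) :
    ∃ (Γ : TropicalCurve g (n + 1) x.base.cone.S) (h : Γ.toMGraph.Stable)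
      (θ : (toSections hgn).obj ⟨x.base.cone, Γ, h⟩ ⟶ x),
      (proj g n).map (Pts.Hom.base θ) = 𝟙 x.base.cone := by
  obtain ⟨A, s⟩ := x
  obtain ⟨p, rfl⟩ := TropicalCurve.exists_mkSection (Γ := A.curve) s
  induction p using Quot.ind with
  | mk p =>
    cases p with
    | vertex v hv => exact exists_of_vertex hgn A v hv
    | leg l hl t =>
      by_cases ht : t = 0
      · subst ht
        rw [Quot.sound (MGraph.PtRel.leg_zero l hl)]
        exact exists_of_vertex hgn A _ _
      · exact exists_of_flag hgn A l hl.1 t 0 ht (fun h => absurd hl.2 h)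
          (fun h => absurd hl.2 h) _ (fun _ => rfl) (fun h => absurd hl.2 h)
    | edge f hf t t' h =>
      -- Subdivision needs nonzero pieces. A point with a vanishing coordinate is a vertex: directly
      -- if `t = 0`, and after passing to the opposite flag if `t' = 0`.
      by_cases ht : t = 0
      · subst ht
        rw [Quot.sound (MGraph.PtRel.edge_zero f hf t' h)]
        exact exists_of_vertex hgn A _ _
      · by_cases ht' : t' = 0
        · subst ht'
          have hf' : A.curve.ι (A.curve.ι f) ≠ A.curve.ι f := by
            rw [A.curve.ι_ι]; exact hf.symm
          have h' : 0 + t = A.curve.d (A.curve.ι f) := by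
            rw [add_comm, A.curve.d_ι]; exact h
          rw [Quot.sound (MGraph.PtRel.edge_symm f hf hf' t 0 h h'),
            Quot.sound (MGraph.PtRel.edge_zero (A.curve.ι f) hf' t h')]
          exact exists_of_vertex hgn A _ _
        · exact exists_of_flag hgn A f (MGraph.not_isVertex_of_ι_ne hf) t t' ht (fun _ => ht')
            (fun _ => h) _ (fun h => absurd h hf) (fun _ => rfl)

end MTrop

/-! ### The universal curve -/

namespace MTrop

variable {g n : ℕ}

/-- A stable curve whose last leg is at the position of a given section. -/
def addLegObj (hgn : 2 < 2 * g + n) (x : Pts (sections g n)) : MTrop g (n + 1) :=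
  ⟨x.base.cone, (exists_of_section hgn x).choose, (exists_of_section hgn x).choose_spec.choose⟩

/-- The comparison of the position of the new leg with the given section. -/
def addLegHom (hgn : 2 < 2 * g + n) (x : Pts (sections g n)) :
    (toSections hgn).obj (addLegObj hgn x) ⟶ x :=
  (exists_of_section hgn x).choose_spec.choose_spec.choose

/-- The morphism of cones that underlies a morphism of sections. -/
abbrev sectionsProj (g n : ℕ) : Pts (sections g n) ⥤ RPC := Pts.proj (sections g n) ⋙ proj g n

/-- The realization of a section lies over the same cone, with comparison over the identity. This
makes Φ a functor strictly over `RPC` and puts the isomorphism of π ∘ Φ with the projection over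
identities. -/
lemma sectionsProj_addLegHom (hgn : 2 < 2 * g + n) (x : Pts (sections g n)) :
    (sectionsProj g n).map (addLegHom hgn x) = 𝟙 x.base.cone :=
  (exists_of_section hgn x).choose_spec.choose_spec.choose_spec

lemma isIso_base_addLegHom (hgn : 2 < 2 * g + n) (x : Pts (sections g n)) :
    IsIso (Hom.base (Pts.Hom.base (addLegHom hgn x))) := by
  have h : Hom.base (Pts.Hom.base (addLegHom hgn x)) = 𝟙 x.base.cone :=
    sectionsProj_addLegHom hgn x
  rw [h]
  exact IsIso.id _

instance (hgn : 2 < 2 * g + n) (x : Pts (sections g n)) : IsIso (addLegHom hgn x) :=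
  isIso_pts _ (isIso_base_addLegHom hgn x)

lemma sectionsProj_inv_addLegHom (hgn : 2 < 2 * g + n) (x : Pts (sections g n)) :
    (sectionsProj g n).map (inv (addLegHom hgn x)) = 𝟙 x.base.cone := by
  have h1 : (sectionsProj g n).map (addLegHom hgn x) ≫
      (sectionsProj g n).map (inv (addLegHom hgn x)) = 𝟙 _ := by
    exact ((sectionsProj g n).map_comp _ _).symm.trans
      ((congrArg (sectionsProj g n).map (IsIso.hom_inv_id _)).trans ((sectionsProj g n).map_id _))
  exact (Category.id_comp _).symm.trans
    ((congrArg (· ≫ _) (sectionsProj_addLegHom hgn x).symm).trans h1)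

lemma toSections_isEquivalence (hgn : 2 < 2 * g + n) :
    (toSections (g := g) hgn).IsEquivalence where
  faithful := toSections_faithful hgn
  full := toSections_full hgn
  essSurj := ⟨fun x => ⟨addLegObj hgn x, ⟨asIso (addLegHom hgn x)⟩⟩⟩

/-- The functor `X_{g,n} → M_{g,n+1}` that adds a leg at the position of a section. -/
def addLegFunctor (hgn : 2 < 2 * g + n) : Pts (sections g n) ⥤ MTrop g (n + 1) :=
  have := toSections_isEquivalence (g := g) hgn
  { obj := addLegObj hgn
    -- Morphisms are defined by conjugating with the comparisons and taking the unique preimage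
    -- under the fully faithful `toSections`, so that the comparisons become natural.
    map := fun {x y} f => (toSections hgn).preimage
      (addLegHom hgn x ≫ f ≫ inv (addLegHom hgn y))
    map_id := fun x => (toSections hgn).map_injective (by simp)
    map_comp := fun f f' => (toSections hgn).map_injective (by simp) }

lemma toSections_addLeg (hgn : 2 < 2 * g + n) {x y : Pts (sections g n)} (f : x ⟶ y) :
    (toSections hgn).map ((addLegFunctor hgn).map f) =
      addLegHom hgn x ≫ f ≫ inv (addLegHom hgn y) := by
  have := toSections_isEquivalence (g := g) hgn
  exact (toSections hgn).map_preimage _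

lemma toSections_addLeg_comp (hgn : 2 < 2 * g + n) {x y : Pts (sections g n)} (f : x ⟶ y) :
    (toSections hgn).map ((addLegFunctor hgn).map f) ≫ addLegHom hgn y = addLegHom hgn x ≫ f := by
  have h : (addLegHom hgn x ≫ f ≫ inv (addLegHom hgn y)) ≫ addLegHom hgn y =
      addLegHom hgn x ≫ f := by simp
  exact (congrArg (· ≫ addLegHom hgn y) (toSections_addLeg hgn f)).trans h

/-- The comparison isomorphism of the position of the new leg with the given section. -/
def addLegObjIso (hgn : 2 < 2 * g + n) (x : Pts (sections g n)) :
    (toSections hgn).obj (addLegObj hgn x) ≅ x := asIso (addLegHom hgn x)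

/-- Adding a leg is inverse to taking the position of the last leg. -/
def addLegIso (hgn : 2 < 2 * g + n) : addLegFunctor hgn ⋙ toSections hgn ≅ 𝟭 (Pts (sections g n)) :=
  NatIso.ofComponents (addLegObjIso hgn) (fun f => toSections_addLeg_comp hgn f)

lemma addLegFunctor_isEquivalence (hgn : 2 < 2 * g + n) :
    (addLegFunctor (g := g) hgn).IsEquivalence := by
  have := toSections_isEquivalence (g := g) hgn
  have : (addLegFunctor (g := g) hgn ⋙ toSections hgn).IsEquivalence :=
    Functor.isEquivalence_of_iso (addLegIso hgn).symm
  exact Functor.isEquivalence_of_comp_right _ (toSections hgn)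

lemma proj_map_addLeg (hgn : 2 < 2 * g + n) {x y : Pts (sections g n)} (f : x ⟶ y) :
    (proj g (n + 1)).map ((addLegFunctor hgn).map f) = (sectionsProj g n).map f := by
  refine (congrArg (sectionsProj g n).map (toSections_addLeg hgn f)).trans ?_
  refine ((sectionsProj g n).map_comp _ _).trans
    ((congrArg (_ ≫ ·) ((sectionsProj g n).map_comp _ _)).trans ?_)
  refine (congrArg₂ (fun a b => a ≫ (sectionsProj g n).map f ≫ b)
    (sectionsProj_addLegHom hgn x) (sectionsProj_inv_addLegHom hgn y)).trans ?_
  exact (Category.id_comp _).trans (Category.comp_id _)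

/-- The equivalence `X_{g,n} → M_{g,n+1}` over the category of cones. -/
def addLeg (hgn : 2 < 2 * g + n) : BasedFunctor (universalCurve g n) (based g (n + 1)) where
  toFunctor := addLegFunctor hgn
  w := Functor.hext (fun _ => rfl) (fun _ _ f => heq_of_eq (proj_map_addLeg hgn f))

/-- Forgetting an added leg. -/
def addLegForgetNatIso (hgn : 2 < 2 * g + n) :
    addLegFunctor hgn ⋙ forgetFunctor hgn ≅ Pts.proj (sections g n) :=
  Functor.isoWhiskerRight (addLegIso hgn) (Pts.proj (sections g n))

lemma addLegForgetNatIso_hom_app (hgn : 2 < 2 * g + n) (x : Pts (sections g n)) :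
    (addLegForgetNatIso hgn).hom.app x = Pts.Hom.base (addLegHom hgn x) := rfl

lemma addLegForgetNatIso_isHomLift (hgn : 2 < 2 * g + n) (x : Pts (sections g n)) :
    (proj g n).IsHomLift (𝟙 x.base.cone) ((addLegForgetNatIso hgn).hom.app x) := by
  have h := sectionsProj_addLegHom hgn x
  rw [addLegForgetNatIso_hom_app, ← h]
  exact IsHomLift.map (proj g n) (Pts.Hom.base (addLegHom hgn x))

/-- Forgetting an added leg, over the category of cones. -/
def addLegForgetIso (hgn : 2 < 2 * g + n) :
    (addLeg hgn).comp (forget hgn) ≅ universalCurveProj g n :=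
  BasedNatIso.mkNatIso (addLegForgetNatIso hgn) (addLegForgetNatIso_isHomLift hgn)

/-- The weight at the last leg is the weight of its position, and the comparison with the given
section lies over the identity, where weights are invariant. -/
lemma lastWeight_addLeg (hgn : 2 < 2 * g + n) (x : Pts (sections g n)) :
    lastWeight ((addLeg hgn).obj x) = TropicalCurve.sectionWeight x.base.curve x.pt := by
  have := isIso_base_addLegHom hgn x
  refine (sectionWeight_lastSection hgn (addLegObj hgn x)).symm.trans ?_
  refine Eq.trans ?_ (sectionWeight_sectionPullback (Pts.Hom.base (addLegHom hgn x)) x.pt)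
  exact congrArg _ (sectionPullback_pt (addLegHom hgn x)).symm

/-! ### Classifying maps -/

/-- The morphism between pullbacks of a tropical curve. -/
def pullbackMap (A : MTrop g n) {a b : Pts (yoneda.obj A.cone)} (f : a ⟶ b) :
    A.pullback a.pt ⟶ A.pullback b.pt :=
  lift (A.pullbackHom a.pt) (A.pullbackHom b.pt) (Pts.Hom.base f) (Pts.Hom.map_pt f)

lemma pullbackMap_comp (A : MTrop g n) {a b : Pts (yoneda.obj A.cone)} (f : a ⟶ b) :
    A.pullbackMap f ≫ A.pullbackHom b.pt = A.pullbackHom a.pt := lift_comp _ _ _ _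

lemma base_pullbackMap (A : MTrop g n) {a b : Pts (yoneda.obj A.cone)} (f : a ⟶ b) :
    Hom.base (A.pullbackMap f) = Pts.Hom.base f := lift_base _ _ _ _

/-- The morphism from a cone to the moduli stack that corresponds to a tropical curve. -/
def pullbackFunctor (A : MTrop g n) : Pts (yoneda.obj A.cone) ⥤ MTrop g n where
  obj a := A.pullback a.pt
  map f := A.pullbackMap f
  map_id a := lift_unique (A.pullbackHom a.pt) (A.base_pullbackMap (𝟙 a))
    ((A.pullbackMap_comp (𝟙 a)).trans (Category.id_comp _).symm)
  map_comp {a b c} f f' := lift_unique (A.pullbackHom c.pt)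
    ((A.base_pullbackMap (f ≫ f')).trans
      (congrArg₂ (fun u v => u ≫ v) (A.base_pullbackMap f) (A.base_pullbackMap f')).symm)
    (by rw [pullbackMap_comp, Category.assoc, pullbackMap_comp, pullbackMap_comp])

/-- Send a morphism of cones to the pullback of `A` along it. The canonical morphism from the
pullback along the identity is an isomorphism because its base is. -/
lemma nonempty_classifyingMap (A : MTrop g n) : Nonempty (ClassifyingMap A) := by
  have h : IsIso (A.pullbackHom (𝟙 A.cone)) := isIso_of_isIso_base _ (IsIso.id A.cone)
  exact ⟨⟨⟨A.pullbackFunctor, Functor.hext (fun _ => rfl)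
    (fun _ _ f => heq_of_eq (A.base_pullbackMap f))⟩, @asIso _ _ _ _ (A.pullbackHom (𝟙 A.cone)) h,
    IsHomLift.map (proj g n) (A.pullbackHom (𝟙 A.cone))⟩⟩

/-! ### Points of the cone over a curve as sections of its pullbacks -/

/-- The section of a curve `T` over `A` given by a point of the cone over `A`. -/
def sectionAt {T A : MTrop g n} (θ : T ⟶ A) {α : RPC} (q : A.curve.Cone.obj (op α))
    (e : T.cone ⟶ α) (h : Hom.base θ = e ≫ q.1) : T.curve.Section :=
  T.curve.mkSection (MGraph.Pt.map (Hom.graph θ) (RPC.pull e) (fun y => by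
    rw [Hom.d_eq, ← RPC.pull_comp, ← h]) q.2)

lemma sectionAt_congr {T A : MTrop g n} {θ θ' : T ⟶ A} {α : RPC} {q q' : A.curve.Cone.obj (op α)}
    {e e' : T.cone ⟶ α} (h : Hom.base θ = e ≫ q.1) (hθ : θ = θ') (hq : q = q') (he : e = e') :
    sectionAt θ q e h = sectionAt θ' q' e' (by rw [← hθ, ← hq, ← he, h]) := by
  subst hθ hq he; rfl

lemma sectionPullback_sectionAt {T T' A : MTrop g n} (χ : T' ⟶ T) (θ : T ⟶ A) {α : RPC}
    (q : A.curve.Cone.obj (op α)) (e : T.cone ⟶ α) (h : Hom.base θ = e ≫ q.1) :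
    sectionPullback χ (sectionAt θ q e h) = sectionAt (χ ≫ θ) q (Hom.base χ ≫ e) (by
      rw [comp_base, h]; exact (Category.assoc _ _ _).symm) := by
  refine (sectionPullback_mk χ _).trans (congrArg T'.curve.mkSection ?_)
  exact MGraph.Pt.map_map _ _ _ _ _ _ _ _ _ (fun _ => rfl) (fun _ => rfl) q.2

lemma sectionAt_map {T A : MTrop g n} (θ : T ⟶ A) {α β : RPC} (f : β ⟶ α)
    (q : A.curve.Cone.obj (op α)) (e : T.cone ⟶ β) (h : Hom.base θ = e ≫ f ≫ q.1) :
    sectionAt θ (A.curve.Cone.map f.op q) e h = sectionAt θ q (e ≫ f) (by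
      rw [h, Category.assoc]) := by
  refine congrArg T.curve.mkSection ?_
  exact MGraph.Pt.map_map _ _ _ _ _ _ _ _ _ (fun _ => rfl) (fun _ => rfl) q.2

lemma sectionAt_mkSection {T A : MTrop g n} (θ : T ⟶ A) (s : A.curve.Section) (e : T.cone ⟶ A.cone)
    (h : Hom.base θ = e ≫ s.1.1) : sectionAt θ s.1 e h = sectionPullback θ s := by
  obtain ⟨p, rfl⟩ := TropicalCurve.exists_mkSection s
  obtain rfl : Hom.base θ = e := h.trans (Category.comp_id e)
  exact (sectionPullback_mk θ p).symm

lemma sectionAt_conePullback {T A B : MTrop g n} (θ : T ⟶ A) (φ : A ⟶ B) {α : RPC}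
    (x : (coneFiber φ).obj (op α)) (e : T.cone ⟶ α) (h : Hom.base θ = e ≫ x.1.2) :
    sectionAt θ ((conePullback φ).app (op α) x) e h = sectionAt (θ ≫ φ) x.1.1 e (by
      rw [comp_base, h, x.2]; exact Category.assoc _ _ _) := by
  refine congrArg T.curve.mkSection ?_
  exact MGraph.Pt.map_map _ _ _ _ _ _ _ _ _ (fun _ => rfl) (fun _ => rfl) x.1.1.2

/-- When `e` is invertible, `θ` exhibits `T` as the pullback of `A`. Its graph morphism contracts
edges whose length is zero at `q`, and these are collapsed in the glued space anyway, so no points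
are lost. -/
lemma sectionAt_injective {T A : MTrop g n} (θ : T ⟶ A) {α : RPC}
    {q q' : A.curve.Cone.obj (op α)} (e : T.cone ⟶ α) [IsIso e] (h : Hom.base θ = e ≫ q.1)
    (h' : Hom.base θ = e ≫ q'.1) (hqq : sectionAt θ q e h = sectionAt θ q' e h') : q = q' := by
  obtain ⟨a, p⟩ := q
  obtain ⟨a', p'⟩ := q'
  obtain rfl : a = a' := (cancel_epi e).1 (h.symm.trans h')
  refine Sigma.ext rfl (heq_of_eq ?_)
  exact MGraph.Pt.map_injective (Hom.graph θ) (RPC.pull e) _ (fun _ _ => RPC.sharp)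
    (fun y => (T.curve.d_eq_zero y).2) (RPC.pull (inv e)) (RPC.pull_inv_left e)
    (T.curve.mkSection_injective hqq)

lemma sectionAt_surjective {T A : MTrop g n} (θ : T ⟶ A) {α : RPC} (a : α ⟶ A.cone)
    (e : T.cone ⟶ α) [IsIso e] (h : Hom.base θ = e ≫ a) (s : T.curve.Section) :
    ∃ p, sectionAt θ (⟨a, p⟩ : A.curve.Cone.obj (op α)) e h = s := by
  obtain ⟨r, rfl⟩ := TropicalCurve.exists_mkSection s
  obtain ⟨p, hp⟩ := MGraph.Pt.map_surjective (ℓ := fun y => RPC.pull a (A.curve.d y))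
    (Hom.graph θ) (RPC.pull e) (fun y => by
      rw [Hom.d_eq, ← RPC.pull_comp, ← h]) (RPC.pull (inv e)) (RPC.pull_inv_left e)
    (RPC.pull_inv_right e) r
  exact ⟨p, congrArg T.curve.mkSection hp⟩

/-! ### Points of the cone as sections over a classifying map -/

namespace ClassifyingMap

variable {A B : MTrop g n}

/-- The morphism from the curve over `x` to the given curve. -/
def toCurve (C : ClassifyingMap A) (x : (coneStack A.cone).obj) : C.u.obj x ⟶ A :=
  C.u.map (toId x) ≫ C.iso.hom

/-- The identification of the base of the curve over `x`. -/
def baseIso (C : ClassifyingMap A) (x : (coneStack A.cone).obj) :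
    MTrop.cone (C.u.obj x) ≅ x.base := eqToIso (C.u.w_obj x)

/-- The identification of the base of the curve over `x`, as a morphism. -/
abbrev baseHom (C : ClassifyingMap A) (x : (coneStack A.cone).obj) :
    MTrop.cone (C.u.obj x) ⟶ x.base := (C.baseIso x).hom

/-- The classifying functor preserves lifts and its comparison lies over the identity, so the curve
over `x` is the pullback of the given curve along `x.pt`. The factor `baseHom` corrects for bases
that agree only by an equality of objects. -/
lemma base_toCurve (C : ClassifyingMap A) (x : (coneStack A.cone).obj) :
    Hom.base (C.toCurve x) = C.baseHom x ≫ x.pt := by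
  have h1 : (coneStack A.cone).p.IsHomLift x.pt (toId x) :=
    IsHomLift.map (coneStack A.cone).p (toId x)
  have h2 : (based g n).p.IsHomLift x.pt (C.u.map (toId x)) :=
    BasedFunctor.preserves_isHomLift C.u x.pt (toId x)
  have h3 : (proj g n).IsHomLift (𝟙 A.cone) C.iso.hom := C.isHomLift
  have h4 : (proj g n).IsHomLift x.pt (C.toCurve x) :=
    @IsHomLift.comp_lift_id_right _ _ _ _ (proj g n) _ _ _ _ _ x.pt _ h2 _ h3
  refine (IsHomLift.fac' (proj g n) x.pt (C.toCurve x)).trans ?_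
  exact congrArg (C.baseHom x ≫ ·) (Category.comp_id _)

lemma map_toCurve (C : ClassifyingMap A) {x y : (coneStack A.cone).obj} (f : x ⟶ y) :
    C.u.map f ≫ C.toCurve y = C.toCurve x := by
  have h : f ≫ toId y = toId x := Pts.Hom.ext (Pts.Hom.map_pt f)
  refine (Category.assoc _ _ _).symm.trans (congrArg (· ≫ C.iso.hom) ?_)
  exact (C.u.map_comp f (toId y)).symm.trans (congrArg C.u.map h)

lemma base_map (C : ClassifyingMap A) {x y : (coneStack A.cone).obj} (f : x ⟶ y) :
    Hom.base (C.u.map f) ≫ C.baseHom y = C.baseHom x ≫ Pts.Hom.base f := by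
  have h1 : (coneStack A.cone).p.IsHomLift (Pts.Hom.base f) f :=
    IsHomLift.map (coneStack A.cone).p f
  have h2 : (based g n).p.IsHomLift (Pts.Hom.base f) (C.u.map f) :=
    BasedFunctor.preserves_isHomLift C.u _ f
  exact (IsHomLift.commSq (based g n).p (Pts.Hom.base f) (C.u.map f)).w

/-- The section of the pullback of a curve given by a point of the cone over this curve. -/
def sectionOf (C : ClassifyingMap A) (x : Pts A.curve.Cone) :
    (C.u.obj (A.curveStackProj.obj x)).curve.Section :=
  sectionAt (C.toCurve (A.curveStackProj.obj x)) x.pt (C.baseHom (A.curveStackProj.obj x))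
    (C.base_toCurve (A.curveStackProj.obj x))

/-- Both sides are images of the same point of the cone in the same curve, because the morphisms to
the given curve are compatible with `C.u.map`. -/
lemma sectionPullback_sectionOf (C : ClassifyingMap A) {x y : Pts A.curve.Cone} (f : x ⟶ y) :
    sectionPullback (C.u.map (A.curveStackProj.map f)) (C.sectionOf y) = C.sectionOf x := by
  refine (sectionPullback_sectionAt (C.u.map (A.curveStackProj.map f))
    (C.toCurve (A.curveStackProj.obj y)) y.pt _ _).trans ?_
  refine (sectionAt_congr _ (C.map_toCurve (A.curveStackProj.map f)) rfl
    (C.base_map (A.curveStackProj.map f))).trans ?_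
  refine (sectionAt_map _ (Pts.Hom.base f) y.pt (C.baseHom (A.curveStackProj.obj x)) ?_).symm.trans
    (sectionAt_congr _ rfl (Pts.Hom.map_pt f) rfl)
  refine (C.base_toCurve (A.curveStackProj.obj x)).trans (congrArg (C.baseHom _ ≫ ·) ?_)
  exact (congrArg Sigma.fst (Pts.Hom.map_pt f)).symm

/-- The functor from the cone over a curve to sections. -/
def sectionFunctor (C : ClassifyingMap A) : Pts A.curve.Cone ⥤ Pts (sections g n) where
  obj x := ⟨C.u.obj (A.curveStackProj.obj x), C.sectionOf x⟩
  map f := ⟨C.u.map (A.curveStackProj.map f), C.sectionPullback_sectionOf f⟩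
  map_id x := Pts.Hom.ext ((congrArg _ (A.curveStackProj.map_id x)).trans (C.u.map_id _))
  map_comp f f' := Pts.Hom.ext ((congrArg _ (A.curveStackProj.map_comp f f')).trans
    (C.u.map_comp _ _))

/-- The morphism from the cone over a curve to the universal curve. -/
def toUniversal (C : ClassifyingMap A) : BasedFunctor A.curveStack (universalCurve g n) where
  toFunctor := C.sectionFunctor
  w := congrArg (fun F => A.curveStackProj.toFunctor ⋙ F) C.u.w

end ClassifyingMap

end MTrop

/-! ### The cone over a curve as a fibre product -/

namespace MTrop

variable {g n : ℕ}

/-- The morphism from the cone over a curve to the moduli stack of curves with an additional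
leg. -/
def addLegCurve (hgn : 2 < 2 * g + n) {A : MTrop g n} (C : ClassifyingMap A) :
    BasedFunctor A.curveStack (based g (n + 1)) := C.toUniversal.comp (addLeg hgn)

/-- The 2-isomorphism of the square of a curve. -/
def addLegCurveIso (hgn : 2 < 2 * g + n) {A : MTrop g n} (C : ClassifyingMap A) :
    A.curveStackProj.comp C.u ≅ (addLegCurve hgn C).comp (forget hgn) :=
  (BasedNatIso.mkNatIso (F := (addLegCurve hgn C).comp (forget hgn))
    (G := A.curveStackProj.comp C.u)
    (Functor.isoWhiskerLeft C.sectionFunctor (addLegForgetNatIso hgn))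
    (fun x => (addLegForgetIso hgn).hom.isHomLift (C.toUniversal.w_obj x))).symm

/-- The square of a curve. -/
def curveSquare (hgn : 2 < 2 * g + n) {A : MTrop g n} (C : ClassifyingMap A) :
    CurveSquare hgn C := ⟨addLegCurve hgn C, addLegCurveIso hgn C⟩

lemma curveSquare_hom_app (hgn : 2 < 2 * g + n) {A : MTrop g n} (C : ClassifyingMap A)
    (x : Pts A.curve.Cone) : (curveSquare hgn C).β.hom.app x =
      Pts.Hom.base (inv (addLegHom hgn (C.sectionFunctor.obj x))) := by
  have h : (addLegObjIso hgn (C.sectionFunctor.obj x)).inv =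
    inv (addLegHom hgn (C.sectionFunctor.obj x)) := rfl
  rw [← h]
  rfl

/-- Over a section, the classified curve maps to `A` with invertible base, and the section used
there is the pullback of `s`. -/
lemma lastWeight_curveSquare (hgn : 2 < 2 * g + n) {A : MTrop g n} (C : ClassifyingMap A)
    (s : A.curve.Section) :
    lastWeight ((curveSquare hgn C).U.obj (A.sectionPoint s)) = A.curve.sectionWeight s := by
  refine (lastWeight_addLeg hgn (C.sectionFunctor.obj (A.sectionPoint s))).trans ?_
  have h := C.base_toCurve (A.curveStackProj.obj (A.sectionPoint s))
  have hs : (A.curveStackProj.obj (A.sectionPoint s)).pt = 𝟙 A.cone := s.2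
  have hi : IsIso (Hom.base (C.toCurve (A.curveStackProj.obj (A.sectionPoint s)))) := by
    rw [show Hom.base (C.toCurve (A.curveStackProj.obj (A.sectionPoint s))) = C.baseHom _ from
      h.trans ((congrArg (_ ≫ ·) hs).trans (Category.comp_id _))]
    exact (C.baseIso _).isIso_hom
  refine Eq.trans ?_ (sectionWeight_sectionPullback
    (C.toCurve (A.curveStackProj.obj (A.sectionPoint s))) s)
  exact congrArg _ (sectionAt_mkSection _ s _ h)

/-! ### Cartesian squares -/

/-- For fullness: a morphism of sections that covers a morphism of points of `σ` comes from the
cone, because a point of the cone is determined by its section (`sectionAt_injective`). -/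
lemma exists_point_hom {A : MTrop g n} (C : ClassifyingMap A) {x y : Pts A.curve.Cone}
    (f : A.curveStackProj.obj x ⟶ A.curveStackProj.obj y)
    (k : C.sectionFunctor.obj x ⟶ C.sectionFunctor.obj y)
    (hk : Pts.Hom.base k = C.u.map f) :
    ∃ l : x ⟶ y, A.curveStackProj.map l = f ∧ C.sectionFunctor.map l = k := by
  let b : x.base ⟶ y.base := (coneStack A.cone).p.map f
  have h1 : b ≫ y.pt.1 = x.pt.1 := Pts.Hom.map_pt f
  have hb := C.base_toCurve (A.curveStackProj.obj x)
  have h2 : Hom.base (C.toCurve (A.curveStackProj.obj x)) =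
      C.baseHom (A.curveStackProj.obj x) ≫ b ≫ y.pt.1 :=
    hb.trans (congrArg (C.baseHom _ ≫ ·) h1.symm)
  have hl : A.curve.Cone.map b.op y.pt = x.pt := by
    have hi : IsIso (C.baseHom (A.curveStackProj.obj x)) := (C.baseIso _).isIso_hom
    refine @sectionAt_injective _ _ _ _ (C.toCurve (A.curveStackProj.obj x)) x.base _ _
      (C.baseHom (A.curveStackProj.obj x)) hi h2 hb ?_
    refine (sectionAt_map _ _ _ _ h2).trans ?_
    have h3 : sectionPullback (C.u.map f) (C.sectionOf y) = C.sectionOf x :=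
      (congrArg (fun m => sectionPullback m (C.sectionOf y)) hk.symm).trans (Pts.Hom.map_pt k)
    refine Eq.trans ?_ h3
    refine Eq.symm ((sectionPullback_sectionAt (C.u.map f)
      (C.toCurve (A.curveStackProj.obj y)) y.pt _ _).trans ?_)
    exact sectionAt_congr _ (C.map_toCurve f) rfl (C.base_map f)
  exact ⟨⟨b, hl⟩, rfl, Pts.Hom.ext hk.symm⟩

/-- For essential surjectivity: an object of the fibre product gives a section of the curve over
`x`, namely the position of the last leg of `B` pulled back along `i`. This section comes from a
point of the cone by `sectionAt_surjective`. -/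
lemma exists_isoClass {A : MTrop g n} (hgn : 2 < 2 * g + n) (C : ClassifyingMap A)
    (x : Pts (yoneda.obj A.cone)) (B : MTrop g (n + 1)) (i : C.u.obj x ≅ B.forgetObj hgn) :
    ∃ (p : _) (κ : addLegObj hgn (C.sectionFunctor.obj ⟨x.base, ⟨x.pt, p⟩⟩) ≅ B),
      (forgetFunctor hgn).map κ.hom =
        Pts.Hom.base (addLegHom hgn (C.sectionFunctor.obj ⟨x.base, ⟨x.pt, p⟩⟩)) ≫ i.hom := by
  have := toSections_isEquivalence (g := g) hgn
  obtain ⟨p, hp⟩ := sectionAt_surjective (C.toCurve x) x.pt (C.baseHom x) (C.base_toCurve x)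
    (sectionPullback i.hom (B.lastSection hgn))
  let ζ : C.sectionFunctor.obj ⟨x.base, ⟨x.pt, p⟩⟩ ⟶ (toSections hgn).obj B := ⟨i.hom, hp.symm⟩
  have hζ : IsIso ζ := isIso_pts ζ ((proj g n).mapIso i).isIso_hom
  let κ := addLegObjIso hgn (C.sectionFunctor.obj ⟨x.base, ⟨x.pt, p⟩⟩) ≪≫ asIso ζ
  refine ⟨p, (toSections hgn).preimageIso κ, ?_⟩
  exact congrArg Pts.Hom.base ((toSections hgn).map_preimage κ.hom)

lemma isTwoCartesian_curveSquare (hgn : 2 < 2 * g + n) {A : MTrop g n} (C : ClassifyingMap A) :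
    IsTwoCartesian (curveSquare hgn C).β := by
  have hE := addLegFunctor_isEquivalence (g := g) hgn
  refine { faithful := ⟨?_⟩, full := ⟨?_⟩, essSurj := ⟨?_⟩ }
  · intro x y f f' h
    have h1 : A.curveStackProj.map f = A.curveStackProj.map f' :=
      congrArg (fun m => m.hom.fst) h
    exact Pts.Hom.ext (congrArg (coneStack A.cone).p.map h1)
  · rintro (x : Pts A.curve.Cone) (y : Pts A.curve.Cone) m
    let f : A.curveStackProj.obj x ⟶ A.curveStackProj.obj y := m.hom.fst
    obtain ⟨k, hk⟩ : ∃ k : C.sectionFunctor.obj x ⟶ C.sectionFunctor.obj y,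
      (addLegFunctor hgn).map k = m.hom.snd := (addLegFunctor hgn).map_surjective _
    have hw : C.u.map f ≫ Pts.Hom.base (inv (addLegHom hgn (C.sectionFunctor.obj y))) =
        Pts.Hom.base (inv (addLegHom hgn (C.sectionFunctor.obj x))) ≫
          (forgetFunctor hgn).map m.hom.snd :=
      ((congrArg (C.u.map f ≫ ·) (curveSquare_hom_app hgn C y)).symm.trans m.hom.w).trans
        (congrArg (· ≫ (forgetFunctor hgn).map m.hom.snd) (curveSquare_hom_app hgn C x))
    have hkb : (forgetFunctor hgn).map m.hom.snd = Pts.Hom.base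
        (addLegHom hgn (C.sectionFunctor.obj x) ≫ k ≫ inv (addLegHom hgn (C.sectionFunctor.obj y))) := by
      exact (congrArg (forgetFunctor hgn).map hk.symm).trans
        (congrArg Pts.Hom.base (toSections_addLeg hgn k))
    -- Compatibility of `m` with the 2-isomorphisms, after cancelling the comparisons at both ends,
    -- says that `k` covers `C.u.map f`.
    have hkf : Pts.Hom.base k = C.u.map f := by
      have e1 : Pts.Hom.base (inv (addLegHom hgn (C.sectionFunctor.obj y))) ≫
          Pts.Hom.base (addLegHom hgn (C.sectionFunctor.obj y)) = 𝟙 _ :=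
        congrArg Pts.Hom.base (IsIso.inv_hom_id (addLegHom hgn (C.sectionFunctor.obj y)))
      have e2 : inv (addLegHom hgn (C.sectionFunctor.obj x)) ≫
          (addLegHom hgn (C.sectionFunctor.obj x) ≫ k ≫
            inv (addLegHom hgn (C.sectionFunctor.obj y))) ≫
          addLegHom hgn (C.sectionFunctor.obj y) = k := by simp
      have e3 := congrArg (· ≫ Pts.Hom.base (addLegHom hgn (C.sectionFunctor.obj y)))
        (hw.trans (congrArg (_ ≫ ·) hkb))
      refine ((congrArg Pts.Hom.base e2).symm.trans (Eq.trans ?_ e3.symm)).trans ?_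
      · exact (Category.assoc _ _ _).symm
      · exact (Category.assoc _ _ _).trans ((congrArg (C.u.map f ≫ ·) e1).trans (Category.comp_id _))
    obtain ⟨l, h1, h2⟩ := exists_point_hom C f k hkf
    refine ⟨l, ?_⟩
    apply ObjectProperty.hom_ext
    refine Limits.CategoricalPullback.hom_ext h1 ?_
    exact (congrArg (addLegFunctor hgn).map h2).trans hk
  · intro o
    obtain ⟨p, κ, hκ⟩ := exists_isoClass hgn C o.obj.fst o.obj.snd o.obj.iso
    let w : Pts A.curve.Cone := ⟨Pts.base o.obj.fst, ⟨Pts.pt o.obj.fst, p⟩⟩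
    refine ⟨w, ⟨ObjectProperty.isoMk _
      (Limits.CategoricalPullback.mkIso (Iso.refl o.obj.fst) κ ?_)⟩⟩
    have e1 : Pts.Hom.base (inv (addLegHom hgn (C.sectionFunctor.obj w))) ≫
        Pts.Hom.base (addLegHom hgn (C.sectionFunctor.obj w)) = 𝟙 _ :=
      congrArg Pts.Hom.base (IsIso.inv_hom_id (addLegHom hgn (C.sectionFunctor.obj w)))
    refine ((congrArg (· ≫ o.obj.iso.hom) (C.u.map_id o.obj.fst)).trans (Category.id_comp _)).trans
      (Eq.symm ?_)
    refine (congrArg₂ (fun a b => a ≫ b) (curveSquare_hom_app hgn C w) hκ).trans ?_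
    exact (Category.assoc _ _ _).symm.trans
      ((congrArg (· ≫ o.obj.iso.hom) e1).trans (Category.id_comp _))

/-! ### Contravariance -/

section Compatible

variable {A B : MTrop g n} (φ : A ⟶ B) (C : ClassifyingMap A) (D : ClassifyingMap B)

/-- The point of `A.cone` below a point of the fibre product. -/
abbrev fiberLeft (x : Pts (coneFiber φ)) : Pts (yoneda.obj A.cone) :=
  A.curveStackProj.obj ((Pts.mapFunctor (conePullback φ)).obj x)

/-- The point of `B.cone` below a point of the fibre product. -/
abbrev fiberRight (x : Pts (coneFiber φ)) : Pts (yoneda.obj B.cone) :=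
  B.curveStackProj.obj ((Pts.mapFunctor (coneFiberFst φ)).obj x)

lemma base_toCurve_fiber (x : Pts (coneFiber φ)) :
    (C.baseHom (fiberLeft φ x) ≫ (D.baseIso (fiberRight φ x)).inv) ≫
      Hom.base (D.toCurve (fiberRight φ x)) = Hom.base (C.toCurve (fiberLeft φ x) ≫ φ) := by
  -- Stated for arbitrary cones: the bases of the curves equal those of the points only
  -- propositionally, and substitution needs free variables.
  have key : ∀ {X Y Z V W : RPC} (f : X ⟶ Y) (i : Z ≅ Y) (q : Y ⟶ W) (a : Y ⟶ V) (b : V ⟶ W)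
      (t : X ⟶ V) (s : Z ⟶ W), t = f ≫ a → s = i.hom ≫ q → q = a ≫ b →
      (f ≫ i.inv) ≫ s = t ≫ b := by
    rintro X Y Z V W f i q a b t s rfl rfl rfl
    simp
  exact key _ _ _ _ _ _ _ (C.base_toCurve (fiberLeft φ x)) (D.base_toCurve (fiberRight φ x)) x.pt.2

/-- The comparison of the two curves over a point of the fibre product. -/
def fiberHom (x : Pts (coneFiber φ)) : C.u.obj (fiberLeft φ x) ⟶ D.u.obj (fiberRight φ x) :=
  lift (C.toCurve (fiberLeft φ x) ≫ φ) (D.toCurve (fiberRight φ x))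
    (C.baseHom (fiberLeft φ x) ≫ (D.baseIso (fiberRight φ x)).inv) (base_toCurve_fiber φ C D x)

lemma base_fiberHom (x : Pts (coneFiber φ)) : Hom.base (fiberHom φ C D x) =
    C.baseHom (fiberLeft φ x) ≫ (D.baseIso (fiberRight φ x)).inv := lift_base _ _ _ _

lemma fiberHom_comp (x : Pts (coneFiber φ)) : fiberHom φ C D x ≫ D.toCurve (fiberRight φ x) =
    C.toCurve (fiberLeft φ x) ≫ φ := lift_comp _ _ _ _

/-- Both sections come from one point of the cone over `B`, and the two routes to `B` agree by
`fiberHom_comp`. -/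
lemma sectionPullback_fiberHom (x : Pts (coneFiber φ)) :
    sectionPullback (fiberHom φ C D x) (D.sectionOf ((Pts.mapFunctor (coneFiberFst φ)).obj x)) =
      C.sectionOf ((Pts.mapFunctor (conePullback φ)).obj x) := by
  refine (sectionPullback_sectionAt (fiberHom φ C D x) (D.toCurve (fiberRight φ x)) _ _ _).trans ?_
  refine Eq.trans ?_ (sectionAt_conePullback (C.toCurve (fiberLeft φ x)) φ x.pt
    (C.baseHom (fiberLeft φ x)) (C.base_toCurve (fiberLeft φ x))).symm
  refine sectionAt_congr _ (fiberHom_comp φ C D x) rfl ?_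
  refine (congrArg (· ≫ D.baseHom (fiberRight φ x)) (base_fiberHom φ C D x)).trans ?_
  exact (Category.assoc _ _ _).trans ((congrArg (C.baseHom (fiberLeft φ x) ≫ ·)
    (D.baseIso (fiberRight φ x)).inv_hom_id).trans (Category.comp_id _))

/-- The comparison of the two sections over a point of the fibre product. -/
def fiberSectionHom (x : Pts (coneFiber φ)) :
    C.sectionFunctor.obj ((Pts.mapFunctor (conePullback φ)).obj x) ⟶
      D.sectionFunctor.obj ((Pts.mapFunctor (coneFiberFst φ)).obj x) :=
  ⟨fiberHom φ C D x, sectionPullback_fiberHom φ C D x⟩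

lemma isIso_fiberSectionHom (x : Pts (coneFiber φ)) : IsIso (fiberSectionHom φ C D x) := by
  refine isIso_pts _ ?_
  rw [show Hom.base (Pts.Hom.base (fiberSectionHom φ C D x)) =
    (C.baseIso (fiberLeft φ x) ≪≫ (D.baseIso (fiberRight φ x)).symm).hom from base_fiberHom φ C D x]
  exact Iso.isIso_hom _

/-- Both composites end in a curve with a cartesian morphism to `B`, so it suffices to compare their
bases and their composites with this morphism. -/
lemma fiberSectionHom_naturality {x y : Pts (coneFiber φ)} (f : x ⟶ y) :
    C.sectionFunctor.map ((Pts.mapFunctor (conePullback φ)).map f) ≫ fiberSectionHom φ C D y =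
      fiberSectionHom φ C D x ≫ D.sectionFunctor.map ((Pts.mapFunctor (coneFiberFst φ)).map f) := by
  let l : fiberLeft φ x ⟶ fiberLeft φ y :=
    A.curveStackProj.map ((Pts.mapFunctor (conePullback φ)).map f)
  let r : fiberRight φ x ⟶ fiberRight φ y :=
    B.curveStackProj.map ((Pts.mapFunctor (coneFiberFst φ)).map f)
  let b : x.base ⟶ y.base := (Pts.proj (coneFiber φ)).map f
  have hl := C.base_map l
  have hr := D.base_map r
  have hbx := base_fiberHom φ C D x
  have hby := base_fiberHom φ C D y
  refine Pts.Hom.ext (lift_unique (D.toCurve (fiberRight φ y)) ?_ ?_)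
  · have key : ∀ {X Y Z X' Y' Z' : RPC} (i : X ≅ Z) (j : Y ≅ Z) (i' : X' ≅ Z') (j' : Y' ≅ Z')
        (b : Z ⟶ Z') (l : X ⟶ X') (r : Y ⟶ Y') (u : X ⟶ Y) (u' : X' ⟶ Y'),
        l ≫ i'.hom = i.hom ≫ b → r ≫ j'.hom = j.hom ≫ b → u = i.hom ≫ j.inv →
        u' = i'.hom ≫ j'.inv → l ≫ u' = u ≫ r := by
      rintro X Y Z X' Y' Z' i j i' j' b l r u u' h1 h2 rfl rfl
      rw [← cancel_mono j'.hom]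
      simp only [Category.assoc, Iso.inv_hom_id, Category.comp_id, h1, h2, Iso.inv_hom_id_assoc]
    exact key (C.baseIso (fiberLeft φ x)) (D.baseIso (fiberRight φ x)) (C.baseIso (fiberLeft φ y))
      (D.baseIso (fiberRight φ y)) b _ _ _ _ hl hr hbx hby
  · have hx : fiberHom φ C D x ≫ D.toCurve (fiberRight φ x) = C.toCurve (fiberLeft φ x) ≫ φ :=
      fiberHom_comp φ C D x
    have hy : fiberHom φ C D y ≫ D.toCurve (fiberRight φ y) = C.toCurve (fiberLeft φ y) ≫ φ :=
      fiberHom_comp φ C D y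
    have hlt : C.u.map l ≫ C.toCurve (fiberLeft φ y) = C.toCurve (fiberLeft φ x) :=
      C.map_toCurve l
    have hrt : D.u.map r ≫ D.toCurve (fiberRight φ y) = D.toCurve (fiberRight φ x) :=
      D.map_toCurve r
    refine ((Category.assoc _ _ _).trans (congrArg (C.u.map l ≫ ·) hy)).trans ?_
    refine ((Category.assoc _ _ _).symm.trans (congrArg (· ≫ φ) hlt)).trans ?_
    refine hx.symm.trans ((congrArg (fiberHom φ C D x ≫ ·) hrt.symm).trans ?_)
    exact (Category.assoc _ _ _).symm

/-- The comparison of the two functors from the fibre product to sections. -/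
def fiberSectionIso : Pts.mapFunctor (conePullback φ) ⋙ C.sectionFunctor ≅
    Pts.mapFunctor (coneFiberFst φ) ⋙ D.sectionFunctor :=
  NatIso.ofComponents (fun x => @asIso _ _ _ _ (fiberSectionHom φ C D x)
    (isIso_fiberSectionHom φ C D x)) (fun f => fiberSectionHom_naturality φ C D f)

lemma fiberSectionHom_isHomLift (x : Pts (coneFiber φ)) :
    (universalCurve g n).p.IsHomLift (𝟙 x.base) (fiberSectionHom φ C D x) := by
  refine IsHomLift.of_commsq (universalCurve g n).p (𝟙 x.base) (fiberSectionHom φ C D x)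
    (C.u.w_obj (fiberLeft φ x)) (D.u.w_obj (fiberRight φ x)) ?_
  refine (congrArg (· ≫ D.baseHom (fiberRight φ x)) (base_fiberHom φ C D x)).trans ?_
  exact (Category.assoc _ _ _).trans (congrArg (C.baseHom (fiberLeft φ x) ≫ ·)
    (D.baseIso (fiberRight φ x)).inv_hom_id)

/-- The isomorphism is Φ applied to the comparison of sections. After forgetting the leg, the
comparisons built into Φ cancel against those in the squares, and what is left is the identity
`fiberHom_comp`. -/
lemma compatible_curveSquare (hgn : 2 < 2 * g + n) :
    (curveSquare hgn C).Compatible φ (curveSquare hgn D) := by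
  let ν : (Pts.map (conePullback φ)).comp (curveSquare hgn C).U ≅
      (Pts.map (coneFiberFst φ)).comp (curveSquare hgn D).U :=
    BasedNatIso.mkNatIso (Functor.isoWhiskerRight (fiberSectionIso φ C D) (addLegFunctor hgn))
      (fun x => by
        have := fiberSectionHom_isHomLift φ C D x
        exact BasedFunctor.preserves_isHomLift (addLeg hgn) (𝟙 (Pts.base x))
          (fiberSectionHom φ C D x))
  refine ⟨ν, fun x => ?_⟩
  let a : C.sectionFunctor.obj ((Pts.mapFunctor (conePullback φ)).obj x) ⟶ _ :=
    fiberSectionHom φ C D x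
  have h1 : (forgetFunctor hgn).map ((addLegFunctor hgn).map a) ≫
      Pts.Hom.base (addLegHom hgn (D.sectionFunctor.obj ((Pts.mapFunctor (coneFiberFst φ)).obj x))) =
      Pts.Hom.base (addLegHom hgn (C.sectionFunctor.obj ((Pts.mapFunctor (conePullback φ)).obj x))) ≫
        fiberHom φ C D x := congrArg Pts.Hom.base (toSections_addLeg_comp hgn a)
  refine (Category.assoc _ _ _).symm.trans
    ((congrArg (· ≫ D.toCurve (fiberRight φ x)) h1).trans ?_)
  refine (Category.assoc _ _ _).trans ((congrArg (_ ≫ ·) (fiberHom_comp φ C D x)).trans ?_)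
  exact (Category.assoc _ _ _).symm

end Compatible

end MTrop

end TropicalModuli

end

theorem theorem2 (g n : ℕ) (hgn : 2 < 2 * g + n) :
    (∃ Φ : BasedFunctor (MTrop.universalCurve g n) (MTrop.based g (n + 1)),
      Φ.toFunctor.IsEquivalence ∧
      Nonempty (Φ.comp (MTrop.forget hgn) ≅ MTrop.universalCurveProj g n) ∧
      ∀ x : Pts (MTrop.sections g n),
        MTrop.lastWeight (Φ.obj x) = TropicalCurve.sectionWeight x.base.curve x.pt) ∧
    (∀ A : MTrop g n, Nonempty (MTrop.ClassifyingMap A)) ∧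
    ∀ u : ∀ A : MTrop g n, MTrop.ClassifyingMap A,
      ∃ S : ∀ A : MTrop g n, MTrop.CurveSquare hgn (u A),
        (∀ A : MTrop g n, IsTwoCartesian (S A).β) ∧
        (∀ (A : MTrop g n) (s : A.curve.Section),
          MTrop.lastWeight ((S A).U.obj (A.sectionPoint s)) = A.curve.sectionWeight s) ∧
        ∀ (A B : MTrop g n) (φ : A ⟶ B), (S A).Compatible φ (S B) := by
  refine ⟨⟨MTrop.addLeg hgn, MTrop.addLegFunctor_isEquivalence hgn,
    ⟨MTrop.addLegForgetIso hgn⟩, MTrop.lastWeight_addLeg hgn⟩, MTrop.nonempty_classifyingMap,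
    fun u => ⟨fun A => MTrop.curveSquare hgn (u A), fun A => ?_, fun A s => ?_, fun A B φ => ?_⟩⟩
  · exact MTrop.isTwoCartesian_curveSquare hgn (u A)
  · exact MTrop.lastWeight_curveSquare hgn (u A) s
  · exact MTrop.compatible_curveSquare φ (u A) (u B) hgn
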